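/- **Setting.** Let $A\in\mathbb R^{r\times r}$, $E\in\mathbb R^{r\times n}$, $C\in\mathbb R^{n\times r}$, $D\in\mathbb R^{n\times n}$, $B\in\mathbb R^{n\times m}$, $H\in\mathbb R^{q\times r}$, $J\in\mathbb R^{q\times m}$, a scalar $\gamma>0$ and gains $K_0\in\mathbb R^{m\times r}$, $K=[K_1\ K_2]\in\mathbb R^{m\times 2n}$ be given. For $\alpha>0$ put $c(\sigma)=\|\sigma\|^{-1/2}+\alpha$ and consider the closed loop $$\dot\zeta=A\zeta+E\sigma,\qquad \dot\sigma=C\zeta+D\sigma+Bu+f(t),\qquad \dot\eta=c(\sigma)^2\sigma,\qquad u=K_0\zeta+c(\sigma)K_1\sigma+K_2\eta ,$$ whose solutions are understood in the sense of Filippov. The disturbance $f:[0,\infty)\to\mathbb R^n$ is *admissible* if it is locally absolutely continuous (e.g. smooth or Lipschitz) and $\|(BK_2)^{-1}\dot f(t)\|\le\gamma^{-1}$ for almost all $t\ge0$; equivalently, $w=c(\sigma)^{-1}(BK_2)^{-1}\dot f$ satisfies $\|w\|^2\le c(\sigma)^{-2}\gamma^{-2}$. Put $z=\eta+(BK_2)^{-1}f$,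 $x=(\sigma,z)\in\mathbb R^{2n}$, $\xi=(H+JK_0)\zeta$, $C_0=C+BK_0$, $R(\sigma)=\mathrm{diag}(c(\sigma)I_n,I_n)$, $$v(\zeta)=\zeta^TS\zeta,\qquad V(x)=x^TR(\sigma)PR(\sigma)x,\qquad \nu(\zeta,x)=\max\{v(\zeta),V(x)\}$$ (with $V$ extended by continuity to $\sigma=0$). Let $G_0=[I_n\ 0]$, $F_0=[0\ I_n]^T$, $E_0=[\tfrac12I_n\ 0]^T$, $A_K=\begin{bmatrix}BK_1&BK_2\\ I_n&0\end{bmatrix}$. Scalars $\alpha,\rho>0$, a matrix $Z_d=\mathrm{diag}(\mu I_n,\beta I_n,\varpi I_n,\kappa I_n)>0$ and symmetric matrices $S>0$ ($r\times r$), $P>0$ ($2n\times2n$) are called *feasible* if $$A_K^TP+PA_K+P\begin{bmatrix}E_0^T\\F_0^T\\G_0\\G_0\end{bmatrix}^TZ_d\begin{bmatrix}E_0^T\\F_0^T\\G_0\\G_0\end{bmatrix}P+\begin{bmatrix}BK\\\gamma^{-1}G_0\\\alpha^{-1}DG_0\\0\end{bmatrix}^TZ_d^{-1}\begin{bmatrix}BK\\\gamma^{-1}G_0\\\alpha^{-1}DG_0\\0\end{bmatrix}+\rho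 P<0,$$ $$\begin{bmatrix}A^TS+SA+\rho S&\bullet&\bullet\\\alpha^{-1}G_0^TE^TS&-\rho P&\bullet\\H+JK_0&0&-I_q\end{bmatrix}<0,\qquad\begin{bmatrix}\rho S&\bullet&\bullet\\C_0&\kappa I_n&\bullet\\H+JK_0&0&\alpha I_q\end{bmatrix}>0 ,$$ where $\bullet$ denotes the blocks given by symmetry. **Theorem.** Let an initial condition $(\zeta_0,x_0)$ be given and assume that a feasible $(\alpha,\rho,Z_d,S,P)$ exists. 1. For every feasible $(\alpha,\rho,Z_d,S,P)$, the closed loop with this $\alpha$ is globally asymptotically stable in the coordinates $(\zeta,x)$ for all admissible disturbances: from every initial state there is a solution on $[0,\infty)$; every solution on an interval $[0,T)$ extends to $[0,\infty)$; the origin is Lyapunov stable, uniformly over the admissible disturbances; and every solution on $[0,\infty)$ satisfies $(\zeta(t),x(t))\to(0,0)$ as $t\to\infty$. Moreover $$\sup\int_0^\infty\xi^T\xi\,dt\le\nu(\zeta_0,x_0),$$ the supremum being over all admissible disturbances and all closed-loop solutions starting at $(\zeta_0,x_0)$. 2. The best cost guaranteed in this way is $$\varrho_{rob}^2=\inf\{\nu(\zeta_0,x_0):(\alpha,\rho,Z_d,S,P)\text{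 feasible}\}:$$ this infimum is a real number, namely the greatest lower bound of the guaranteed costs $\nu(\zeta_0,x_0)$, and for every $\varepsilon>0$ there is a feasible $(\alpha,\rho,Z_d,S,P)$ for which the closed loop is globally asymptotically stable and $\sup\int_0^\infty\xi^T\xi\,dt\le\varrho_{rob}^2+\varepsilon$. -/

import Mathlib

open MeasureTheory Set Filter Topology
open scoped Matrix ENNReal

noncomputable section

namespace MGSTA

/-! ### Filippov solutions -/

/-- Filippov's regularization of a (possibly discontinuous) vector field `g` at the point `p`:
the intersection, over all radii `δ > 0` and all Lebesgue-null sets `N`, of the closed convex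
hulls of `g (ball p δ \ N)`. -/
def filippovMap {X : Type*} [NormedAddCommGroup X] [NormedSpace ℝ X] [MeasureSpace X]
    (g : X → X) (p : X) : Set X :=
  ⋂ (δ : ℝ) (_ : 0 < δ) (N : Set X) (_ : volume N = 0),
    closure (convexHull ℝ (g '' (Metric.ball p δ \ N)))

/-- `y` is a Filippov solution of `y' = g t y` on the interval `[0, T)`, with `0 < T ≤ ∞`
(`T = ⊤` gives `[0, ∞)`): it is absolutely continuous on every compact interval
`[0, b] ⊆ [0, T)` and satisfies the Filippov inclusion at almost every time. -/
def IsFilippovSolution {X : Type*} [NormedAddCommGroup X] [NormedSpace ℝ X] [MeasureSpace X]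
    (g : ℝ → X → X) (T : EReal) (y : ℝ → X) : Prop :=
  (∀ b : ℝ, 0 ≤ b → (b : EReal) < T → AbsolutelyContinuousOnInterval y 0 b) ∧
  ∀ᵐ t : ℝ, 0 < t → (t : EReal) < T →
    ∃ d : X, HasDerivAt y d t ∧ d ∈ filippovMap (g t) (y t)

/-! ### The plant and the control law -/

/-- The matrices of the plant `ζ' = A ζ + E σ`, `σ' = C ζ + D σ + B u + f`. -/
structure Plant (r n m : ℕ) where
  A : Matrix (Fin r) (Fin r) ℝ
  E : Matrix (Fin r) (Fin n) ℝ
  C : Matrix (Fin n) (Fin r) ℝ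
  D : Matrix (Fin n) (Fin n) ℝ
  B : Matrix (Fin n) (Fin m) ℝ

/-- The Euclidean norm of a real vector (the instance norm on `Fin n → ℝ` is the sup norm). -/
def euclNorm {ι : Type*} [Fintype ι] (v : ι → ℝ) : ℝ := Real.sqrt (v ⬝ᵥ v)

/-- The scalar function `c(σ) = 1 / √‖σ‖ + α`. The value at `σ = 0` plays no role in the
dynamics (the singleton is negligible for the Filippov regularization). -/
def cFun {n : ℕ} (α : ℝ) (σ : Fin n → ℝ) : ℝ := 1 / Real.sqrt (euclNorm σ) + α

/-- States `(ζ, σ, η)` of the closed loop. -/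
abbrev State (r n : ℕ) : Type := (Fin r → ℝ) × (Fin n → ℝ) × (Fin n → ℝ)

variable {r n m q : ℕ}

/-- The control `u = K₀ ζ + c(σ) K₁ σ + K₂ η`, where `K = [K₁ K₂]`. -/
def control (α : ℝ) (K₀ : Matrix (Fin m) (Fin r) ℝ) (K : Matrix (Fin m) (Fin n ⊕ Fin n) ℝ)
    (s : State r n) : Fin m → ℝ :=
  K₀ *ᵥ s.1 + cFun α s.2.1 • (K.toCols₁ *ᵥ s.2.1) + K.toCols₂ *ᵥ s.2.2

/-- The vector field of the plant in closed loop with the control law and the integrator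
`η' = c(σ)² σ`, under the disturbance `f`. -/
def closedLoop (G : Plant r n m) (α : ℝ) (K₀ : Matrix (Fin m) (Fin r) ℝ)
    (K : Matrix (Fin m) (Fin n ⊕ Fin n) ℝ) (f : ℝ → Fin n → ℝ) (t : ℝ) (s : State r n) :
    State r n :=
  (G.A *ᵥ s.1 + G.E *ᵥ s.2.1,
   G.C *ᵥ s.1 + G.D *ᵥ s.2.1 + G.B *ᵥ control α K₀ K s + f t,
   cFun α s.2.1 ^ 2 • s.2.1)

/-- Admissible disturbances: `f` is locally absolutely continuous on `[0, ∞)` (smooth functions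
and Lipschitz functions are) and `‖(B K₂)⁻¹ f'(t)‖ ≤ γ⁻¹` for almost all `t ≥ 0`, that is,
`w = c(σ)⁻¹ (B K₂)⁻¹ f'` satisfies `‖w‖² ≤ c(σ)⁻² γ⁻²`. -/
def Admissible (G : Plant r n m) (K : Matrix (Fin m) (Fin n ⊕ Fin n) ℝ) (γ : ℝ)
    (f : ℝ → Fin n → ℝ) : Prop :=
  (∀ b : ℝ, 0 ≤ b → AbsolutelyContinuousOnInterval f 0 b) ∧
  ∀ᵐ t : ℝ, 0 < t → euclNorm ((G.B * K.toCols₂)⁻¹ *ᵥ deriv f t) ≤ γ⁻¹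

/-- The state `x = (σ, z)` with `z = η + (B K₂)⁻¹ f(t)`. -/
def xState (G : Plant r n m) (K : Matrix (Fin m) (Fin n ⊕ Fin n) ℝ) (f : ℝ → Fin n → ℝ)
    (t : ℝ) (s : State r n) : Fin n ⊕ Fin n → ℝ :=
  Sum.elim s.2.1 (s.2.2 + (G.B * K.toCols₂)⁻¹ *ᵥ f t)

/-- Global (robust) asymptotic stability of the origin of the closed loop in the coordinates
`(ζ, x)`, for all admissible disturbances: existence of solutions from every initial state,
no finite escape time, Lyapunov stability (uniformly over the disturbances) and global
attractivity. -/
def GloballyAsymptoticallyStable (G : Plant r n m) (α γ : ℝ) (K₀ : Matrix (Fin m) (Fin r) ℝ)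
    (K : Matrix (Fin m) (Fin n ⊕ Fin n) ℝ) : Prop :=
  (∀ f, Admissible G K γ f → ∀ s₀ : State r n,
    ∃ y, IsFilippovSolution (closedLoop G α K₀ K f) ⊤ y ∧ y 0 = s₀) ∧
  (∀ f, Admissible G K γ f → ∀ (T : EReal) (y : ℝ → State r n),
    IsFilippovSolution (closedLoop G α K₀ K f) T y →
    ∃ Y, IsFilippovSolution (closedLoop G α K₀ K f) ⊤ Y ∧
      ∀ t : ℝ, 0 ≤ t → (t : EReal) < T → Y t = y t) ∧
  (∀ ε : ℝ, 0 < ε → ∃ δ : ℝ, 0 < δ ∧ ∀ f, Admissible G K γ f → ∀ y : ℝ → State r n,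
    IsFilippovSolution (closedLoop G α K₀ K f) ⊤ y →
    ‖((y 0).1, xState G K f 0 (y 0))‖ < δ →
    ∀ t : ℝ, 0 ≤ t → ‖((y t).1, xState G K f t (y t))‖ < ε) ∧
  (∀ f, Admissible G K γ f → ∀ y : ℝ → State r n,
    IsFilippovSolution (closedLoop G α K₀ K f) ⊤ y →
    Tendsto (fun t => ((y t).1, xState G K f t (y t))) atTop (𝓝 0))

/-- The controlled output `ξ = (H + J K₀) ζ`. -/
def output (H : Matrix (Fin q) (Fin r) ℝ) (J : Matrix (Fin q) (Fin m) ℝ)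
    (K₀ : Matrix (Fin m) (Fin r) ℝ) (ζ : Fin r → ℝ) : Fin q → ℝ :=
  (H + J * K₀) *ᵥ ζ

/-- The worst-case cost: the supremum of `∫₀^∞ ξᵀ ξ dt` over all admissible disturbances and
all closed-loop solutions with initial condition `(ζ₀, x₀)`. -/
def worstCaseCost (G : Plant r n m) (H : Matrix (Fin q) (Fin r) ℝ)
    (J : Matrix (Fin q) (Fin m) ℝ) (α γ : ℝ) (K₀ : Matrix (Fin m) (Fin r) ℝ)
    (K : Matrix (Fin m) (Fin n ⊕ Fin n) ℝ) (ζ₀ : Fin r → ℝ) (x₀ : Fin n ⊕ Fin n → ℝ) : ℝ≥0∞ :=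
  ⨆ (f : ℝ → Fin n → ℝ) (_ : Admissible G K γ f) (y : ℝ → State r n)
    (_ : IsFilippovSolution (closedLoop G α K₀ K f) ⊤ y)
    (_ : (y 0).1 = ζ₀ ∧ xState G K f 0 (y 0) = x₀),
    ∫⁻ t in Ioi (0 : ℝ), ENNReal.ofReal (output H J K₀ (y t).1 ⬝ᵥ output H J K₀ (y t).1)

/-! ### Lyapunov functions -/

/-- `R(σ) = diag(c(σ) Iₙ, Iₙ)`. -/
def Rmat (α : ℝ) (σ : Fin n → ℝ) : Matrix (Fin n ⊕ Fin n) (Fin n ⊕ Fin n) ℝ :=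
  Matrix.fromBlocks (cFun α σ • 1) 0 0 1

/-- `v(ζ) = ζᵀ S ζ`. -/
def vFun (S : Matrix (Fin r) (Fin r) ℝ) (ζ : Fin r → ℝ) : ℝ := ζ ⬝ᵥ (S *ᵥ ζ)

/-- `V(x) = xᵀ R(σ) P R(σ) x`, with `σ` the first block of `x`. At `σ = 0` one has
`R(σ) x = (0, z)`, so that this is the continuous extension of `V`. -/
def VFun (α : ℝ) (P : Matrix (Fin n ⊕ Fin n) (Fin n ⊕ Fin n) ℝ) (x : Fin n ⊕ Fin n → ℝ) : ℝ :=
  x ⬝ᵥ ((Rmat α (x ∘ Sum.inl) * P * Rmat α (x ∘ Sum.inl)) *ᵥ x)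

/-- `ν(ζ, x) = max {v(ζ), V(x)}`. -/
def nuFun (α : ℝ) (S : Matrix (Fin r) (Fin r) ℝ) (P : Matrix (Fin n ⊕ Fin n) (Fin n ⊕ Fin n) ℝ)
    (ζ : Fin r → ℝ) (x : Fin n ⊕ Fin n → ℝ) : ℝ :=
  max (vFun S ζ) (VFun α P x)

/-! ### The matrix inequalities -/

/-- `E₀ = [½ Iₙ  0]ᵀ`. -/
def E0 (n : ℕ) : Matrix (Fin n ⊕ Fin n) (Fin n) ℝ := Matrix.fromRows ((1 / 2 : ℝ) • 1) 0

/-- `F₀ = [0  Iₙ]ᵀ`. -/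
def F0 (n : ℕ) : Matrix (Fin n ⊕ Fin n) (Fin n) ℝ := Matrix.fromRows 0 1

/-- `G₀ = [Iₙ  0]`. -/
def G0 (n : ℕ) : Matrix (Fin n) (Fin n ⊕ Fin n) ℝ := Matrix.fromCols 1 0

/-- `A_K = A₀ + B₀ K` with `A₀ = [0 0; Iₙ 0]` and `B₀ = [B; 0]`. -/
def AK (G : Plant r n m) (K : Matrix (Fin m) (Fin n ⊕ Fin n) ℝ) :
    Matrix (Fin n ⊕ Fin n) (Fin n ⊕ Fin n) ℝ :=
  Matrix.fromBlocks 0 0 1 0 + Matrix.fromRows G.B 0 * K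

/-- `C₀ = C + B K₀`. -/
def C0 (G : Plant r n m) (K₀ : Matrix (Fin m) (Fin r) ℝ) : Matrix (Fin n) (Fin r) ℝ :=
  G.C + G.B * K₀

/-- `Z_d = diag(μ Iₙ, β Iₙ, ϖ Iₙ, κ Iₙ)`. -/
def Zd (n : ℕ) (μ β ϖ κ : ℝ) :
    Matrix (Fin n ⊕ Fin n ⊕ Fin n ⊕ Fin n) (Fin n ⊕ Fin n ⊕ Fin n ⊕ Fin n) ℝ :=
  Matrix.diagonal (Sum.elim (fun _ => μ) (Sum.elim (fun _ => β)
    (Sum.elim (fun _ => ϖ) (fun _ => κ))))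

/-- The column `[E₀ᵀ; F₀ᵀ; G₀; G₀]`. -/
def colM (n : ℕ) : Matrix (Fin n ⊕ Fin n ⊕ Fin n ⊕ Fin n) (Fin n ⊕ Fin n) ℝ :=
  Matrix.fromRows (E0 n)ᵀ (Matrix.fromRows (F0 n)ᵀ (Matrix.fromRows (G0 n) (G0 n)))

/-- The column `[B K; γ⁻¹ G₀; α⁻¹ D G₀; 0]`. -/
def colN (G : Plant r n m) (α γ : ℝ) (K : Matrix (Fin m) (Fin n ⊕ Fin n) ℝ) :
    Matrix (Fin n ⊕ Fin n ⊕ Fin n ⊕ Fin n) (Fin n ⊕ Fin n) ℝ :=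
  Matrix.fromRows (G.B * K) (Matrix.fromRows (γ⁻¹ • G0 n)
    (Matrix.fromRows (α⁻¹ • (G.D * G0 n)) 0))

/-- The left-hand side of the Riccati-type inequality:
`A_Kᵀ P + P A_K + P Mᵀ Z_d M P + Nᵀ Z_d⁻¹ N + ρ P`, with `M = colM` and `N = colN`. -/
def riccatiMat (G : Plant r n m) (α γ ρ μ β ϖ κ : ℝ) (K : Matrix (Fin m) (Fin n ⊕ Fin n) ℝ)
    (P : Matrix (Fin n ⊕ Fin n) (Fin n ⊕ Fin n) ℝ) :
    Matrix (Fin n ⊕ Fin n) (Fin n ⊕ Fin n) ℝ :=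
  (AK G K)ᵀ * P + P * AK G K + P * (colM n)ᵀ * Zd n μ β ϖ κ * colM n * P
    + (colN G α γ K)ᵀ * (Zd n μ β ϖ κ)⁻¹ * colN G α γ K + ρ • P

/-- The symmetric block matrix
`[AᵀS + SA + ρS, •, •; α⁻¹ G₀ᵀ Eᵀ S, -ρP, •; H + J K₀, 0, -I]`. -/
def linearMat (G : Plant r n m) (H : Matrix (Fin q) (Fin r) ℝ) (J : Matrix (Fin q) (Fin m) ℝ)
    (α ρ : ℝ) (K₀ : Matrix (Fin m) (Fin r) ℝ) (S : Matrix (Fin r) (Fin r) ℝ)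
    (P : Matrix (Fin n ⊕ Fin n) (Fin n ⊕ Fin n) ℝ) :
    Matrix (Fin r ⊕ (Fin n ⊕ Fin n) ⊕ Fin q) (Fin r ⊕ (Fin n ⊕ Fin n) ⊕ Fin q) ℝ :=
  let W : Matrix ((Fin n ⊕ Fin n) ⊕ Fin q) (Fin r) ℝ :=
    Matrix.fromRows (α⁻¹ • ((G0 n)ᵀ * G.Eᵀ * S)) (H + J * K₀)
  Matrix.fromBlocks (G.Aᵀ * S + S * G.A + ρ • S) Wᵀ W (Matrix.fromBlocks (-(ρ • P)) 0 0 (-1))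

/-- The symmetric block matrix `[ρS, •, •; C₀, κI, •; H + J K₀, 0, αI]`. -/
def couplingMat (G : Plant r n m) (H : Matrix (Fin q) (Fin r) ℝ) (J : Matrix (Fin q) (Fin m) ℝ)
    (α ρ κ : ℝ) (K₀ : Matrix (Fin m) (Fin r) ℝ) (S : Matrix (Fin r) (Fin r) ℝ) :
    Matrix (Fin r ⊕ Fin n ⊕ Fin q) (Fin r ⊕ Fin n ⊕ Fin q) ℝ :=
  let W : Matrix (Fin n ⊕ Fin q) (Fin r) ℝ := Matrix.fromRows (C0 G K₀) (H + J * K₀)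
  Matrix.fromBlocks (ρ • S) Wᵀ W (Matrix.fromBlocks (κ • 1) 0 0 (α • 1))

/-- Feasibility of `(α, ρ, Z_d, S, P)` with `Z_d = diag(μI, βI, ϖI, κI)`: positivity of the
variables and the three matrix inequalities (`X < 0` means that `-X` is positive definite). -/
structure Feasible (G : Plant r n m) (H : Matrix (Fin q) (Fin r) ℝ)
    (J : Matrix (Fin q) (Fin m) ℝ) (γ : ℝ) (K₀ : Matrix (Fin m) (Fin r) ℝ)
    (K : Matrix (Fin m) (Fin n ⊕ Fin n) ℝ) (α ρ μ β ϖ κ : ℝ) (S : Matrix (Fin r) (Fin r) ℝ)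
    (P : Matrix (Fin n ⊕ Fin n) (Fin n ⊕ Fin n) ℝ) : Prop where
  alpha_pos : 0 < α
  rho_pos : 0 < ρ
  mu_pos : 0 < μ
  beta_pos : 0 < β
  varpi_pos : 0 < ϖ
  kappa_pos : 0 < κ
  S_pos : S.PosDef
  P_pos : P.PosDef
  riccati : (-(riccatiMat G α γ ρ μ β ϖ κ K P)).PosDef
  linear : (-(linearMat G H J α ρ K₀ S P)).PosDef
  coupling : (couplingMat G H J α ρ κ K₀ S).PosDef

/-- The set of guaranteed costs: the values `ν(ζ₀, x₀)` over all feasible `α, ρ, Z_d, S, P`. -/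
def guaranteedCosts (G : Plant r n m) (H : Matrix (Fin q) (Fin r) ℝ)
    (J : Matrix (Fin q) (Fin m) ℝ) (γ : ℝ) (K₀ : Matrix (Fin m) (Fin r) ℝ)
    (K : Matrix (Fin m) (Fin n ⊕ Fin n) ℝ) (ζ₀ : Fin r → ℝ) (x₀ : Fin n ⊕ Fin n → ℝ) : Set ℝ :=
  {θ | ∃ α ρ μ β ϖ κ S P, Feasible G H J γ K₀ K α ρ μ β ϖ κ S P ∧ θ = nuFun α S P ζ₀ x₀}

/-- The best guaranteed cost `ϱ_rob²`. -/
def rhoRobSq (G : Plant r n m) (H : Matrix (Fin q) (Fin r) ℝ)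
    (J : Matrix (Fin q) (Fin m) ℝ) (γ : ℝ) (K₀ : Matrix (Fin m) (Fin r) ℝ)
    (K : Matrix (Fin m) (Fin n ⊕ Fin n) ℝ) (ζ₀ : Fin r → ℝ) (x₀ : Fin n ⊕ Fin n → ℝ) : ℝ :=
  sInf (guaranteedCosts G H J γ K₀ K ζ₀ x₀)

end MGSTA

end

/-!
The function `ν = max {v, V}` is a Lyapunov function with supply rate `‖ξ‖²`. In the coordinates
`y = R(σ) x = (c(σ) σ, z)` the closed loop reads, away from `σ = 0`, `y' = c (A_K y + …)`, where
the omitted terms are exactly the uncertainties weighted by `Z_d` in the Riccati inequality: the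
derivative of `c` contributes a rank-one contraction along `σ` (`half_projection_le`), the
disturbance satisfies `‖w‖ ≤ γ⁻¹ ‖c σ‖`, and `D σ = c⁻¹ D (c σ)` with `c ≥ α`. Young's inequality
then gives `V' ≤ c (ρ (v - V) - α⁻¹ ‖ξ‖² - l V)` (`V_decay`), where the third matrix inequality
absorbs the input of `ζ` (`coupling_bound`), and the second one gives
`v' ≤ ρ (V - v) - ‖ξ‖² - l v` (`linear_bound`). Whichever of `v`, `V` is the larger one thus
decreases at least with rate `l ν + ‖ξ‖²`.

At `σ = 0` the function `V` is not locally Lipschitz, and it need not be absolutely continuous along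
trajectories. Since `σ` is continuously differentiable along trajectories, its zeros with `σ' ≠ 0`
are isolated, and continuity of `ν` suffices there. If `σ = σ' = 0`, then `B K₂ z = -C₀ ζ`, and the
Riccati inequality tested with `y = (0, z)` shows `V < v` unless the state is zero
(`sliding_bound`). So `ν` agrees with the smooth function `v` near such times. Hence `ν + ∫ (l ν +
‖ξ‖²)` decreases to the right of every time at which `ν > 0` (`eventually_nuAlong_le`), which is
enough for a global dissipation inequality (`dissipation_of_local`). It yields the cost bound,
stability, and `l t ν(t) ≤ ν(0)`, which is attractivity.

Existence is obtained from Euler polygons. Their increments are averages of values of the vector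
field, so every velocity of a limit lies in the closed convex hull of nearby values
(`exists_euler_limit`). For the closed loop these hulls, like Filippov's, leave all components of the
velocity determined except `η'` at `σ = 0`, which ranges over the unit ball (`IsVelocity`).
A solution on `[0, T)` is bounded because `ν` does not increase, hence it is Lipschitz and can be
continued beyond `T` (`exists_extension`).
-/

namespace MGSTA

variable {r n m q : ℕ}

/-! ### Quadratic forms and the matrix inequalities -/

/-- A positive definite form dominates a positive multiple of every other quadratic form. -/
theorem posDef_dominates {ι : Type*} [Fintype ι] {M : Matrix ι ι ℝ} (hM : M.PosDef)
    (N : Matrix ι ι ℝ) :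
    ∃ ε > 0, ∀ x : ι → ℝ, ε * (x ⬝ᵥ N *ᵥ x) ≤ x ⬝ᵥ M *ᵥ x := by
  have hc : ∀ A : Matrix ι ι ℝ, Continuous fun x : ι → ℝ => x ⬝ᵥ A *ᵥ x := fun A => by fun_prop
  have hK : IsCompact (Metric.sphere (0 : ι → ℝ) 1) := isCompact_sphere _ _
  obtain hE | hE := (Metric.sphere (0 : ι → ℝ) 1).eq_empty_or_nonempty
  · refine ⟨1, one_pos, fun x => ?_⟩
    obtain rfl | hx := eq_or_ne x 0
    · simp
    · have : ‖x‖⁻¹ • x ∈ Metric.sphere (0 : ι → ℝ) 1 := by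
        simp [norm_smul, norm_ne_zero_iff.2 hx]
      simp [hE] at this
  obtain ⟨a, ha, hamin⟩ := hK.exists_isMinOn hE (hc M).continuousOn
  obtain ⟨C, hC⟩ := hK.exists_bound_of_continuousOn (hc N).continuousOn
  have ha0 : a ≠ 0 := by rintro rfl; simp at ha
  have hm : 0 < a ⬝ᵥ M *ᵥ a := by simpa using hM.dotProduct_mulVec_pos ha0
  set m := a ⬝ᵥ M *ᵥ a
  have hC1 : 0 < |C| + 1 := by positivity
  refine ⟨m / (|C| + 1), by positivity, fun x => ?_⟩
  obtain rfl | hx := eq_or_ne x 0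
  · simp
  have hn : 0 < ‖x‖ := norm_pos_iff.2 hx
  have hu : ‖x‖⁻¹ • x ∈ Metric.sphere (0 : ι → ℝ) 1 := by
    simp [norm_smul, hn.ne']
  have hscale : ∀ A : Matrix ι ι ℝ, x ⬝ᵥ A *ᵥ x
      = ‖x‖ ^ 2 * ((‖x‖⁻¹ • x) ⬝ᵥ A *ᵥ (‖x‖⁻¹ • x)) := fun A => by
    rw [Matrix.mulVec_smul, smul_dotProduct, dotProduct_smul, smul_eq_mul, smul_eq_mul]
    field_simp
  have h1 : m ≤ (‖x‖⁻¹ • x) ⬝ᵥ M *ᵥ (‖x‖⁻¹ • x) := hamin hu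
  have h2 : (‖x‖⁻¹ • x) ⬝ᵥ N *ᵥ (‖x‖⁻¹ • x) ≤ |C| + 1 := by
    have := hC _ hu
    rw [Real.norm_eq_abs] at this
    linarith [le_abs_self ((‖x‖⁻¹ • x) ⬝ᵥ N *ᵥ (‖x‖⁻¹ • x)), le_abs_self C]
  rw [hscale M, hscale N]
  calc m / (|C| + 1) * (‖x‖ ^ 2 * ((‖x‖⁻¹ • x) ⬝ᵥ N *ᵥ (‖x‖⁻¹ • x)))
      = ‖x‖ ^ 2 * (m / (|C| + 1) * ((‖x‖⁻¹ • x) ⬝ᵥ N *ᵥ (‖x‖⁻¹ • x))) := by ring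
    _ ≤ ‖x‖ ^ 2 * (m / (|C| + 1) * (|C| + 1)) := by gcongr
    _ = ‖x‖ ^ 2 * m := by field_simp
    _ ≤ _ := by gcongr

theorem posDef_coercive {ι : Type*} [Fintype ι] {M : Matrix ι ι ℝ} (hM : M.PosDef) :
    ∃ ε > 0, ∀ x : ι → ℝ, ε * (x ⬝ᵥ x) ≤ x ⬝ᵥ M *ᵥ x := by
  classical
  simpa using posDef_dominates hM 1

theorem posDef_form_nonneg {ι : Type*} [Fintype ι] {M : Matrix ι ι ℝ} (hM : M.PosDef)
    (x : ι → ℝ) : 0 ≤ x ⬝ᵥ M *ᵥ x := by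
  simpa using hM.posSemidef.dotProduct_mulVec_nonneg x

theorem posDef_transpose_eq {ι : Type*} [Fintype ι] {M : Matrix ι ι ℝ} (hM : M.PosDef) :
    Mᵀ = M := by
  rw [← Matrix.conjTranspose_eq_transpose_of_trivial]
  exact hM.isHermitian

theorem posDef_form_comm {ι : Type*} [Fintype ι] {M : Matrix ι ι ℝ} (hM : M.PosDef)
    (x y : ι → ℝ) : x ⬝ᵥ M *ᵥ y = (M *ᵥ x) ⬝ᵥ y := by
  rw [Matrix.dotProduct_mulVec, ← Matrix.mulVec_transpose, posDef_transpose_eq hM]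

theorem dotProduct_self_nonneg' {ι : Type*} [Fintype ι] (x : ι → ℝ) : 0 ≤ x ⬝ᵥ x :=
  Finset.sum_nonneg fun i _ => mul_self_nonneg (x i)

/-- Young's inequality for the dot product. -/
theorem two_mul_dotProduct_le {ι : Type*} [Fintype ι] {k : ℝ} (hk : 0 < k) (x y : ι → ℝ) :
    2 * (x ⬝ᵥ y) ≤ k * (x ⬝ᵥ x) + k⁻¹ * (y ⬝ᵥ y) := by
  have h := dotProduct_self_nonneg' (k • x - y)
  have e : (k • x - y) ⬝ᵥ (k • x - y) = k ^ 2 * (x ⬝ᵥ x) - 2 * k * (x ⬝ᵥ y) + y ⬝ᵥ y := by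
    simp only [sub_dotProduct, dotProduct_sub, smul_dotProduct, dotProduct_smul, smul_eq_mul,
      dotProduct_comm y x]
    ring
  rw [e] at h
  have : 0 ≤ k⁻¹ * (k ^ 2 * (x ⬝ᵥ x) - 2 * k * (x ⬝ᵥ y) + y ⬝ᵥ y) := by positivity
  have e2 : k⁻¹ * (k ^ 2 * (x ⬝ᵥ x) - 2 * k * (x ⬝ᵥ y) + y ⬝ᵥ y)
      = k * (x ⬝ᵥ x) - 2 * (x ⬝ᵥ y) + k⁻¹ * (y ⬝ᵥ y) := by
    field_simp
  linarith

theorem AK_mulVec (G : Plant r n m) (K : Matrix (Fin m) (Fin n ⊕ Fin n) ℝ)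
    (y : Fin n ⊕ Fin n → ℝ) :
    AK G K *ᵥ y = Sum.elim ((G.B * K) *ᵥ y) (y ∘ Sum.inl) := by
  rw [AK, Matrix.add_mulVec, Matrix.fromBlocks_mulVec, ← Matrix.mulVec_mulVec,
    Matrix.fromRows_mulVec, Matrix.mulVec_mulVec]
  ext (i | i) <;> simp

theorem sum_elim_dotProduct {ι κ : Type*} [Fintype ι] [Fintype κ] (a : ι → ℝ) (b : κ → ℝ)
    (u : ι ⊕ κ → ℝ) :
    u ⬝ᵥ Sum.elim a b = (u ∘ Sum.inl) ⬝ᵥ a + (u ∘ Sum.inr) ⬝ᵥ b := by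
  simp [dotProduct]

theorem colM_mulVec (u : Fin n ⊕ Fin n → ℝ) :
    colM n *ᵥ u = Sum.elim ((1 / 2 : ℝ) • (u ∘ Sum.inl)) (Sum.elim (u ∘ Sum.inr)
      (Sum.elim (u ∘ Sum.inl) (u ∘ Sum.inl))) := by
  have h : ∀ u : Fin n ⊕ Fin n → ℝ, u = Sum.elim (u ∘ Sum.inl) (u ∘ Sum.inr) := fun u => by simp
  rw [colM, E0, F0, G0, Matrix.transpose_fromRows, Matrix.transpose_fromRows]
  simp only [Matrix.fromRows_mulVec]
  simp only [Matrix.fromCols_mulVec]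
  simp [Matrix.smul_mulVec]

theorem colN_mulVec (G : Plant r n m) (α γ : ℝ) (K : Matrix (Fin m) (Fin n ⊕ Fin n) ℝ)
    (y : Fin n ⊕ Fin n → ℝ) :
    colN G α γ K *ᵥ y = Sum.elim ((G.B * K) *ᵥ y) (Sum.elim (γ⁻¹ • (y ∘ Sum.inl))
      (Sum.elim (α⁻¹ • (G.D *ᵥ (y ∘ Sum.inl))) 0)) := by
  rw [colN]
  simp only [Matrix.fromRows_mulVec, Matrix.smul_mulVec, ← Matrix.mulVec_mulVec, G0,
    Matrix.fromCols_mulVec]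
  simp

/-- The form of the weight `Z_d`, and of its inverse, is a weighted sum of squares. -/
theorem Zd_form (μ β ϖ κ : ℝ) (a b c d : Fin n → ℝ) :
    Sum.elim a (Sum.elim b (Sum.elim c d)) ⬝ᵥ
      Zd n μ β ϖ κ *ᵥ Sum.elim a (Sum.elim b (Sum.elim c d))
      = μ * (a ⬝ᵥ a) + β * (b ⬝ᵥ b) + ϖ * (c ⬝ᵥ c) + κ * (d ⬝ᵥ d) := by
  simp only [Zd, Matrix.mulVec_diagonal, dotProduct, Fintype.sum_sum_type, Sum.elim_inl,
    Sum.elim_inr, Finset.mul_sum]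
  simp only [add_assoc]
  congr 1
  · exact Finset.sum_congr rfl fun i _ => by ring
  congr 1
  · exact Finset.sum_congr rfl fun i _ => by ring
  congr 1 <;> exact Finset.sum_congr rfl fun i _ => by ring

theorem Zd_inv {μ β ϖ κ : ℝ} (hμ : 0 < μ) (hβ : 0 < β) (hϖ : 0 < ϖ) (hκ : 0 < κ) :
    (Zd n μ β ϖ κ)⁻¹ = Zd n μ⁻¹ β⁻¹ ϖ⁻¹ κ⁻¹ := by
  apply Matrix.inv_eq_right_inv
  rw [Zd, Zd, Matrix.diagonal_mul_diagonal, ← Matrix.diagonal_one]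
  congr 1
  ext (i | i | i | i) <;> simp [hμ.ne', hβ.ne', hϖ.ne', hκ.ne']

theorem riccati_form (G : Plant r n m) {α γ ρ μ β ϖ κ : ℝ} (hμ : 0 < μ) (hβ : 0 < β) (hϖ : 0 < ϖ)
    (hκ : 0 < κ) (K : Matrix (Fin m) (Fin n ⊕ Fin n) ℝ)
    {P : Matrix (Fin n ⊕ Fin n) (Fin n ⊕ Fin n) ℝ} (hP : P.PosDef) (y : Fin n ⊕ Fin n → ℝ) :
    y ⬝ᵥ riccatiMat G α γ ρ μ β ϖ κ K P *ᵥ y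
      = 2 * (((P *ᵥ y) ∘ Sum.inl) ⬝ᵥ ((G.B * K) *ᵥ y) + ((P *ᵥ y) ∘ Sum.inr) ⬝ᵥ (y ∘ Sum.inl))
        + (μ / 4 + ϖ + κ) * (((P *ᵥ y) ∘ Sum.inl) ⬝ᵥ ((P *ᵥ y) ∘ Sum.inl))
        + β * (((P *ᵥ y) ∘ Sum.inr) ⬝ᵥ ((P *ᵥ y) ∘ Sum.inr))
        + μ⁻¹ * (((G.B * K) *ᵥ y) ⬝ᵥ ((G.B * K) *ᵥ y))
        + β⁻¹ * (γ⁻¹ ^ 2 * ((y ∘ Sum.inl) ⬝ᵥ (y ∘ Sum.inl)))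
        + ϖ⁻¹ * (α⁻¹ ^ 2 * ((G.D *ᵥ (y ∘ Sum.inl)) ⬝ᵥ (G.D *ᵥ (y ∘ Sum.inl))))
        + ρ * (y ⬝ᵥ P *ᵥ y) := by
  have ht : ∀ {ι κ : Type} [Fintype ι] [Fintype κ] (M : Matrix ι κ ℝ) (a : κ → ℝ) (b : ι → ℝ),
      a ⬝ᵥ Mᵀ *ᵥ b = (M *ᵥ a) ⬝ᵥ b := fun M a b => by
    rw [Matrix.dotProduct_mulVec, Matrix.vecMul_transpose]
  rw [riccatiMat, Zd_inv hμ hβ hϖ hκ]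
  simp only [Matrix.add_mulVec, dotProduct_add, ← Matrix.mulVec_mulVec, Matrix.smul_mulVec,
    dotProduct_smul, smul_eq_mul]
  rw [ht, posDef_form_comm hP y (AK G K *ᵥ y), dotProduct_comm (AK G K *ᵥ y), AK_mulVec,
    sum_elim_dotProduct, posDef_form_comm hP y ((colM n)ᵀ *ᵥ _), ht, ht, colM_mulVec, colN_mulVec,
    Zd_form, Zd_form]
  simp only [smul_dotProduct, dotProduct_smul, smul_eq_mul, dotProduct_zero, mul_zero,
    ← Matrix.mulVec_mulVec]
  ring

/-- The Riccati inequality as a dissipation estimate. With `u = P y`, the vectors `w₁, w₂, w₃`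
are the uncertainties bounded by the rows of `colN`, and `w₄` is the input from `ζ`. -/
theorem riccati_bound {G : Plant r n m} {H : Matrix (Fin q) (Fin r) ℝ}
    {J : Matrix (Fin q) (Fin m) ℝ} {γ : ℝ} {K₀ : Matrix (Fin m) (Fin r) ℝ}
    {K : Matrix (Fin m) (Fin n ⊕ Fin n) ℝ} {α ρ μ β ϖ κ : ℝ} {S : Matrix (Fin r) (Fin r) ℝ}
    {P : Matrix (Fin n ⊕ Fin n) (Fin n ⊕ Fin n) ℝ}
    (hF : Feasible G H J γ K₀ K α ρ μ β ϖ κ S P) :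
    ∃ l > 0, ∀ (y : Fin n ⊕ Fin n → ℝ) (w₁ w₂ w₃ w₄ : Fin n → ℝ),
      w₁ ⬝ᵥ w₁ ≤ ((G.B * K) *ᵥ y) ⬝ᵥ ((G.B * K) *ᵥ y) →
      w₂ ⬝ᵥ w₂ ≤ γ⁻¹ ^ 2 * ((y ∘ Sum.inl) ⬝ᵥ (y ∘ Sum.inl)) →
      w₃ ⬝ᵥ w₃ ≤ α⁻¹ ^ 2 * ((G.D *ᵥ (y ∘ Sum.inl)) ⬝ᵥ (G.D *ᵥ (y ∘ Sum.inl))) →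
      2 * (((P *ᵥ y) ∘ Sum.inl) ⬝ᵥ ((G.B * K) *ᵥ y + (1 / 2 : ℝ) • w₁ + (w₃ + w₄))
          + ((P *ᵥ y) ∘ Sum.inr) ⬝ᵥ (y ∘ Sum.inl + w₂))
        ≤ -((ρ + l) * (y ⬝ᵥ P *ᵥ y)) + κ⁻¹ * (w₄ ⬝ᵥ w₄) := by
  obtain ⟨l, hl, hl'⟩ := posDef_dominates hF.riccati P
  refine ⟨l, hl, fun y w₁ w₂ w₃ w₄ h₁ h₂ h₃ => ?_⟩
  have h := hl' y
  rw [Matrix.neg_mulVec, dotProduct_neg, riccati_form G hF.mu_pos hF.beta_pos hF.varpi_pos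
    hF.kappa_pos K hF.P_pos] at h
  set u₁ := (P *ᵥ y) ∘ Sum.inl
  set u₂ := (P *ᵥ y) ∘ Sum.inr
  have y₁ := two_mul_dotProduct_le (half_pos hF.mu_pos) u₁ w₁
  have y₂ := two_mul_dotProduct_le hF.beta_pos u₂ w₂
  have y₃ := two_mul_dotProduct_le hF.varpi_pos u₁ w₃
  have y₄ := two_mul_dotProduct_le hF.kappa_pos u₁ w₄
  have e₁ : (μ / 2)⁻¹ * (w₁ ⬝ᵥ w₁) = 2 * (μ⁻¹ * (w₁ ⬝ᵥ w₁)) := by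
    rw [inv_div]; ring
  have b₁ := mul_le_mul_of_nonneg_left h₁ (inv_pos.2 hF.mu_pos).le
  have b₂ := mul_le_mul_of_nonneg_left h₂ (inv_pos.2 hF.beta_pos).le
  have b₃ := mul_le_mul_of_nonneg_left h₃ (inv_pos.2 hF.varpi_pos).le
  simp only [dotProduct_add, dotProduct_smul, smul_eq_mul]
  linarith

theorem sum_elim_dotProduct_sum_elim {ι κ : Type*} [Fintype ι] [Fintype κ] (a a' : ι → ℝ)
    (b b' : κ → ℝ) : Sum.elim a b ⬝ᵥ Sum.elim a' b' = a ⬝ᵥ a' + b ⬝ᵥ b' := by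
  simp [dotProduct]

theorem fromBlocks_form {ι κ : Type*} [Fintype ι] [Fintype κ] (A : Matrix ι ι ℝ)
    (W : Matrix κ ι ℝ) (D : Matrix κ κ ℝ) (a : ι → ℝ) (b : κ → ℝ) :
    Sum.elim a b ⬝ᵥ Matrix.fromBlocks A Wᵀ W D *ᵥ Sum.elim a b
      = a ⬝ᵥ A *ᵥ a + 2 * (b ⬝ᵥ W *ᵥ a) + b ⬝ᵥ D *ᵥ b := by
  rw [Matrix.fromBlocks_mulVec, sum_elim_dotProduct_sum_elim]
  simp only [Sum.elim_comp_inl, Sum.elim_comp_inr, dotProduct_add]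
  rw [Matrix.dotProduct_mulVec a Wᵀ, Matrix.vecMul_transpose, dotProduct_comm (W *ᵥ a)]
  ring

theorem fromBlocks_diag_form {ι κ : Type*} [Fintype ι] [Fintype κ] (A : Matrix ι ι ℝ)
    (D : Matrix κ κ ℝ) (a : ι → ℝ) (b : κ → ℝ) :
    Sum.elim a b ⬝ᵥ Matrix.fromBlocks A 0 0 D *ᵥ Sum.elim a b
      = a ⬝ᵥ A *ᵥ a + b ⬝ᵥ D *ᵥ b := by
  simpa using fromBlocks_form A 0 D a b

theorem quad_smul {ι : Type*} [Fintype ι] (M : Matrix ι ι ℝ) (k : ℝ) (x : ι → ℝ) :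
    (k • x) ⬝ᵥ M *ᵥ (k • x) = k ^ 2 * (x ⬝ᵥ M *ᵥ x) := by
  rw [Matrix.mulVec_smul, smul_dotProduct, dotProduct_smul, smul_eq_mul, smul_eq_mul]
  ring

/-- The second matrix inequality as a dissipation estimate for `v`, with supply rate `ρ V`. The
vector `y = (c σ, z)` enters through `σ = c⁻¹ G₀ y`, and `c ≥ α`. -/
theorem linear_bound {G : Plant r n m} {H : Matrix (Fin q) (Fin r) ℝ}
    {J : Matrix (Fin q) (Fin m) ℝ} {γ : ℝ} {K₀ : Matrix (Fin m) (Fin r) ℝ}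
    {K : Matrix (Fin m) (Fin n ⊕ Fin n) ℝ} {α ρ μ β ϖ κ : ℝ} {S : Matrix (Fin r) (Fin r) ℝ}
    {P : Matrix (Fin n ⊕ Fin n) (Fin n ⊕ Fin n) ℝ}
    (hF : Feasible G H J γ K₀ K α ρ μ β ϖ κ S P) :
    ∃ l > 0, ∀ (ζ : Fin r → ℝ) (σ z : Fin n → ℝ) (c : ℝ), α ≤ c →
      2 * ((S *ᵥ ζ) ⬝ᵥ (G.A *ᵥ ζ + G.E *ᵥ σ))
        ≤ ρ * (Sum.elim (c • σ) z ⬝ᵥ P *ᵥ Sum.elim (c • σ) z) - (ρ + l) * (ζ ⬝ᵥ S *ᵥ ζ)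
          - output H J K₀ ζ ⬝ᵥ output H J K₀ ζ := by
  obtain ⟨l, hl, hl'⟩ := posDef_dominates hF.linear
    (Matrix.fromBlocks S (0 : Matrix _ ((Fin n ⊕ Fin n) ⊕ Fin q) ℝ) 0 0)
  refine ⟨l, hl, fun ζ σ z c hc => ?_⟩
  have hα := hF.alpha_pos
  have hc0 : 0 < c := hα.trans_le hc
  set y := Sum.elim (c • σ) z with hy
  have h := hl' (Sum.elim ζ (Sum.elim ((α / c) • y) (output H J K₀ ζ)))
  rw [fromBlocks_diag_form, Matrix.neg_mulVec, dotProduct_neg, linearMat, fromBlocks_form,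
    fromBlocks_diag_form, Matrix.fromRows_mulVec, sum_elim_dotProduct_sum_elim] at h
  simp only [Matrix.zero_mulVec, dotProduct_zero, add_zero, Matrix.neg_mulVec, Matrix.one_mulVec,
    Matrix.add_mulVec, dotProduct_add, dotProduct_neg, Matrix.smul_mulVec, dotProduct_smul,
    smul_eq_mul, ← Matrix.mulVec_mulVec, quad_smul] at h
  have e₁ : ζ ⬝ᵥ G.Aᵀ *ᵥ S *ᵥ ζ = (S *ᵥ ζ) ⬝ᵥ G.A *ᵥ ζ := by
    rw [Matrix.dotProduct_mulVec, Matrix.vecMul_transpose, dotProduct_comm]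
  have e₂ : ζ ⬝ᵥ S *ᵥ G.A *ᵥ ζ = (S *ᵥ ζ) ⬝ᵥ G.A *ᵥ ζ := posDef_form_comm hF.S_pos _ _
  have e₃ : α⁻¹ * (((α / c) • y) ⬝ᵥ (G0 n)ᵀ *ᵥ G.Eᵀ *ᵥ S *ᵥ ζ) = (S *ᵥ ζ) ⬝ᵥ G.E *ᵥ σ := by
    rw [Matrix.dotProduct_mulVec, Matrix.vecMul_transpose, Matrix.dotProduct_mulVec,
      Matrix.vecMul_transpose, dotProduct_comm (S *ᵥ ζ), G0, Matrix.fromCols_mulVec]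
    have : ((α / c) • y) ∘ Sum.inl = α • σ := by
      ext i
      simp [hy]
      field_simp
    rw [this, Matrix.zero_mulVec, add_zero, Matrix.one_mulVec, Matrix.mulVec_smul, smul_dotProduct,
      smul_eq_mul]
    field_simp
  have e₄ : H *ᵥ ζ + J *ᵥ K₀ *ᵥ ζ = output H J K₀ ζ := by
    rw [output, Matrix.add_mulVec, Matrix.mulVec_mulVec]
  have e₅ : (α / c) ^ 2 * (y ⬝ᵥ P *ᵥ y) ≤ y ⬝ᵥ P *ᵥ y :=
    mul_le_of_le_one_left (posDef_form_nonneg hF.P_pos y)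
      (pow_le_one₀ (by positivity) ((div_le_one hc0).2 hc))
  have e₆ : output H J K₀ ζ ⬝ᵥ H *ᵥ ζ + output H J K₀ ζ ⬝ᵥ J *ᵥ K₀ *ᵥ ζ
      = output H J K₀ ζ ⬝ᵥ output H J K₀ ζ := by rw [← dotProduct_add, e₄]
  have e₇ := mul_le_mul_of_nonneg_left e₅ hF.rho_pos.le
  simp only [dotProduct_add]
  rw [e₁, e₂, e₃, e₆] at h
  linarith

/-- The third matrix inequality: the input of `ζ` into the `σ`-equation and the output are
dominated by `ρ v`. -/
theorem coupling_bound {G : Plant r n m} {H : Matrix (Fin q) (Fin r) ℝ}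
    {J : Matrix (Fin q) (Fin m) ℝ} {γ : ℝ} {K₀ : Matrix (Fin m) (Fin r) ℝ}
    {K : Matrix (Fin m) (Fin n ⊕ Fin n) ℝ} {α ρ μ β ϖ κ : ℝ} {S : Matrix (Fin r) (Fin r) ℝ}
    {P : Matrix (Fin n ⊕ Fin n) (Fin n ⊕ Fin n) ℝ}
    (hF : Feasible G H J γ K₀ K α ρ μ β ϖ κ S P) (ζ : Fin r → ℝ) :
    κ⁻¹ * ((C0 G K₀ *ᵥ ζ) ⬝ᵥ (C0 G K₀ *ᵥ ζ))
      ≤ ρ * (ζ ⬝ᵥ S *ᵥ ζ) - α⁻¹ * (output H J K₀ ζ ⬝ᵥ output H J K₀ ζ) := by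
  have h := posDef_form_nonneg hF.coupling
    (Sum.elim ζ (Sum.elim (-κ⁻¹ • (C0 G K₀ *ᵥ ζ)) (-α⁻¹ • output H J K₀ ζ)))
  have e₄ : (H + J * K₀) *ᵥ ζ = output H J K₀ ζ := rfl
  rw [couplingMat, fromBlocks_form, fromBlocks_diag_form, Matrix.fromRows_mulVec,
    sum_elim_dotProduct_sum_elim, e₄] at h
  simp only [Matrix.smul_mulVec, dotProduct_smul, smul_dotProduct, smul_eq_mul,
    Matrix.one_mulVec] at h
  have h1 : κ * (-κ⁻¹ * (-κ⁻¹ * ((C0 G K₀ *ᵥ ζ) ⬝ᵥ (C0 G K₀ *ᵥ ζ))))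
      = κ⁻¹ * ((C0 G K₀ *ᵥ ζ) ⬝ᵥ (C0 G K₀ *ᵥ ζ)) := by
    have := hF.kappa_pos.ne'
    field_simp
  have h2 : α * (-α⁻¹ * (-α⁻¹ * (output H J K₀ ζ ⬝ᵥ output H J K₀ ζ)))
      = α⁻¹ * (output H J K₀ ζ ⬝ᵥ output H J K₀ ζ) := by
    have := hF.alpha_pos.ne'
    field_simp
  linarith

theorem toCols_mulVec (G : Plant r n m) (K : Matrix (Fin m) (Fin n ⊕ Fin n) ℝ)
    (a b : Fin n → ℝ) :
    (G.B * K) *ᵥ Sum.elim a b = G.B *ᵥ (K.toCols₁ *ᵥ a) + (G.B * K.toCols₂) *ᵥ b := by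
  conv_lhs => rw [← Matrix.fromCols_toCols K]
  rw [← Matrix.mulVec_mulVec, Matrix.fromCols_mulVec, Matrix.mulVec_add]
  simp

/-- Where `σ` and `σ'` vanish, `V` is dominated by `v`: there `B K₂ z = -C₀ ζ`, and the Riccati
inequality can be tested with `y = (0, z)`. -/
theorem sliding_bound {G : Plant r n m} {H : Matrix (Fin q) (Fin r) ℝ}
    {J : Matrix (Fin q) (Fin m) ℝ} {γ : ℝ} {K₀ : Matrix (Fin m) (Fin r) ℝ}
    {K : Matrix (Fin m) (Fin n ⊕ Fin n) ℝ} {α ρ μ β ϖ κ : ℝ} {S : Matrix (Fin r) (Fin r) ℝ}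
    {P : Matrix (Fin n ⊕ Fin n) (Fin n ⊕ Fin n) ℝ}
    (hF : Feasible G H J γ K₀ K α ρ μ β ϖ κ S P) :
    ∃ l > 0, ∀ (ζ : Fin r → ℝ) (z : Fin n → ℝ),
      C0 G K₀ *ᵥ ζ + (G.B * K.toCols₂) *ᵥ z = 0 →
      (ρ + l) * (Sum.elim 0 z ⬝ᵥ P *ᵥ Sum.elim 0 z) ≤ ρ * (ζ ⬝ᵥ S *ᵥ ζ) := by
  obtain ⟨l, hl, hl'⟩ := riccati_bound hF
  refine ⟨l, hl, fun ζ z h => ?_⟩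
  have h1 := hl' (Sum.elim 0 z) 0 0 0 (C0 G K₀ *ᵥ ζ) (by simpa using dotProduct_self_nonneg' _)
    (by simp) (by simp)
  have h2 : (G.B * K) *ᵥ Sum.elim 0 z + (1 / 2 : ℝ) • 0 + (0 + C0 G K₀ *ᵥ ζ) = 0 := by
    rw [toCols_mulVec, Matrix.mulVec_zero, Matrix.mulVec_zero, zero_add, smul_zero, add_zero,
      zero_add, add_comm, h]
  rw [h2] at h1
  have h3 := coupling_bound hF ζ
  have h4 : 0 ≤ α⁻¹ * (output H J K₀ ζ ⬝ᵥ output H J K₀ ζ) :=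
    mul_nonneg (inv_pos.2 hF.alpha_pos).le (dotProduct_self_nonneg' _)
  simp only [Sum.elim_comp_inl, dotProduct_zero, add_zero, mul_zero] at h1
  linarith

theorem isUnit_BK₂ {G : Plant r n m} {H : Matrix (Fin q) (Fin r) ℝ}
    {J : Matrix (Fin q) (Fin m) ℝ} {γ : ℝ} {K₀ : Matrix (Fin m) (Fin r) ℝ}
    {K : Matrix (Fin m) (Fin n ⊕ Fin n) ℝ} {α ρ μ β ϖ κ : ℝ} {S : Matrix (Fin r) (Fin r) ℝ}
    {P : Matrix (Fin n ⊕ Fin n) (Fin n ⊕ Fin n) ℝ}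
    (hF : Feasible G H J γ K₀ K α ρ μ β ϖ κ S P) : IsUnit (G.B * K.toCols₂) := by
  obtain ⟨l, hl, hl'⟩ := sliding_bound hF
  rw [← Matrix.mulVec_injective_iff_isUnit]
  refine (injective_iff_map_eq_zero (Matrix.mulVecLin (G.B * K.toCols₂))).2 fun z hz => ?_
  have h := hl' 0 z (by simpa using hz)
  by_contra hz0
  have h1 : 0 < Sum.elim 0 z ⬝ᵥ P *ᵥ Sum.elim 0 z := by
    have : (Sum.elim 0 z : Fin n ⊕ Fin n → ℝ) ≠ 0 := fun e => hz0 <| by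
      ext i; simpa using congrFun e (Sum.inr i)
    simpa using hF.P_pos.dotProduct_mulVec_pos this
  have := mul_pos (add_pos hF.rho_pos hl) h1
  simp at h
  linarith

/-! ### Absolutely continuous functions and differential inequalities -/

theorem ae_ne (a : ℝ) : ∀ᵐ t : ℝ, t ≠ a := by
  simp [ae_iff]

theorem ac_lipschitz_comp {X Y : Type*} [PseudoMetricSpace X]
    [PseudoMetricSpace Y] {φ : X → Y} {C : NNReal} (hφ : LipschitzWith C φ) {y : ℝ → X} {a b : ℝ}
    (hy : AbsolutelyContinuousOnInterval y a b) :
    AbsolutelyContinuousOnInterval (fun t => φ (y t)) a b := by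
  rw [absolutelyContinuousOnInterval_iff] at hy ⊢
  intro ε hε
  obtain ⟨δ, hδ, h⟩ := hy (ε / (C + 1)) (by positivity)
  refine ⟨δ, hδ, fun E hE hl => ?_⟩
  have h1 := h E hE hl
  calc ∑ i ∈ Finset.range E.1, dist (φ (y (E.2 i).1)) (φ (y (E.2 i).2))
      ≤ ∑ i ∈ Finset.range E.1, C * dist (y (E.2 i).1) (y (E.2 i).2) :=
        Finset.sum_le_sum fun i _ => hφ.dist_le_mul _ _
    _ = C * ∑ i ∈ Finset.range E.1, dist (y (E.2 i).1) (y (E.2 i).2) := by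
        rw [Finset.mul_sum]
    _ ≤ (C + 1) * ∑ i ∈ Finset.range E.1, dist (y (E.2 i).1) (y (E.2 i).2) := by
        gcongr
        linarith
    _ < (C + 1) * (ε / (C + 1)) := by gcongr
    _ = ε := by field_simp

theorem ac_max {f g : ℝ → ℝ} {a b : ℝ}
    (hf : AbsolutelyContinuousOnInterval f a b) (hg : AbsolutelyContinuousOnInterval g a b) :
    AbsolutelyContinuousOnInterval (fun t => max (f t) (g t)) a b := by
  have h1 : AbsolutelyContinuousOnInterval (fun t => ‖f t - g t‖) a b :=
    ac_lipschitz_comp lipschitzWith_one_norm (hf.fun_sub hg)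
  have h2 := ((hf.fun_add hg).fun_add h1).const_mul (1 / 2)
  refine h2.congr' ?_
  refine Eventually.of_forall fun E => Finset.sum_congr rfl fun i _ => ?_
  have e : ∀ x y : ℝ, 1 / 2 * (x + y + ‖x - y‖) = max x y := fun x y => by
    rw [Real.norm_eq_abs]
    rcases le_total x y with hxy | hxy
    · rw [abs_of_nonpos (by linarith), max_eq_right hxy]; ring
    · rw [abs_of_nonneg (by linarith), max_eq_left hxy]; ring
  simp only [e]

/-- An absolutely continuous function with a nonpositive derivative almost everywhere decreases. -/
theorem ac_le_of_deriv_nonpos {W : ℝ → ℝ} {a b : ℝ} (hab : a ≤ b)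
    (hW : AbsolutelyContinuousOnInterval W a b)
    (h : ∀ᵐ t : ℝ, t ∈ Ioo a b → ∃ d ≤ 0, HasDerivAt W d t) : W b ≤ W a := by
  have h0 : 0 ≤ ∫ t in a..b, -deriv W t := by
    refine intervalIntegral.integral_nonneg_of_ae_restrict hab ?_
    rw [EventuallyLE, ae_restrict_iff' measurableSet_Icc]
    filter_upwards [h, ae_ne a, ae_ne b] with t ht hta htb htI
    obtain ⟨d, hd, hd'⟩ := ht ⟨lt_of_le_of_ne htI.1 hta.symm, lt_of_le_of_ne htI.2 htb⟩
    rw [hd'.deriv]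
    simpa using hd
  rw [intervalIntegral.integral_neg, hW.integral_deriv_eq_sub] at h0
  linarith

/-- The norm of an increment is bounded by an almost everywhere bound of the derivative. -/
theorem ac_norm_sub_le {F : Type*} [NormedAddCommGroup F] [NormedSpace ℝ F] {y : ℝ → F}
    {a b M : ℝ} (hab : a ≤ b) (hy : AbsolutelyContinuousOnInterval y a b)
    (h : ∀ᵐ t : ℝ, t ∈ Ioo a b → ∃ d, ‖d‖ ≤ M ∧ HasDerivAt y d t) :
    ‖y b - y a‖ ≤ M * (b - a) := by
  have hl : LipschitzWith 1 fun x : F => ‖x - y a‖ := by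
    have := lipschitzWith_one_norm.comp
      ((LipschitzWith.id (α := F)).sub (LipschitzWith.const (y a)))
    simpa using! this
  have hN : AbsolutelyContinuousOnInterval (fun t => ‖y t - y a‖) a b :=
    ac_lipschitz_comp hl hy
  have hlin : AbsolutelyContinuousOnInterval (fun t : ℝ => M * t) a b := by
    refine ContDiffOn.absolutelyContinuousOnInterval ?_
    fun_prop
  have key := ac_le_of_deriv_nonpos hab (hN.fun_sub hlin) ?_
  · simp only [sub_self, norm_zero] at key
    linarith
  filter_upwards [h, hN.ae_differentiableAt] with t ht hdt htI
  obtain ⟨d, hdM, hd⟩ := ht htI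
  have hNt := (hdt (by rw [uIcc_of_le hab]; exact Ioo_subset_Icc_self htI)).hasDerivAt
  refine ⟨_, ?_, hNt.sub ((hasDerivAt_id t).const_mul M)⟩
  have h1 := hNt.tendsto_slope.norm
  have h2 := hd.tendsto_slope.norm
  have h3 : ‖deriv (fun t => ‖y t - y a‖) t‖ ≤ ‖d‖ := by
    refine le_of_tendsto_of_tendsto h1 h2 (Eventually.of_forall fun s => ?_)
    simp only [slope_def_module, norm_smul]
    gcongr
    have := abs_norm_sub_norm_le (y s - y a) (y t - y a)
    rw [sub_sub_sub_cancel_right] at this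
    simpa using this
  have h4 := le_abs_self (deriv (fun t => ‖y t - y a‖) t)
  rw [Real.norm_eq_abs] at h3
  linarith

/-- An absolutely continuous function whose derivative agrees almost everywhere with a continuous
function is continuously differentiable. -/
theorem ac_hasDerivAt_of_ae {F : Type*} [NormedAddCommGroup F] [NormedSpace ℝ F] [CompleteSpace F]
    {y φ : ℝ → F} {a b : ℝ} (hy : AbsolutelyContinuousOnInterval y a b)
    (hφ : ContinuousOn φ (Icc a b)) (h : ∀ᵐ t : ℝ, t ∈ Ioo a b → HasDerivAt y (φ t) t) :
    ∀ t ∈ Ioo a b, HasDerivAt y (φ t) t := by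
  intro t ht
  have hab : a ≤ b := (ht.1.trans ht.2).le
  set ψ : ℝ → F := IccExtend hab ((Icc a b).domRestrict φ) with hψ
  have hψc : Continuous ψ := (continuousOn_iff_continuous_domRestrict.1 hφ).Icc_extend'
  have hψe : ∀ s ∈ Icc a b, ψ s = φ s := fun s hs => by
    rw [hψ, IccExtend_of_mem _ _ hs]; rfl
  set Φ : ℝ → F := fun s => ∫ x in a..s, ψ x
  have hΦ : ∀ s, HasDerivAt Φ (ψ s) s := fun s => hψc.integral_hasStrictDerivAt a s |>.hasDerivAt
  have hΦac : AbsolutelyContinuousOnInterval Φ a b := by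
    have : ContDiff ℝ 1 Φ := by
      rw [contDiff_one_iff_deriv]
      refine ⟨fun s => (hΦ s).differentiableAt, ?_⟩
      rwa [show deriv Φ = ψ from funext fun s => (hΦ s).deriv]
    exact this.contDiffOn.absolutelyContinuousOnInterval
  obtain ⟨C, hC⟩ := (hy.fun_sub hΦac).const_of_ae_hasDerivAt_zero (by
    rw [uIcc_of_le hab]
    filter_upwards [h, ae_ne a, ae_ne b] with s hs hsa hsb hsI
    have h1 := (hs ⟨lt_of_le_of_ne hsI.1 hsa.symm, lt_of_le_of_ne hsI.2 hsb⟩).sub (hΦ s)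
    rwa [hψe s hsI, sub_self] at h1)
  have h2 : HasDerivAt (fun s => Φ s + C) (φ t) t := by
    simpa [hψe t (Ioo_subset_Icc_self ht)] using (hΦ t).add_const C
  refine h2.congr_of_eventuallyEq ?_
  filter_upwards [Ioo_mem_nhds ht.1 ht.2] with s hs
  have := hC s (by rw [uIcc_of_le hab]; exact Ioo_subset_Icc_self hs)
  rw [← this]
  abel

/-- A continuous function that does not exceed its present value immediately after each time
decreases. -/
theorem le_of_eventually_right_le {W : ℝ → ℝ} {a b : ℝ} (hab : a ≤ b)
    (hW : ContinuousOn W (Icc a b)) (h : ∀ t ∈ Ico a b, ∀ᶠ s in 𝓝[>] t, W s ≤ W t) :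
    W b ≤ W a := by
  have hcl : IsClosed ({t | W t ≤ W a} ∩ Icc a b) := by
    have := hW.preimage_isClosed_of_isClosed isClosed_Icc (isClosed_Iic (a := W a))
    rwa [inter_comm] at this
  have := hcl.Icc_subset_of_forall_mem_nhdsWithin (le_refl (W a)) fun t ht => by
    filter_upwards [h t ht.2] with s hs using le_trans hs ht.1
  exact this (right_mem_Icc.2 hab)

theorem antitoneOn_of_eventually_right_le {W : ℝ → ℝ} {a b : ℝ} (hW : ContinuousOn W (Icc a b))
    (h : ∀ t ∈ Ioo a b, ∀ᶠ s in 𝓝[>] t, W s ≤ W t) : AntitoneOn W (Icc a b) := by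
  intro s hs t ht hst
  rcases hst.eq_or_lt with rfl | hlt
  · exact le_rfl
  have hlim : Tendsto W (𝓝[>] s) (𝓝 (W s)) :=
    ((hW s hs).mono_of_mem_nhdsWithin (Icc_mem_nhdsGT_of_mem ⟨hs.1, hlt.trans_le ht.2⟩))
  refine ge_of_tendsto hlim ?_
  filter_upwards [Ioo_mem_nhdsGT hlt] with u hu
  refine le_of_eventually_right_le hu.2.le (hW.mono (Icc_subset_Icc (hs.1.trans hu.1.le) ht.2)) ?_
  exact fun τ hτ => h τ ⟨(hs.1.trans_lt hu.1).trans_le hτ.1, hτ.2.trans_le ht.2⟩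

/-- A dissipation inequality that holds locally, to the right of every time at which the storage
function `ν` is positive, holds globally. Zeros of `ν` are handled by the fact that `ν` cannot
leave the value zero: after its last zero it would be decreasing. -/
theorem dissipation_of_local {ν q : ℝ → ℝ} {b : ℝ} (hb : 0 ≤ b) (hν : ContinuousOn ν (Icc 0 b))
    (hν0 : ∀ t ∈ Icc 0 b, 0 ≤ ν t) (hq : Continuous q) (hq0 : ∀ t, 0 ≤ q t)
    (hqν : ∀ t ∈ Icc 0 b, ν t = 0 → q t = 0)
    (h : ∀ t ∈ Ioo 0 b, 0 < ν t → ∀ᶠ s in 𝓝[>] t, ν s + ∫ x in t..s, q x ≤ ν t) :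
    (∀ s ∈ Icc 0 b, ν b ≤ ν s) ∧ ν b + ∫ x in 0..b, q x ≤ ν 0 := by
  have hloc : ∀ t ∈ Ioo 0 b, 0 < ν t → ∀ᶠ s in 𝓝[>] t, ν s ≤ ν t := fun t ht hpos => by
    filter_upwards [h t ht hpos, self_mem_nhdsWithin] with s hs hts
    have := intervalIntegral.integral_nonneg (μ := volume) (le_of_lt hts) fun x _ => hq0 x
    linarith
  have habs : ∀ s ∈ Icc 0 b, ν s = 0 → ∀ t ∈ Icc s b, ν t = 0 := by
    intro s hs hs0 t ht
    by_contra hne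
    have hsub : Icc s t ⊆ Icc 0 b := Icc_subset_Icc hs.1 ht.2
    have hcl : IsClosed (Icc s t ∩ ν ⁻¹' {0}) :=
      (hν.mono hsub).preimage_isClosed_of_isClosed isClosed_Icc isClosed_singleton
    obtain ⟨u, ⟨hu, hu0⟩, hmax⟩ := (isCompact_Icc.of_isClosed_subset hcl
      inter_subset_left).exists_isGreatest ⟨s, left_mem_Icc.2 ht.1, hs0⟩
    have hpos : ∀ x ∈ Ioo u t, 0 < ν x := fun x hx => by
      have hxI : x ∈ Icc s t := ⟨hu.1.trans hx.1.le, hx.2.le⟩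
      refine (hν0 x (hsub hxI)).lt_of_ne fun h0 => ?_
      exact absurd (hmax ⟨hxI, h0.symm⟩) (not_le.2 hx.1)
    have hanti := antitoneOn_of_eventually_right_le
      (hν.mono ((Icc_subset_Icc_left hu.1).trans hsub)) fun x hx =>
        hloc x ⟨(hs.1.trans hu.1).trans_lt hx.1, hx.2.trans_le ht.2⟩ (hpos x hx)
    have hle := hanti (left_mem_Icc.2 hu.2) (right_mem_Icc.2 hu.2) hu.2
    rw [show ν u = 0 from hu0] at hle
    exact hne (le_antisymm hle (hν0 t (hsub (right_mem_Icc.2 ht.1))))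
  constructor
  · intro s hs
    refine antitoneOn_of_eventually_right_le hν (fun t ht => ?_) hs (right_mem_Icc.2 hb) hs.2
    rcases (hν0 t (Ioo_subset_Icc_self ht)).eq_or_lt with h0 | hpos
    · filter_upwards [Ioo_mem_nhdsGT ht.2] with u hu
      rw [habs t (Ioo_subset_Icc_self ht) h0.symm u ⟨hu.1.le, hu.2.le⟩, ← h0]
    · exact hloc t ht hpos
  · have hQ : Continuous fun t => ∫ x in 0..t, q x :=
      intervalIntegral.continuous_primitive (fun a b => hq.intervalIntegrable a b) 0
    have hanti := antitoneOn_of_eventually_right_le (W := fun t => ν t + ∫ x in 0..t, q x)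
      (hν.add hQ.continuousOn) fun t ht => ?_
    · simpa using hanti (left_mem_Icc.2 hb) (right_mem_Icc.2 hb) hb
    have hsplit : ∀ u, ∫ x in 0..u, q x = (∫ x in 0..t, q x) + ∫ x in t..u, q x := fun u =>
      (intervalIntegral.integral_add_adjacent_intervals (hq.intervalIntegrable _ _)
        (hq.intervalIntegrable _ _)).symm
    rcases (hν0 t (Ioo_subset_Icc_self ht)).eq_or_lt with h0 | hpos
    · filter_upwards [Ioo_mem_nhdsGT ht.2] with u hu
      have hz := habs t (Ioo_subset_Icc_self ht) h0.symm
      have hint : ∫ x in t..u, q x = 0 := by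
        rw [intervalIntegral.integral_congr (g := fun _ => (0 : ℝ)), intervalIntegral.integral_zero]
        intro x hx
        rw [uIcc_of_le hu.1.le] at hx
        exact hqν x ⟨ht.1.le.trans hx.1, hx.2.trans hu.2.le⟩ (hz x ⟨hx.1, hx.2.trans hu.2.le⟩)
      rw [hsplit u, hint, hz u ⟨hu.1.le, hu.2.le⟩, ← h0, add_zero]
    · filter_upwards [h t ht hpos] with u hu
      rw [hsplit u]
      linarith

/-- The derivative of a maximum, where it exists, is that of an active branch. -/
theorem hasDerivAt_max_eq {f g : ℝ → ℝ} {f' d t : ℝ} (hf : HasDerivAt f f' t)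
    (hd : HasDerivAt (fun s => max (f s) (g s)) d t) (h : g t ≤ f t) : d = f' := by
  have hmin : IsLocalMin (fun s => max (f s) (g s) - f s) t := by
    refine Eventually.of_forall fun s => ?_
    simp only [max_eq_left h, sub_self]
    exact sub_nonneg.2 (le_max_left _ _)
  linarith [hmin.hasDerivAt_eq_zero (hd.sub hf)]

/-! ### Existence by Euler polygons -/

section Euler

variable {X : Type*} [NormedAddCommGroup X] [NormedSpace ℝ X]

/-- The nodes of the Euler polygon with step `h`, started at `x₀` at time `0`. -/
noncomputable def eulerNode (g : ℝ → X → X) (x₀ : X) (h : ℝ) : ℕ → X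
  | 0 => x₀
  | j + 1 => eulerNode g x₀ h j + h • g (j * h) (eulerNode g x₀ h j)

theorem eulerNode_bound {g : ℝ → X → X} {x₀ : X} {h M T : ℝ} (hh : 0 ≤ h)
    (hg : ∀ t ∈ Icc 0 T, ∀ p, ‖g t p‖ ≤ M * (1 + ‖p‖)) (j : ℕ) (hj : j * h ≤ T) :
    1 + ‖eulerNode g x₀ h j‖ ≤ Real.exp (j * h * M) * (1 + ‖x₀‖) := by
  induction j with
  | zero => simp [eulerNode]
  | succ j ih =>
    push_cast at hj ⊢
    have hj' : j * h ≤ T := by nlinarith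
    have h1 := hg (j * h) ⟨by positivity, hj'⟩ (eulerNode g x₀ h j)
    have h2 : ‖eulerNode g x₀ h (j + 1)‖
        ≤ ‖eulerNode g x₀ h j‖ + h * (M * (1 + ‖eulerNode g x₀ h j‖)) := by
      rw [eulerNode]
      refine (norm_add_le _ _).trans ?_
      rw [norm_smul, Real.norm_of_nonneg hh]
      gcongr
    have h3 : 1 + h * M ≤ Real.exp (h * M) := by linarith [Real.add_one_le_exp (h * M)]
    have e : ((j : ℝ) + 1) * h * M = h * M + j * h * M := by ring
    rw [e, Real.exp_add, mul_assoc]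
    calc 1 + ‖eulerNode g x₀ h (j + 1)‖
        ≤ (1 + h * M) * (1 + ‖eulerNode g x₀ h j‖) := by linarith
      _ ≤ Real.exp (h * M) * (Real.exp (j * h * M) * (1 + ‖x₀‖)) := by
          gcongr
          exact ih hj'

theorem eulerNode_sub_le {g : ℝ → X → X} {x₀ : X} {h M T : ℝ} (hh : 0 ≤ h) (hM : 0 ≤ M)
    (hg : ∀ t ∈ Icc 0 T, ∀ p, ‖g t p‖ ≤ M * (1 + ‖p‖)) {i j : ℕ} (hij : i ≤ j)
    (hj : j * h ≤ T) :
    ‖eulerNode g x₀ h j - eulerNode g x₀ h i‖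
      ≤ (j * h - i * h) * (M * (Real.exp (T * M) * (1 + ‖x₀‖))) := by
  induction j, hij using Nat.le_induction with
  | base => simp
  | succ j hij ih =>
    push_cast at hj ⊢
    have hj' : j * h ≤ T := by nlinarith
    have h1 := hg (j * h) ⟨by positivity, hj'⟩ (eulerNode g x₀ h j)
    have h2 := eulerNode_bound (x₀ := x₀) hh hg j hj'
    have h3 : Real.exp (j * h * M) ≤ Real.exp (T * M) := by gcongr
    have h4 : ‖g (j * h) (eulerNode g x₀ h j)‖ ≤ M * (Real.exp (T * M) * (1 + ‖x₀‖)) := by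
      refine h1.trans ?_
      gcongr
      exact h2.trans (by gcongr)
    have h5 : eulerNode g x₀ h (j + 1) - eulerNode g x₀ h i
        = (eulerNode g x₀ h j - eulerNode g x₀ h i) + h • g (j * h) (eulerNode g x₀ h j) := by
      rw [eulerNode]; abel
    rw [h5]
    refine (norm_add_le _ _).trans ?_
    rw [norm_smul, Real.norm_of_nonneg hh]
    have h6 := mul_le_mul_of_nonneg_left h4 hh
    linarith [ih hj']

/-- The increments of an Euler polygon are averages of the values of the vector field. -/
theorem eulerNode_sub_mem {g : ℝ → X → X} {x₀ : X} {h : ℝ} {C : Set X} (hC : Convex ℝ C) {i j : ℕ}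
    (hij : i < j) (hmem : ∀ k, i ≤ k → k < j → g (k * h) (eulerNode g x₀ h k) ∈ C) :
    ∃ e ∈ C, eulerNode g x₀ h j - eulerNode g x₀ h i = (j * h - i * h) • e := by
  induction j, hij using Nat.le_induction with
  | base =>
    refine ⟨_, hmem i le_rfl (Nat.lt_succ_self i), ?_⟩
    rw [eulerNode]
    push_cast
    rw [add_sub_cancel_left]
    congr 1
    ring
  | succ j hij ih =>
    obtain ⟨e, he, heq⟩ := ih fun k h1 h2 => hmem k h1 (h2.trans (Nat.lt_succ_self j))
    have hg := hmem j (Nat.le_of_succ_le hij) (Nat.lt_succ_self j)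
    have hpos : (0 : ℝ) < j - i := sub_pos.2 (by exact_mod_cast hij)
    have hpos' : (0 : ℝ) < j + 1 - i := by linarith
    refine ⟨((j - i : ℝ) / (j + 1 - i)) • e + ((1 : ℝ) / (j + 1 - i)) •
      g (j * h) (eulerNode g x₀ h j), hC he hg (by positivity) (by positivity) ?_, ?_⟩
    · rw [← add_div, div_eq_one_iff_eq hpos'.ne']; ring
    · have h5 : eulerNode g x₀ h (j + 1) - eulerNode g x₀ h i
          = (eulerNode g x₀ h j - eulerNode g x₀ h i) + h • g (j * h) (eulerNode g x₀ h j) := by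
        rw [eulerNode]; abel
      rw [h5, heq, smul_add, smul_smul, smul_smul]
      push_cast
      congr 2 <;> · field_simp

/-- Peano's theorem for discontinuous right-hand sides of linear growth: there is a locally
Lipschitz function whose derivatives are limits of averages of nearby values of the vector
field. It is the pointwise limit of step functions through the nodes of Euler polygons along
an ultrafilter. -/
theorem exists_euler_limit [FiniteDimensional ℝ X] (g : ℝ → X → X)
    (hg : ∀ T : ℝ, ∃ M ≥ 0, ∀ t ∈ Icc 0 T, ∀ p, ‖g t p‖ ≤ M * (1 + ‖p‖)) (x₀ : X) :
    ∃ y : ℝ → X, y 0 = x₀ ∧ (∀ b : ℝ, ∃ C : NNReal, LipschitzOnWith C y (Icc 0 b)) ∧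
      ∀ t > 0, ∀ d, HasDerivAt y d t → ∀ δ > 0,
        d ∈ closure (convexHull ℝ {v | ∃ s ≥ 0, ∃ p, |s - t| < δ ∧ ‖p - y t‖ < δ ∧ g s p = v}) := by
  have : ProperSpace X := FiniteDimensional.proper ℝ X
  set h : ℕ → ℝ := fun k => 1 / ((k : ℝ) + 1) with hh
  have hpos : ∀ k, 0 < h k := fun k => by positivity
  have hlim : Tendsto h atTop (𝓝 0) := tendsto_one_div_add_atTop_nhds_zero_nat
  set N : ℕ → ℝ → ℕ := fun k t => ⌊t / h k⌋₊
  have hNle : ∀ k t, 0 ≤ t → N k t * h k ≤ t := fun k t ht => by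
    rw [← le_div_iff₀ (hpos k)]
    exact Nat.floor_le (div_nonneg ht (hpos k).le)
  have hNgt : ∀ k t, t - h k < N k t * h k := fun k t => by
    have := Nat.lt_floor_add_one (t / h k)
    rw [div_lt_iff₀ (hpos k)] at this
    change t < (N k t + 1) * h k at this
    linarith
  set Y : ℕ → ℝ → X := fun k t => eulerNode g x₀ (h k) (N k t)
  set U : Ultrafilter ℕ := hyperfilter ℕ
  have hU : (U : Filter ℕ) ≤ atTop := by
    rw [← Nat.cofinite_eq_atTop]; exact hyperfilter_le_cofinite
  have hlimU : Tendsto h U (𝓝 0) := hlim.mono_left hU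
  have hNlim : ∀ t, 0 ≤ t → Tendsto (fun k => N k t * h k) U (𝓝 t) := fun t ht => by
    refine tendsto_of_tendsto_of_tendsto_of_le_of_le (g := fun k => t - h k) ?_
      tendsto_const_nhds (fun k => (hNgt k t).le) (fun k => hNle k t ht)
    simpa using (tendsto_const_nhds (x := t)).sub hlimU
  have hex : ∀ t, ∃ a, Tendsto (fun k => Y k t) U (𝓝 a) := fun t => by
    obtain ⟨M, hM, hgM⟩ := hg (max t 0)
    have hb : ∀ k, Y k t ∈ Metric.closedBall (0 : X) (Real.exp (max t 0 * M) * (1 + ‖x₀‖)) := by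
      intro k
      have hN : N k t * h k ≤ max t 0 := by
        rcases le_total 0 t with ht | ht
        · exact (hNle k t ht).trans (le_max_left _ _)
        · have : N k t = 0 := Nat.floor_of_nonpos (div_nonpos_of_nonpos_of_nonneg ht (hpos k).le)
          simp [this]
      have h1 := eulerNode_bound (x₀ := x₀) (hpos k).le hgM (N k t) hN
      have h2 : Real.exp (N k t * h k * M) ≤ Real.exp (max t 0 * M) := by gcongr
      rw [mem_closedBall_zero_iff]
      have h3 := mul_le_mul_of_nonneg_right h2 (by positivity : 0 ≤ 1 + ‖x₀‖)
      change ‖eulerNode g x₀ (h k) (N k t)‖ ≤ _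
      linarith
    obtain ⟨a, -, ha⟩ := (isCompact_closedBall (0 : X)
      (Real.exp (max t 0 * M) * (1 + ‖x₀‖))).ultrafilter_le_nhds (U.map fun k => Y k t)
      (by
        rw [le_principal_iff, Ultrafilter.mem_coe, Ultrafilter.mem_map]
        exact Filter.univ_mem' hb)
    exact ⟨a, ha⟩
  choose y hy using hex
  have hYsub : ∀ T M : ℝ, 0 ≤ M → (∀ t ∈ Icc 0 T, ∀ p, ‖g t p‖ ≤ M * (1 + ‖p‖)) →
      ∀ s t, 0 ≤ s → s ≤ t → t ≤ T → ∀ k j : ℕ, N k s ≤ j → j ≤ N k t →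
        ‖eulerNode g x₀ (h k) j - Y k s‖
          ≤ (t - s + h k) * (M * (Real.exp (T * M) * (1 + ‖x₀‖))) := by
    intro T M hM hgM s t hs hst htT k j hsj hjt
    have hjt' : j * h k ≤ N k t * h k := by
      have := (hpos k).le
      gcongr
    have h1 := hNle k t (hs.trans hst)
    refine (eulerNode_sub_le (hpos k).le hM hgM hsj (by linarith)).trans ?_
    have h2 := hNgt k s
    gcongr
    linarith
  have hNmono : ∀ k, Monotone (N k) := fun k s t hst =>
    Nat.floor_mono (div_le_div_of_nonneg_right hst (hpos k).le)
  refine ⟨y, ?_, fun b => ?_, fun t ht d hd δ hδ => ?_⟩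
  · refine tendsto_nhds_unique (hy 0) ?_
    have : (fun k => Y k 0) = fun _ => x₀ := by
      funext k
      simp [Y, N, eulerNode]
    rw [this]
    exact tendsto_const_nhds
  · obtain ⟨M, hM, hgM⟩ := hg b
    set L := M * (Real.exp (b * M) * (1 + ‖x₀‖)) with hL
    have hL0 : 0 ≤ L := by positivity
    have key : ∀ s t, 0 ≤ s → s ≤ t → t ≤ b → ‖y t - y s‖ ≤ L * (t - s) := by
      intro s t hs hst htb
      have h1 : Tendsto (fun k => (t - s + h k) * L) U (𝓝 ((t - s + 0) * L)) :=
        (tendsto_const_nhds.add hlimU).mul tendsto_const_nhds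
      have h2 := le_of_tendsto_of_tendsto ((hy t).sub (hy s)).norm h1 (Eventually.of_forall
        fun k => hYsub b M hM hgM s t hs hst htb k (N k t) (hNmono k hst) le_rfl)
      linarith
    refine ⟨⟨L, hL0⟩, LipschitzOnWith.of_dist_le_mul fun s hs t ht => ?_⟩
    rw [dist_eq_norm, dist_eq_norm, Real.norm_eq_abs]
    change _ ≤ L * _
    rcases le_total s t with hst | hst
    · rw [norm_sub_rev, abs_of_nonpos (by linarith), neg_sub]
      exact key s t hs.1 hst ht.2
    · rw [abs_of_nonneg (by linarith)]
      exact key t s ht.1 hst hs.2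
  · set C := convexHull ℝ {v | ∃ s ≥ 0, ∃ p, |s - t| < δ ∧ ‖p - y t‖ < δ ∧ g s p = v} with hCdef
    obtain ⟨M, hM, hgM⟩ := hg (t + 1)
    set L := M * (Real.exp ((t + 1) * M) * (1 + ‖x₀‖)) with hL
    have hL0 : 0 ≤ L := by positivity
    set η := min (min 1 δ) (δ / (8 * (L + 1)))
    have hη : 0 < η := by positivity
    have hη1 : η ≤ 1 := (min_le_left _ _).trans (min_le_left _ _)
    have hηδ : η ≤ δ := (min_le_left _ _).trans (min_le_right _ _)
    have hηL : (2 * η) * L < δ / 2 := by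
      have h1 : η ≤ δ / (8 * (L + 1)) := min_le_right _ _
      rw [le_div_iff₀ (by positivity)] at h1
      nlinarith
    -- Difference quotients over short intervals to the right of `t` lie in the closed hull.
    have hslope : ∀ s, t < s → s < t + η → (s - t)⁻¹ • (y s - y t) ∈ closure C := by
      intro s hts hsη
      have hev : ∀ᶠ k in (U : Filter ℕ), h k < min η (s - t) ∧ ‖Y k t - y t‖ < δ / 2 := by
        refine (hlimU.eventually_lt_const (lt_min hη (sub_pos.2 hts))).and ?_
        have := (hy t).eventually (Metric.ball_mem_nhds (y t) (half_pos hδ))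
        simpa [dist_eq_norm] using this
      have hmem : ∀ᶠ k in (U : Filter ℕ),
          (N k s * h k - N k t * h k)⁻¹ • (Y k s - Y k t) ∈ C := by
        filter_upwards [hev] with k hk
        have hk1 := hk.1.trans_le (min_le_left _ _)
        have hk2 := hk.1.trans_le (min_le_right _ _)
        have h1 := hNle k t ht.le
        have h2 := hNgt k s
        have hlt : N k t < N k s := by
          have : (N k t : ℝ) * h k < N k s * h k := by linarith
          exact_mod_cast lt_of_mul_lt_mul_right this (hpos k).le
        have hval : ∀ j, N k t ≤ j → j < N k s → g (j * h k) (eulerNode g x₀ (h k) j) ∈ C := by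
          intro j hj1 hj2
          refine subset_convexHull ℝ _ ⟨j * h k, by have := hpos k; positivity,
            eulerNode g x₀ (h k) j, ?_, ?_, rfl⟩
          · have h3 : (N k t : ℝ) * h k ≤ j * h k := by
              have := (hpos k).le
              gcongr
            have h4 : (j : ℝ) * h k ≤ N k s * h k := by
              have := (hpos k).le
              gcongr
            have h5 := hNle k s (ht.le.trans hts.le)
            have h6 := hNgt k t
            rw [abs_lt]
            constructor <;> linarith
          · have h3 := hYsub (t + 1) M hM hgM t s ht.le hts.le (by linarith) k j hj1 hj2.le
            have h4 : (s - t + h k) * L ≤ (2 * η) * L := by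
              gcongr
              linarith
            calc ‖eulerNode g x₀ (h k) j - y t‖
                ≤ ‖eulerNode g x₀ (h k) j - Y k t‖ + ‖Y k t - y t‖ :=
                  norm_sub_le_norm_sub_add_norm_sub _ _ _
              _ < δ / 2 + δ / 2 := by linarith [hk.2]
              _ = δ := by ring
        obtain ⟨e, he, heq⟩ := eulerNode_sub_mem (convex_convexHull ℝ _) hlt hval
        change (_ : ℝ)⁻¹ • (eulerNode g x₀ (h k) (N k s) - eulerNode g x₀ (h k) (N k t)) ∈ C
        rw [heq, smul_smul, inv_mul_cancel₀ (by linarith), one_smul]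
        exact he
      have hts' : 0 ≤ s := ht.le.trans hts.le
      exact mem_closure_of_tendsto ((((hNlim s hts').sub (hNlim t ht.le)).inv₀
        (sub_pos.2 hts).ne').smul ((hy s).sub (hy t))) hmem
    have hlimd : Tendsto (slope y t) (𝓝[>] t) (𝓝 d) := by
      have := hasDerivWithinAt_iff_tendsto_slope.1 (hd.hasDerivWithinAt (s := Ioi t))
      simpa using this
    refine isClosed_closure.mem_of_tendsto hlimd ?_
    filter_upwards [Ioo_mem_nhdsGT (show t < t + η by linarith)] with s hs
    rw [slope_def_module]
    exact hslope s hs.1 hs.2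

end Euler

/-! ### The Euclidean norm and the gain `c(σ)` -/

theorem euclNorm_nonneg {ι : Type*} [Fintype ι] (v : ι → ℝ) : 0 ≤ euclNorm v := Real.sqrt_nonneg _

theorem euclNorm_sq {ι : Type*} [Fintype ι] (v : ι → ℝ) : euclNorm v ^ 2 = v ⬝ᵥ v :=
  Real.sq_sqrt (dotProduct_self_nonneg' v)

theorem euclNorm_eq {ι : Type*} [Fintype ι] (v : ι → ℝ) : euclNorm v = ‖WithLp.toLp 2 v‖ := by
  rw [euclNorm, EuclideanSpace.norm_eq]
  congr 1
  simp [dotProduct, sq]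

theorem euclNorm_smul {ι : Type*} [Fintype ι] (k : ℝ) (v : ι → ℝ) :
    euclNorm (k • v) = |k| * euclNorm v := by
  rw [euclNorm_eq, euclNorm_eq, WithLp.toLp_smul, norm_smul, Real.norm_eq_abs]

theorem euclNorm_zero {ι : Type*} [Fintype ι] : euclNorm (0 : ι → ℝ) = 0 := by simp [euclNorm]

theorem euclNorm_pos {ι : Type*} [Fintype ι] {v : ι → ℝ} (hv : v ≠ 0) : 0 < euclNorm v := by
  rw [euclNorm_eq, norm_pos_iff]
  simpa using hv

theorem continuous_euclNorm {ι : Type*} [Fintype ι] : Continuous (euclNorm : (ι → ℝ) → ℝ) := by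
  unfold euclNorm
  fun_prop

theorem norm_le_euclNorm {ι : Type*} [Fintype ι] (v : ι → ℝ) : ‖v‖ ≤ euclNorm v := by
  refine (pi_norm_le_iff_of_nonneg (euclNorm_nonneg v)).2 fun i => ?_
  rw [euclNorm_eq]
  exact PiLp.norm_apply_le (WithLp.toLp 2 v) i

theorem euclNorm_le_card_mul {ι : Type*} [Fintype ι] (v : ι → ℝ) :
    euclNorm v ≤ Fintype.card ι * ‖v‖ := by
  refine Real.sqrt_le_iff.2 ⟨by positivity, ?_⟩
  have h1 : v ⬝ᵥ v ≤ ∑ _i : ι, ‖v‖ ^ 2 := Finset.sum_le_sum fun i _ => by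
    have := norm_le_pi_norm v i
    rw [← sq, ← sq_abs, ← Real.norm_eq_abs]
    gcongr
  have h2 : (Fintype.card ι : ℝ) ≤ (Fintype.card ι : ℝ) ^ 2 := by
    exact_mod_cast Nat.le_self_pow two_ne_zero _
  rw [Finset.sum_const, Finset.card_univ, nsmul_eq_mul] at h1
  rw [mul_pow]
  exact h1.trans (by gcongr)

theorem convex_euclNorm_le {ι : Type*} [Fintype ι] (a : ℝ) :
    Convex ℝ {v : ι → ℝ | euclNorm v ≤ a} := by
  intro v hv w hw s t hs ht hst
  simp only [mem_ofPred_eq, euclNorm_eq] at *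
  rw [WithLp.toLp_add, WithLp.toLp_smul, WithLp.toLp_smul]
  refine (norm_add_le _ _).trans ?_
  rw [norm_smul, norm_smul, Real.norm_of_nonneg hs, Real.norm_of_nonneg ht]
  calc s * _ + t * _ ≤ s * a + t * a := by gcongr
    _ = a := by rw [← add_mul, hst, one_mul]

theorem cFun_pos {α : ℝ} (hα : 0 < α) (σ : Fin n → ℝ) : 0 < cFun α σ := by
  unfold cFun
  positivity

theorem le_cFun (α : ℝ) (σ : Fin n → ℝ) : α ≤ cFun α σ := by
  unfold cFun
  have : 0 ≤ 1 / Real.sqrt (euclNorm σ) := by positivity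
  linarith

theorem continuousAt_cFun (α : ℝ) {σ : Fin n → ℝ} (hσ : σ ≠ 0) : ContinuousAt (cFun α) σ := by
  unfold cFun
  have h : Real.sqrt (euclNorm σ) ≠ 0 := (Real.sqrt_pos.2 (euclNorm_pos hσ)).ne'
  exact (continuousAt_const.div continuous_euclNorm.continuousAt.sqrt h).add continuousAt_const

theorem euclNorm_cFun_smul {α : ℝ} (hα : 0 < α) (σ : Fin n → ℝ) :
    euclNorm (cFun α σ • σ) = Real.sqrt (euclNorm σ) + α * euclNorm σ := by
  rw [euclNorm_smul, abs_of_pos (cFun_pos hα σ), cFun, add_mul, one_div, inv_mul_eq_div,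
    Real.div_sqrt]

theorem continuous_cFun_smul {α : ℝ} (hα : 0 < α) :
    Continuous fun σ : Fin n → ℝ => cFun α σ • σ := by
  rw [continuous_iff_continuousAt]
  intro σ
  obtain rfl | hσ := eq_or_ne σ 0
  · rw [ContinuousAt, smul_zero, tendsto_zero_iff_norm_tendsto_zero]
    have h : Tendsto (fun σ : Fin n → ℝ => Real.sqrt (euclNorm σ) + α * euclNorm σ) (𝓝 0) (𝓝 0) := by
      have hc : Continuous fun σ : Fin n → ℝ => Real.sqrt (euclNorm σ) + α * euclNorm σ := by
        have := continuous_euclNorm (ι := Fin n)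
        fun_prop
      simpa [euclNorm_zero] using hc.tendsto 0
    exact squeeze_zero (fun _ => norm_nonneg _)
      (fun σ => (norm_le_euclNorm _).trans (euclNorm_cFun_smul hα σ).le) h
  · exact (continuousAt_cFun α hσ).smul continuousAt_id

theorem euclNorm_cFun_sq_smul_le {α : ℝ} (hα : 0 < α) (σ : Fin n → ℝ) :
    euclNorm (cFun α σ ^ 2 • σ) ≤ (1 + α * Real.sqrt (euclNorm σ)) ^ 2 := by
  rw [euclNorm_smul, abs_of_nonneg (sq_nonneg _)]
  obtain rfl | hσ := eq_or_ne σ 0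
  · simp [euclNorm_zero]
  have hs := Real.sqrt_pos.2 (euclNorm_pos hσ)
  refine le_of_eq ?_
  rw [cFun]
  field_simp
  rw [Real.sq_sqrt (euclNorm_nonneg σ)]

/-! ### Filippov's regularization of the closed loop -/

/-- `d` lies in every closed convex set that belongs to the filter `𝓕`. -/
def IsHullPoint {X : Type*} [NormedAddCommGroup X] [NormedSpace ℝ X] (𝓕 : Filter X) (d : X) :
    Prop :=
  ∀ C : Set X, IsClosed C → Convex ℝ C → C ∈ 𝓕 → d ∈ C

theorem IsHullPoint.map_eq {X Y : Type*} [NormedAddCommGroup X] [NormedSpace ℝ X]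
    [NormedAddCommGroup Y] [NormedSpace ℝ Y] {𝓕 : Filter X} {d : X} (hd : IsHullPoint 𝓕 d)
    (φ : X →L[ℝ] Y) {a : Y} (hφ : Tendsto φ 𝓕 (𝓝 a)) : φ d = a := by
  refine eq_of_forall_dist_le fun ε hε => ?_
  have := hd (φ ⁻¹' Metric.closedBall a ε) (Metric.isClosed_closedBall.preimage φ.continuous)
    ((convex_closedBall a ε).is_linear_preimage φ.isBoundedLinearMap.toIsLinearMap)
    (hφ (Metric.closedBall_mem_nhds a hε))
  simpa using this

theorem IsHullPoint.of_mem_filippovMap {X : Type*} [NormedAddCommGroup X] [NormedSpace ℝ X]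
    [MeasureSpace X] {g : X → X} {p d : X} (hd : d ∈ filippovMap g p) :
    IsHullPoint (map g (𝓝 p)) d := by
  intro C hC hCc hmem
  obtain ⟨δ, hδ, hsub⟩ := Metric.mem_nhds_iff.1 hmem
  simp only [filippovMap, mem_iInter] at hd
  refine closure_minimal (convexHull_min ?_ hCc) hC (hd δ hδ ∅ measure_empty)
  rintro _ ⟨s, hs, rfl⟩
  exact hsub hs.1

theorem IsHullPoint.norm_le {X : Type*} [NormedAddCommGroup X] [NormedSpace ℝ X] {𝓕 : Filter X}
    {d : X} (hd : IsHullPoint 𝓕 d) {M : ℝ} (hM : ∀ᶠ v in 𝓕, ‖v‖ ≤ M) : ‖d‖ ≤ M := by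
  simpa using hd (Metric.closedBall 0 M) Metric.isClosed_closedBall (convex_closedBall _ _)
    (by simpa [Metric.closedBall, dist_zero_right, Filter.Eventually] using hM)

theorem exists_mulVec_le {ι κ : Type*} [Fintype ι] [Fintype κ] (M : Matrix ι κ ℝ) :
    ∃ C ≥ 0, ∀ v : κ → ℝ, ‖M *ᵥ v‖ ≤ C * ‖v‖ := by
  classical
  exact ⟨‖LinearMap.toContinuousLinearMap M.mulVecLin‖, norm_nonneg _,
    fun v => (LinearMap.toContinuousLinearMap M.mulVecLin).le_opNorm v⟩

theorem control_eq (α : ℝ) (K₀ : Matrix (Fin m) (Fin r) ℝ) (K : Matrix (Fin m) (Fin n ⊕ Fin n) ℝ)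
    (s : State r n) :
    control α K₀ K s
      = K₀ *ᵥ s.1 + K.toCols₁ *ᵥ (cFun α s.2.1 • s.2.1) + K.toCols₂ *ᵥ s.2.2 := by
  rw [control, Matrix.mulVec_smul]

theorem continuous_control {α : ℝ} (hα : 0 < α) (K₀ : Matrix (Fin m) (Fin r) ℝ)
    (K : Matrix (Fin m) (Fin n ⊕ Fin n) ℝ) : Continuous (control (r := r) α K₀ K) := by
  have : control (r := r) α K₀ K = fun s =>
      K₀ *ᵥ s.1 + K.toCols₁ *ᵥ (cFun α s.2.1 • s.2.1) + K.toCols₂ *ᵥ s.2.2 :=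
    funext (control_eq α K₀ K)
  rw [this]
  have := (continuous_cFun_smul (n := n) hα).comp
    (continuous_fst.comp (continuous_snd (X := Fin r → ℝ) (Y := (Fin n → ℝ) × (Fin n → ℝ))))
  simp only [Function.comp_def] at this
  fun_prop

theorem continuousAt_closedLoop_fst (G : Plant r n m) (α : ℝ)
    (K₀ : Matrix (Fin m) (Fin r) ℝ) (K : Matrix (Fin m) (Fin n ⊕ Fin n) ℝ) (f : ℝ → Fin n → ℝ)
    (a : ℝ × State r n) :
    ContinuousAt (fun b : ℝ × State r n => (closedLoop G α K₀ K f b.1 b.2).1) a := by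
  simp only [closedLoop]
  fun_prop

theorem continuousAt_closedLoop_snd_fst (G : Plant r n m) {α : ℝ} (hα : 0 < α)
    (K₀ : Matrix (Fin m) (Fin r) ℝ) (K : Matrix (Fin m) (Fin n ⊕ Fin n) ℝ) {f : ℝ → Fin n → ℝ}
    {a : ℝ × State r n} (hf : ContinuousAt f a.1) :
    ContinuousAt (fun b : ℝ × State r n => (closedLoop G α K₀ K f b.1 b.2).2.1) a := by
  simp only [closedLoop]
  have h1 : ContinuousAt (fun b : ℝ × State r n => f b.1) a :=
    ContinuousAt.comp (f := Prod.fst) hf continuousAt_fst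
  have h2 : Continuous fun b : ℝ × State r n =>
      G.C *ᵥ b.2.1 + G.D *ᵥ b.2.2.1 + G.B *ᵥ control α K₀ K b.2 := by
    have := (continuous_control hα K₀ K).comp (continuous_snd (X := ℝ))
    simp only [Function.comp_def] at this
    fun_prop
  exact h2.continuousAt.add h1

theorem continuousAt_closedLoop_snd_snd (G : Plant r n m) (α : ℝ)
    (K₀ : Matrix (Fin m) (Fin r) ℝ) (K : Matrix (Fin m) (Fin n ⊕ Fin n) ℝ) (f : ℝ → Fin n → ℝ)
    {a : ℝ × State r n} (ha : a.2.2.1 ≠ 0) :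
    ContinuousAt (fun b : ℝ × State r n => (closedLoop G α K₀ K f b.1 b.2).2.2) a := by
  simp only [closedLoop]
  have h : ContinuousAt (fun b : ℝ × State r n => b.2.2.1) a := by fun_prop
  exact ((ContinuousAt.comp (f := fun b : ℝ × State r n => b.2.2.1)
    (continuousAt_cFun α ha) h).pow 2).smul h

/-- The velocities allowed by Filippov's regularization of the closed loop: only the component
`η'` is set-valued, and only where `σ = 0`, where it may be any vector of the unit ball. -/
structure IsVelocity (G : Plant r n m) (α : ℝ) (K₀ : Matrix (Fin m) (Fin r) ℝ)
    (K : Matrix (Fin m) (Fin n ⊕ Fin n) ℝ) (f : ℝ → Fin n → ℝ) (t : ℝ) (p d : State r n) :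
    Prop where
  fst : d.1 = (closedLoop G α K₀ K f t p).1
  snd_fst : d.2.1 = (closedLoop G α K₀ K f t p).2.1
  snd_snd : p.2.1 ≠ 0 → d.2.2 = (closedLoop G α K₀ K f t p).2.2
  ball : p.2.1 = 0 → euclNorm d.2.2 ≤ 1

theorem IsHullPoint.isVelocity {G : Plant r n m} {α : ℝ} (hα : 0 < α)
    {K₀ : Matrix (Fin m) (Fin r) ℝ} {K : Matrix (Fin m) (Fin n ⊕ Fin n) ℝ} {f : ℝ → Fin n → ℝ}
    {t : ℝ} {p d : State r n} (hf : ContinuousAt f t)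
    (hd : IsHullPoint
      (map (fun b : ℝ × State r n => closedLoop G α K₀ K f b.1 b.2) (𝓝 (t, p))) d) :
    IsVelocity G α K₀ K f t p d := by
  refine ⟨?_, ?_, fun hp => ?_, fun hp => ?_⟩
  · exact hd.map_eq (ContinuousLinearMap.fst ℝ _ _)
      (continuousAt_closedLoop_fst G α K₀ K f (t, p))
  · exact hd.map_eq ((ContinuousLinearMap.fst ℝ _ _).comp (ContinuousLinearMap.snd ℝ _ _))
      (continuousAt_closedLoop_snd_fst G hα K₀ K (a := (t, p)) hf)
  · exact hd.map_eq ((ContinuousLinearMap.snd ℝ _ _).comp (ContinuousLinearMap.snd ℝ _ _))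
      (continuousAt_closedLoop_snd_snd G α K₀ K f (a := (t, p)) hp)
  · refine le_of_forall_pos_le_add fun ε hε => ?_
    have hcont : Continuous fun b : ℝ × State r n => (1 + α * Real.sqrt (euclNorm b.2.2.1)) ^ 2 := by
      have := continuous_euclNorm (ι := Fin n)
      fun_prop
    have hev : ∀ᶠ b : ℝ × State r n in 𝓝 (t, p),
        (1 + α * Real.sqrt (euclNorm b.2.2.1)) ^ 2 < 1 + ε := by
      refine (hcont.tendsto (t, p)).eventually_lt_const ?_
      simp only [hp, euclNorm_zero, Real.sqrt_zero, mul_zero, add_zero, one_pow]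
      linarith
    have hcl : IsClosed {v : State r n | euclNorm v.2.2 ≤ 1 + ε} := by
      have := continuous_euclNorm (ι := Fin n)
      exact isClosed_le (by fun_prop) continuous_const
    have hcv : Convex ℝ {v : State r n | euclNorm v.2.2 ≤ 1 + ε} :=
      (convex_euclNorm_le (ι := Fin n) (1 + ε)).linear_preimage
        (LinearMap.snd ℝ (Fin n → ℝ) (Fin n → ℝ) ∘ₗ LinearMap.snd ℝ (Fin r → ℝ) _)
    refine hd _ hcl hcv (mem_map.2 ?_)
    filter_upwards [hev] with b hb
    exact (euclNorm_cFun_sq_smul_le hα _).trans hb.le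

theorem isVelocity_of_mem_filippovMap {G : Plant r n m} {α : ℝ} (hα : 0 < α)
    {K₀ : Matrix (Fin m) (Fin r) ℝ} {K : Matrix (Fin m) (Fin n ⊕ Fin n) ℝ} {f : ℝ → Fin n → ℝ}
    {t : ℝ} {p d : State r n} (hd : d ∈ filippovMap (closedLoop G α K₀ K f t) p) :
    IsVelocity G α K₀ K f t p d := by
  -- Freezing the disturbance at time `t` does not change the regularization at time `t`.
  have h : IsHullPoint (map (fun b : ℝ × State r n => closedLoop G α K₀ K (fun _ => f t) b.1 b.2)
      (𝓝 (t, p))) d := by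
    intro C hC hCc hmem
    refine IsHullPoint.of_mem_filippovMap hd C hC hCc ?_
    exact (Filter.Eventually.curry_nhds (mem_map.1 hmem)).self_of_nhds
  obtain ⟨h1, h2, h3, h4⟩ := h.isVelocity hα continuousAt_const
  exact ⟨h1, h2, h3, h4⟩

theorem mem_filippovMap_of_isVelocity {G : Plant r n m} {α : ℝ} (hα : 0 < α)
    {K₀ : Matrix (Fin m) (Fin r) ℝ} {K : Matrix (Fin m) (Fin n ⊕ Fin n) ℝ} {f : ℝ → Fin n → ℝ}
    {t : ℝ} {p d : State r n} (hd : IsVelocity G α K₀ K f t p d) :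
    d ∈ filippovMap (closedLoop G α K₀ K f t) p := by
  simp only [filippovMap, mem_iInter]
  intro δ hδ N hN
  set g := closedLoop G α K₀ K f t with hg
  set A := g '' (Metric.ball p δ \ N)
  have hconv : Convex ℝ (closure (convexHull ℝ A)) := (convex_convexHull ℝ A).closure
  have hfst : Continuous fun b => (g b).1 := by
    have h := continuous_iff_continuousAt.2
      (continuousAt_closedLoop_fst G α K₀ K (fun _ => f t))
    exact h.comp (Continuous.prodMk_right t)
  have hsnd : Continuous fun b => (g b).2.1 := by
    have h := continuous_iff_continuousAt.2 fun a =>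
      continuousAt_closedLoop_snd_fst G hα K₀ K (f := fun _ => f t) (a := a) continuousAt_const
    exact h.comp (Continuous.prodMk_right t)
  have hthird : ∀ b : State r n, b.2.1 ≠ 0 → ContinuousAt (fun b => (g b).2.2) b := fun b hb => by
    have h := continuousAt_closedLoop_snd_snd G α K₀ K (fun _ => f t) (a := (t, b)) hb
    exact ContinuousAt.comp (f := fun b : State r n => (t, b)) h
      (Continuous.prodMk_right t).continuousAt
  -- A null set cannot hide the value of `g` at a point of continuity.
  have hcl : ∀ b ∈ Metric.ball p δ, ContinuousAt (fun b => (g b).2.2) b →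
      g b ∈ closure (convexHull ℝ A) := by
    intro b hb hc
    refine closure_mono (subset_convexHull ℝ A) ?_
    have hgc : ContinuousAt g b := hfst.continuousAt.prodMk (hsnd.continuousAt.prodMk hc)
    refine hgc.continuousWithinAt.mem_closure_image ?_
    have hdense : Dense Nᶜ := by
      refine Measure.dense_of_ae (μ := (volume : Measure (State r n))) (p := fun x => x ∉ N) ?_
      exact measure_eq_zero_iff_ae_notMem.1 hN
    rw [sdiff_eq]
    exact hdense.open_subset_closure_inter Metric.isOpen_ball hb
  by_cases hp : p.2.1 = 0
  swap
  · have : d = g p := Prod.ext hd.fst (Prod.ext hd.snd_fst (hd.snd_snd hp))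
    rw [this]
    exact hcl p (Metric.mem_ball_self hδ) (hthird p hp)
  rcases isEmpty_or_nonempty (Fin n) with hn | ⟨⟨i⟩⟩
  · have : d = g p := Prod.ext hd.fst (Prod.ext hd.snd_fst (Subsingleton.elim _ _))
    rw [this]
    refine hcl p (Metric.mem_ball_self hδ) ?_
    exact (continuous_of_const fun x y => Subsingleton.elim _ _).continuousAt
  -- The unit sphere is reached in the limit along rays from `σ = 0`.
  have hsphere : ∀ u : Fin n → ℝ, euclNorm u = 1 →
      ((d.1, d.2.1, u) : State r n) ∈ closure (convexHull ℝ A) := by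
    intro u hu
    set b : ℝ → State r n := fun τ => (p.1, τ • u, p.2.2) with hb
    have hbc : Continuous b := by fun_prop
    have hb0 : b 0 = p := by
      simp only [hb, zero_smul]
      exact Prod.ext rfl (Prod.ext hp.symm rfl)
    have hu0 : u ≠ 0 := by rintro rfl; simp [euclNorm_zero] at hu
    have hbt : Tendsto b (𝓝[>] 0) (𝓝 p) := by
      have := hbc.tendsto 0
      rw [hb0] at this
      exact this.mono_left nhdsWithin_le_nhds
    have h1 : Tendsto (fun τ => (g (b τ)).1) (𝓝[>] 0) (𝓝 d.1) := by
      rw [hd.fst]; exact (hfst.tendsto p).comp hbt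
    have h2 : Tendsto (fun τ => (g (b τ)).2.1) (𝓝[>] 0) (𝓝 d.2.1) := by
      rw [hd.snd_fst]; exact (hsnd.tendsto p).comp hbt
    have h3 : Tendsto (fun τ => (g (b τ)).2.2) (𝓝[>] 0) (𝓝 u) := by
      have h4 : Tendsto (fun τ : ℝ => (1 + α * Real.sqrt τ) ^ 2 • u) (𝓝[>] 0) (𝓝 u) := by
        have hc : Continuous fun τ : ℝ => (1 + α * Real.sqrt τ) ^ 2 • u := by fun_prop
        have := hc.tendsto 0
        simp only [Real.sqrt_zero, mul_zero, add_zero, one_pow, one_smul] at this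
        exact this.mono_left nhdsWithin_le_nhds
      refine h4.congr' ?_
      filter_upwards [self_mem_nhdsWithin] with τ hτ
      have hτ' : (0 : ℝ) < τ := hτ
      have hs := Real.sqrt_pos.2 hτ'
      change _ = cFun α (τ • u) ^ 2 • τ • u
      rw [smul_smul, cFun, euclNorm_smul, hu, mul_one, abs_of_pos hτ']
      congr 1
      nth_rewrite 3 [← Real.sq_sqrt hτ'.le]
      field_simp
    refine isClosed_closure.mem_of_tendsto (h1.prodMk_nhds (h2.prodMk_nhds h3)) ?_
    filter_upwards [hbt (Metric.ball_mem_nhds p hδ), self_mem_nhdsWithin] with τ hτ1 hτ2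
    exact hcl (b τ) hτ1 (hthird _ (smul_ne_zero (ne_of_gt hτ2) hu0))
  obtain ⟨u, hu, a, ha0, ha1, hua⟩ : ∃ u : Fin n → ℝ, euclNorm u = 1 ∧
      ∃ a : ℝ, 0 ≤ a ∧ a ≤ 1 ∧ d.2.2 = a • u := by
    by_cases h0 : d.2.2 = 0
    · exact ⟨Pi.single i 1, by simp [euclNorm], 0, le_rfl, zero_le_one, by simp [h0]⟩
    · have hpos := euclNorm_pos h0
      refine ⟨(euclNorm d.2.2)⁻¹ • d.2.2, ?_, euclNorm d.2.2, hpos.le, hd.ball hp, ?_⟩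
      · rw [euclNorm_smul, abs_of_pos (inv_pos.2 hpos), inv_mul_cancel₀ hpos.ne']
      · rw [smul_smul, mul_inv_cancel₀ hpos.ne', one_smul]
  have h1 := hsphere u hu
  have h2 := hsphere (-u) (by rw [← neg_one_smul ℝ u, euclNorm_smul]; simp [hu])
  have h3 := hconv h1 h2 (a := (1 + a) / 2) (b := (1 - a) / 2) (by linarith) (by linarith)
    (by ring)
  convert h3 using 1
  refine Prod.ext ?_ (Prod.ext ?_ ?_)
  · simp only [Prod.fst_add, Prod.smul_fst]
    rw [← add_smul]
    ring_nf
    simp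
  · simp only [Prod.fst_add, Prod.smul_fst, Prod.snd_add, Prod.smul_snd]
    rw [← add_smul]
    ring_nf
    simp
  · simp only [Prod.snd_add, Prod.smul_snd]
    rw [hua, smul_neg, ← sub_eq_add_neg, ← sub_smul]
    congr 1
    ring

/-! ### Existence and continuation of solutions -/

theorem closedLoop_growth (G : Plant r n m) {α : ℝ} (hα : 0 < α)
    (K₀ : Matrix (Fin m) (Fin r) ℝ) (K : Matrix (Fin m) (Fin n ⊕ Fin n) ℝ) {f : ℝ → Fin n → ℝ}
    (hf : ContinuousOn f (Ici 0)) (T : ℝ) :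
    ∃ M ≥ 0, ∀ t ∈ Icc 0 T, ∀ p, ‖closedLoop G α K₀ K f t p‖ ≤ M * (1 + ‖p‖) := by
  obtain ⟨F, hF⟩ := isCompact_Icc.exists_bound_of_continuousOn
    (hf.mono (Icc_subset_Ici_self : Icc 0 T ⊆ Ici 0))
  obtain ⟨cA, hA0, hA⟩ := exists_mulVec_le G.A
  obtain ⟨cE, hE0, hE⟩ := exists_mulVec_le G.E
  obtain ⟨cC, hC0, hC⟩ := exists_mulVec_le G.C
  obtain ⟨cD, hD0, hD⟩ := exists_mulVec_le G.D
  obtain ⟨cB, hB0, hB⟩ := exists_mulVec_le G.B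
  obtain ⟨c₀, h00, h0⟩ := exists_mulVec_le K₀
  obtain ⟨c₁, h10, h1⟩ := exists_mulVec_le K.toCols₁
  obtain ⟨c₂, h20, h2⟩ := exists_mulVec_le K.toCols₂
  set k₁ : ℝ := 1 + (1 + α) * n with hk₁
  set k : ℝ := c₀ + c₁ * k₁ + c₂ with hk
  set k₂ : ℝ := 2 + 2 * α ^ 2 * n with hk₂
  have hk₁0 : 0 ≤ k₁ := by positivity
  have hk0 : 0 ≤ k := by positivity
  have hk₂0 : 0 ≤ k₂ := by positivity
  refine ⟨(cA + cE) + (cC + cD + cB * k + |F|) + k₂, by positivity, fun t ht p => ?_⟩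
  obtain ⟨ζ, σ, η⟩ := p
  set N := ‖((ζ, σ, η) : State r n)‖ with hN
  have hN0 : 0 ≤ N := norm_nonneg _
  have hζ : ‖ζ‖ ≤ N := norm_fst_le ((ζ, σ, η) : State r n)
  have hση : ‖(σ, η)‖ ≤ N := norm_snd_le ((ζ, σ, η) : State r n)
  have hσ : ‖σ‖ ≤ N := (norm_fst_le (σ, η)).trans hση
  have hη : ‖η‖ ≤ N := (norm_snd_le (σ, η)).trans hση
  set e := euclNorm σ with he
  have he0 : 0 ≤ e := euclNorm_nonneg σ
  have heN : e ≤ n * N := by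
    have := euclNorm_le_card_mul σ
    rw [Fintype.card_fin] at this
    exact this.trans (by gcongr)
  have hs : Real.sqrt e ≤ 1 + e := by
    rw [Real.sqrt_le_iff]
    constructor <;> nlinarith
  have hcσ : ‖cFun α σ • σ‖ ≤ k₁ * (1 + N) := by
    refine (norm_le_euclNorm _).trans ((euclNorm_cFun_smul hα σ).trans_le ?_)
    rw [← he, hk₁]
    nlinarith [mul_le_mul_of_nonneg_left heN hα.le, mul_nonneg hα.le (Nat.cast_nonneg (α := ℝ) n),
      Nat.cast_nonneg (α := ℝ) n]
  have hc2σ : ‖cFun α σ ^ 2 • σ‖ ≤ k₂ * (1 + N) := by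
    refine (norm_le_euclNorm _).trans ((euclNorm_cFun_sq_smul_le hα σ).trans ?_)
    rw [← he, hk₂]
    have h3 : (1 + α * Real.sqrt e) ^ 2 ≤ 2 + 2 * α ^ 2 * e := by
      nlinarith [sq_nonneg (1 - α * Real.sqrt e), Real.sq_sqrt he0]
    have h4 : 2 * α ^ 2 * e ≤ 2 * α ^ 2 * (n * N) := by gcongr
    have h5 : 0 ≤ 2 * α ^ 2 * (n : ℝ) := by positivity
    nlinarith
  have hu : ‖control α K₀ K (ζ, σ, η)‖ ≤ k * (1 + N) := by
    rw [control_eq]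
    refine (norm_add₃_le ..).trans ?_
    have e0 : ‖K₀ *ᵥ ζ‖ ≤ c₀ * N := (h0 _).trans (by gcongr)
    have e1 : ‖K.toCols₁ *ᵥ (cFun α σ • σ)‖ ≤ c₁ * (k₁ * (1 + N)) := (h1 _).trans (by gcongr)
    have e2 : ‖K.toCols₂ *ᵥ η‖ ≤ c₂ * N := (h2 _).trans (by gcongr)
    rw [hk]
    change ‖K₀ *ᵥ ζ‖ + ‖K.toCols₁ *ᵥ (cFun α σ • σ)‖ + ‖K.toCols₂ *ᵥ η‖ ≤ _
    linarith
  have b1 : ‖G.A *ᵥ ζ + G.E *ᵥ σ‖ ≤ (cA + cE) * (1 + N) := by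
    refine (norm_add_le _ _).trans ?_
    have e0 : ‖G.A *ᵥ ζ‖ ≤ cA * N := (hA _).trans (by gcongr)
    have e1 : ‖G.E *ᵥ σ‖ ≤ cE * N := (hE _).trans (by gcongr)
    linarith
  have b2 : ‖G.C *ᵥ ζ + G.D *ᵥ σ + G.B *ᵥ control α K₀ K (ζ, σ, η) + f t‖
      ≤ (cC + cD + cB * k + |F|) * (1 + N) := by
    refine (norm_add_le _ _).trans ?_
    have e0 : ‖G.C *ᵥ ζ‖ ≤ cC * N := (hC _).trans (by gcongr)
    have e1 : ‖G.D *ᵥ σ‖ ≤ cD * N := (hD _).trans (by gcongr)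
    have e2 : ‖G.B *ᵥ control α K₀ K (ζ, σ, η)‖ ≤ cB * (k * (1 + N)) := (hB _).trans (by gcongr)
    have e3 := (hF t ht).trans (le_abs_self F)
    have e4 : 0 ≤ |F| * N := by positivity
    have e5 := norm_add₃_le (a := G.C *ᵥ ζ) (b := G.D *ᵥ σ)
      (c := G.B *ᵥ control α K₀ K (ζ, σ, η))
    linarith
  have p1 : 0 ≤ (cA + cE) * (1 + N) := by positivity
  have p2 : 0 ≤ (cC + cD + cB * k + |F|) * (1 + N) := by positivity
  have p3 : 0 ≤ k₂ * (1 + N) := by positivity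
  simp only [closedLoop, norm_prod_le_iff]
  refine ⟨?_, ?_, ?_⟩ <;> linarith

theorem exists_lipschitz_solution (G : Plant r n m) {α : ℝ} (hα : 0 < α)
    (K₀ : Matrix (Fin m) (Fin r) ℝ) (K : Matrix (Fin m) (Fin n ⊕ Fin n) ℝ) {f : ℝ → Fin n → ℝ}
    (hf : ContinuousOn f (Ici 0)) (s₀ : State r n) :
    ∃ y : ℝ → State r n, y 0 = s₀ ∧ (∀ b : ℝ, ∃ C : NNReal, LipschitzOnWith C y (Icc 0 b)) ∧
      ∀ t > 0, ∀ d, HasDerivAt y d t → d ∈ filippovMap (closedLoop G α K₀ K f t) (y t) := by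
  obtain ⟨y, hy0, hyL, hy⟩ := exists_euler_limit (closedLoop G α K₀ K f)
    (closedLoop_growth G hα K₀ K hf) s₀
  refine ⟨y, hy0, hyL, fun t ht d hd => mem_filippovMap_of_isVelocity hα ?_⟩
  refine IsHullPoint.isVelocity hα (hf.continuousAt (Ici_mem_nhds ht)) ?_
  intro C hC hCc hmem
  obtain ⟨δ, hδ, hsub⟩ := Metric.mem_nhds_iff.1 (mem_map.1 hmem)
  refine closure_minimal (convexHull_min ?_ hCc) hC (hy t ht d hd δ hδ)
  rintro _ ⟨s, -, p, hs, hp, rfl⟩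
  refine hsub (show (s, p) ∈ _ from ?_)
  rw [Metric.mem_ball, Prod.dist_eq, max_lt_iff, Real.dist_eq, dist_eq_norm]
  exact ⟨hs, hp⟩

/-- A locally Lipschitz function is a Filippov solution as soon as its velocities are admissible
wherever they exist. -/
theorem isFilippovSolution_of_lipschitz {g : ℝ → State r n → State r n} {y : ℝ → State r n}
    (hL : ∀ b : ℝ, ∃ C : NNReal, LipschitzOnWith C y (Icc 0 b))
    (h : ∀ᵐ t : ℝ, t > 0 → ∀ d, HasDerivAt y d t → d ∈ filippovMap (g t) (y t)) :
    IsFilippovSolution g ⊤ y := by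
  refine ⟨fun b hb _ => ?_, ?_⟩
  · obtain ⟨C, hC⟩ := hL b
    refine LipschitzOnWith.absolutelyContinuousOnInterval (K := C) ?_
    rwa [uIcc_of_le hb]
  · have hd : ∀ᵐ t : ℝ, ∀ N : ℕ, t ∈ Icc (0 : ℝ) N → DifferentiableWithinAt ℝ y (Icc 0 N) t := by
      rw [ae_all_iff]
      intro N
      obtain ⟨C, hC⟩ := hL N
      exact hC.ae_differentiableWithinAt_of_mem_real
    filter_upwards [h, hd] with t ht hdt h0 _
    obtain ⟨N, hN⟩ := exists_nat_gt t
    have hdiff := (hdt N ⟨h0.le, hN.le⟩).differentiableAt (Icc_mem_nhds h0 hN)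
    exact ⟨_, hdiff.hasDerivAt, ht h0 _ hdiff.hasDerivAt⟩

theorem norm_le_of_mem_filippovMap {X : Type*} [NormedAddCommGroup X] [NormedSpace ℝ X]
    [MeasureSpace X] {g : X → X} {p d : X} {M : ℝ} (hM : 0 ≤ M)
    (hg : ∀ p, ‖g p‖ ≤ M * (1 + ‖p‖)) (hd : d ∈ filippovMap g p) : ‖d‖ ≤ M * (2 + ‖p‖) := by
  refine (IsHullPoint.of_mem_filippovMap hd).norm_le ?_
  rw [eventually_map]
  filter_upwards [Metric.ball_mem_nhds p one_pos] with s hs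
  refine (hg s).trans ?_
  have : ‖s‖ ≤ ‖s - p‖ + ‖p‖ := norm_le_norm_sub_add s p
  rw [mem_ball_iff_norm] at hs
  exact mul_le_mul_of_nonneg_left (by linarith) hM

/-- A solution that stays bounded up to a finite time extends to `[0, ∞)`: it is Lipschitz, hence
has a limit at that time, and can be continued by a solution of the shifted equation. -/
theorem exists_extension (G : Plant r n m) {α : ℝ} (hα : 0 < α)
    (K₀ : Matrix (Fin m) (Fin r) ℝ) (K : Matrix (Fin m) (Fin n ⊕ Fin n) ℝ) {f : ℝ → Fin n → ℝ}
    (hf : ContinuousOn f (Ici 0)) {T : ℝ} (hT : 0 < T) {y : ℝ → State r n}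
    (hy : IsFilippovSolution (closedLoop G α K₀ K f) T y)
    {R : ℝ} (hR : ∀ t ∈ Ico 0 T, ‖y t‖ ≤ R) :
    ∃ Y, IsFilippovSolution (closedLoop G α K₀ K f) ⊤ Y ∧ ∀ t ∈ Ico 0 T, Y t = y t := by
  obtain ⟨M, hM, hg⟩ := closedLoop_growth G hα K₀ K hf T
  have hR0 : 0 ≤ R := (norm_nonneg _).trans (hR 0 ⟨le_rfl, hT⟩)
  set L := M * (2 + R) with hL
  have hL0 : 0 ≤ L := by positivity
  have hsub : ∀ s t, 0 ≤ s → s ≤ t → t < T → ‖y t - y s‖ ≤ L * (t - s) := by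
    intro s t hs hst htT
    refine ac_norm_sub_le hst ((hy.1 t (hs.trans hst) (by exact_mod_cast htT)).mono ?_) ?_
    · rw [uIcc_of_le hst, uIcc_of_le (hs.trans hst)]
      exact Icc_subset_Icc_left hs
    · filter_upwards [hy.2] with τ hτ hτI
      have h0 : 0 < τ := hs.trans_lt hτI.1
      have hτT : τ < T := hτI.2.trans htT
      obtain ⟨d, hd, hdm⟩ := hτ h0 (by exact_mod_cast hτT)
      refine ⟨d, (norm_le_of_mem_filippovMap hM (hg τ ⟨h0.le, hτT.le⟩) hdm).trans ?_, hd⟩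
      have := hR τ ⟨h0.le, hτT⟩
      exact mul_le_mul_of_nonneg_left (by linarith) hM
  have hLip : LipschitzOnWith ⟨L, hL0⟩ y (Ico 0 T) := by
    refine LipschitzOnWith.of_dist_le_mul fun s hs t ht => ?_
    rw [dist_eq_norm, dist_eq_norm, Real.norm_eq_abs]
    change _ ≤ L * _
    rcases le_total s t with hst | hst
    · rw [norm_sub_rev, abs_of_nonpos (by linarith), neg_sub]
      exact hsub s t hs.1 hst ht.2
    · rw [abs_of_nonneg (by linarith)]
      exact hsub t s ht.1 hst hs.2
  obtain ⟨e, he, hey⟩ := hLip.extend_finite_dimension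
  set C₁ := lipschitzExtensionConstant (State r n) * ⟨L, hL0⟩ with hC₁
  obtain ⟨y₂, hy₂0, hy₂L, hy₂⟩ := exists_lipschitz_solution G hα K₀ K (f := fun s => f (s + T))
    (hf.comp (by fun_prop) fun s (hs : 0 ≤ s) => show 0 ≤ s + T by linarith) (e T)
  set Y : ℝ → State r n := fun t => if t < T then e t else y₂ (t - T) with hY
  have hYl : ∀ t, t ≤ T → Y t = e t := fun t ht => by
    rcases ht.lt_or_eq with h | rfl
    · simp [hY, h]
    · simp [hY, hy₂0]
  have hYr : ∀ t, T ≤ t → Y t = y₂ (t - T) := fun t ht => by simp [hY, not_lt.2 ht]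
  refine ⟨Y, isFilippovSolution_of_lipschitz (fun b => ?_) ?_, fun t ht => ?_⟩
  · obtain ⟨C₂, hC₂⟩ := hy₂L (b - T)
    have h1 : ∀ s t, s ≤ t → t ≤ T → ‖Y t - Y s‖ ≤ C₁ * (t - s) := fun s t hst ht => by
      rw [hYl t ht, hYl s (hst.trans ht), ← dist_eq_norm]
      refine (he.dist_le_mul _ _).trans ?_
      rw [Real.dist_eq, abs_of_nonneg (by linarith)]
    have h2 : ∀ s t, T ≤ s → s ≤ t → t ≤ b → ‖Y t - Y s‖ ≤ C₂ * (t - s) := fun s t hs hst ht => by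
      rw [hYr t (hs.trans hst), hYr s hs, ← dist_eq_norm]
      refine (hC₂.dist_le_mul _ ⟨by linarith, by linarith⟩ _ ⟨by linarith, by linarith⟩).trans ?_
      rw [Real.dist_eq, abs_of_nonneg (by linarith)]
      exact le_of_eq (by ring)
    have h3 : ∀ s t, 0 ≤ s → s ≤ t → t ≤ b → ‖Y t - Y s‖ ≤ (C₁ + C₂ : NNReal) * (t - s) := by
      intro s t _ hst ht
      have n1 : (0 : ℝ) ≤ C₁ := C₁.2
      have n2 : (0 : ℝ) ≤ C₂ := C₂.2
      have n3 : 0 ≤ t - s := by linarith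
      push_cast
      rcases le_total t T with htT | htT
      · have := h1 s t hst htT
        nlinarith
      rcases le_total T s with hsT | hsT
      · have := h2 s t hsT hst ht
        nlinarith
      · have a1 := h1 s T hsT le_rfl
        have a2 := h2 T t le_rfl htT ht
        have a3 := norm_sub_le_norm_sub_add_norm_sub (Y t) (Y T) (Y s)
        nlinarith
    refine ⟨C₁ + C₂, LipschitzOnWith.of_dist_le_mul fun s hs t ht => ?_⟩
    rw [dist_eq_norm, dist_eq_norm, Real.norm_eq_abs]
    rcases le_total s t with hst | hst
    · rw [norm_sub_rev, abs_of_nonpos (by linarith), neg_sub]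
      exact h3 s t hs.1 hst ht.2
    · rw [abs_of_nonneg (by linarith)]
      exact h3 t s ht.1 hst hs.2
  · filter_upwards [hy.2, ae_ne T] with t ht htT h0 d hd
    rcases htT.lt_or_gt with h | h
    · obtain ⟨d', hd', hdm⟩ := ht h0 (by exact_mod_cast h)
      have heq : Y =ᶠ[𝓝 t] y := by
        filter_upwards [Ioo_mem_nhds h0 h] with s hs
        rw [hYl s hs.2.le, hey ⟨hs.1.le, hs.2⟩]
      rw [heq.eq_of_nhds, (hd.congr_of_eventuallyEq heq.symm).unique hd']
      exact hdm
    · have heq : y₂ =ᶠ[𝓝 (t - T)] fun s => Y (s + T) := by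
        filter_upwards [Ioi_mem_nhds (sub_pos.2 h)] with s hs
        rw [hYr _ (by linarith [show (0 : ℝ) < s from hs]), add_sub_cancel_right]
      have hd' : HasDerivAt (fun s => Y (s + T)) d (t - T) := by
        refine HasDerivAt.comp_add_const (t - T) T ?_
        rwa [sub_add_cancel]
      have h5 := hy₂ (t - T) (sub_pos.2 h) d (hd'.congr_of_eventuallyEq heq)
      have hshift : closedLoop G α K₀ K (fun s => f (s + T)) (t - T)
          = closedLoop G α K₀ K f t := by
        funext s
        simp [closedLoop]
      rw [hYr t h.le, ← hshift]
      exact h5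
  · rw [hYl t ht.2.le, hey ht]

/-! ### The Lyapunov functions along velocities -/

/-- The vector `R(σ) x = (c(σ) σ, z)`, in which `V` is a quadratic form. -/
noncomputable def gainVec (α : ℝ) (x : Fin n ⊕ Fin n → ℝ) : Fin n ⊕ Fin n → ℝ :=
  Sum.elim (cFun α (x ∘ Sum.inl) • (x ∘ Sum.inl)) (x ∘ Sum.inr)

theorem VFun_eq (α : ℝ) (P : Matrix (Fin n ⊕ Fin n) (Fin n ⊕ Fin n) ℝ) (x : Fin n ⊕ Fin n → ℝ) :
    VFun α P x = gainVec α x ⬝ᵥ P *ᵥ gainVec α x := by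
  have h : Rmat α (x ∘ Sum.inl) *ᵥ x = gainVec α x := by
    rw [Rmat, Matrix.fromBlocks_mulVec]
    simp [gainVec, Matrix.smul_mulVec]
  have ht : (Rmat α (x ∘ Sum.inl))ᵀ = Rmat α (x ∘ Sum.inl) := by
    simp [Rmat, Matrix.fromBlocks_transpose]
  rw [VFun, ← Matrix.mulVec_mulVec, ← Matrix.mulVec_mulVec, h, Matrix.dotProduct_mulVec,
    ← Matrix.mulVec_transpose, ht, h]

theorem continuous_gainVec {α : ℝ} (hα : 0 < α) :
    Continuous (gainVec α : (Fin n ⊕ Fin n → ℝ) → Fin n ⊕ Fin n → ℝ) := by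
  refine continuous_pi fun i => ?_
  rcases i with i | i
  · have h : Continuous fun x : Fin n ⊕ Fin n → ℝ => x ∘ Sum.inl :=
      continuous_pi fun j => continuous_apply _
    exact (continuous_apply i).comp ((continuous_cFun_smul hα).comp h)
  · exact continuous_apply _

theorem continuous_VFun {α : ℝ} (hα : 0 < α) (P : Matrix (Fin n ⊕ Fin n) (Fin n ⊕ Fin n) ℝ) :
    Continuous (VFun α P) := by
  have := continuous_gainVec (n := n) hα
  rw [funext (VFun_eq α P)]
  fun_prop

theorem hasDerivAt_dotProduct {ι : Type*} [Fintype ι] {a b : ℝ → ι → ℝ} {a' b' : ι → ℝ} {t : ℝ}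
    (ha : HasDerivAt a a' t) (hb : HasDerivAt b b' t) :
    HasDerivAt (fun s => a s ⬝ᵥ b s) (a' ⬝ᵥ b t + a t ⬝ᵥ b') t := by
  simp only [dotProduct, ← Finset.sum_add_distrib]
  exact HasDerivAt.fun_sum fun i _ => (hasDerivAt_pi.1 ha i).mul (hasDerivAt_pi.1 hb i)

theorem hasDerivAt_mulVec {ι κ : Type*} [Fintype ι] [Fintype κ] (M : Matrix ι κ ℝ)
    {a : ℝ → κ → ℝ} {a' : κ → ℝ} {t : ℝ} (ha : HasDerivAt a a' t) :
    HasDerivAt (fun s => M *ᵥ a s) (M *ᵥ a') t := by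
  classical
  exact (LinearMap.toContinuousLinearMap M.mulVecLin).hasFDerivAt.comp_hasDerivAt t ha

theorem hasDerivAt_form {ι : Type*} [Fintype ι] {M : Matrix ι ι ℝ} (hM : M.PosDef)
    {a : ℝ → ι → ℝ} {a' : ι → ℝ} {t : ℝ} (ha : HasDerivAt a a' t) :
    HasDerivAt (fun s => a s ⬝ᵥ M *ᵥ a s) (2 * ((M *ᵥ a t) ⬝ᵥ a')) t := by
  have h := hasDerivAt_dotProduct ha (hasDerivAt_mulVec M ha)
  convert h using 1
  rw [posDef_form_comm hM (a t), dotProduct_comm a']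
  ring

theorem ac_sum {ι : Type*} (s : Finset ι) {F : ι → ℝ → ℝ} {a b : ℝ}
    (h : ∀ i ∈ s, AbsolutelyContinuousOnInterval (F i) a b) :
    AbsolutelyContinuousOnInterval (fun t => ∑ i ∈ s, F i t) a b := by
  classical
  induction s using Finset.induction_on with
  | empty =>
    simp only [Finset.sum_empty]
    exact (contDiffOn_const (c := (0 : ℝ))).absolutelyContinuousOnInterval
  | insert i s hi ih =>
    simp only [Finset.sum_insert hi]
    exact (h i (Finset.mem_insert_self i s)).fun_add
      (ih fun j hj => h j (Finset.mem_insert_of_mem hj))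

theorem ac_form {ι : Type*} [Fintype ι] (M : Matrix ι ι ℝ) {F : ℝ → ι → ℝ} {a b : ℝ}
    (h : ∀ i, AbsolutelyContinuousOnInterval (fun t => F t i) a b) :
    AbsolutelyContinuousOnInterval (fun t => F t ⬝ᵥ M *ᵥ F t) a b := by
  simp only [dotProduct, Matrix.mulVec]
  exact ac_sum _ fun i _ => (h i).fun_mul (ac_sum _ fun j _ => (h j).const_mul _)

/-- The derivative of `c(σ)` away from `σ = 0`. -/
theorem hasDerivAt_cFun (α : ℝ) {σ : ℝ → Fin n → ℝ} {s : Fin n → ℝ} {t : ℝ}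
    (hσ : HasDerivAt σ s t) (h0 : σ t ≠ 0) :
    HasDerivAt (fun τ => cFun α (σ τ))
      (-(1 / 2) * (σ t ⬝ᵥ s) / (euclNorm (σ t) ^ 2 * Real.sqrt (euclNorm (σ t)))) t := by
  have he := euclNorm_pos h0
  have h1 : HasDerivAt (fun τ => σ τ ⬝ᵥ σ τ) (2 * (σ t ⬝ᵥ s)) t := by
    convert hasDerivAt_dotProduct hσ hσ using 1
    rw [dotProduct_comm s]
    ring
  have h2 : HasDerivAt (fun τ => euclNorm (σ τ)) (2 * (σ t ⬝ᵥ s) / (2 * euclNorm (σ t))) t :=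
    h1.sqrt (by rw [← euclNorm_sq]; positivity)
  have h3 := h2.sqrt he.ne'
  have hs := Real.sqrt_pos.2 he
  have h4 := (h3.fun_inv hs.ne').add_const α
  have hfun : (fun τ => cFun α (σ τ)) = fun τ => (Real.sqrt (euclNorm (σ τ)))⁻¹ + α := by
    funext τ
    rw [cFun, one_div]
  rw [hfun]
  refine h4.congr_deriv ?_
  rw [Real.sq_sqrt he.le]
  field_simp

/-- The map `a ↦ a - ½ k ⟨σ, a⟩ σ` does not increase the norm if `0 ≤ k ‖σ‖² ≤ 1`. -/
theorem half_projection_le {ι : Type*} [Fintype ι] {k : ℝ} (hk : 0 ≤ k) {σ : ι → ℝ}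
    (h : k * (σ ⬝ᵥ σ) ≤ 1) (a : ι → ℝ) :
    (a - (1 / 2 * (k * (σ ⬝ᵥ a))) • σ) ⬝ᵥ (a - (1 / 2 * (k * (σ ⬝ᵥ a))) • σ) ≤ a ⬝ᵥ a := by
  simp only [sub_dotProduct, dotProduct_sub, smul_dotProduct, dotProduct_smul, smul_eq_mul,
    dotProduct_comm a σ]
  have h1 : 0 ≤ k * (σ ⬝ᵥ a) ^ 2 := by positivity
  nlinarith [mul_nonneg h1 (sub_nonneg.2 h)]

theorem projection_le {ι : Type*} [Fintype ι] {k : ℝ} (hk : 0 ≤ k) {σ : ι → ℝ}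
    (h : k * (σ ⬝ᵥ σ) ≤ 1) (a : ι → ℝ) :
    (-(k * (σ ⬝ᵥ a)) • σ) ⬝ᵥ (-(k * (σ ⬝ᵥ a)) • σ) ≤ a ⬝ᵥ a := by
  have h0 := dotProduct_self_nonneg' (a - (k * (σ ⬝ᵥ a)) • σ)
  simp only [sub_dotProduct, dotProduct_sub, smul_dotProduct, dotProduct_smul, smul_eq_mul,
    dotProduct_comm a σ] at h0 ⊢
  have h1 : 0 ≤ k * (σ ⬝ᵥ a) ^ 2 := by positivity
  nlinarith [mul_nonneg h1 (sub_nonneg.2 h)]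

/-- The decay of `V` away from `σ = 0`: up to the factor `c`, the velocity of `R(σ) x` is that of
the linear system of `A_K` perturbed as in the Riccati estimate. The derivative of the factor `c`
contributes a rank-one contraction along `σ`. -/
theorem V_decay {G : Plant r n m} {H : Matrix (Fin q) (Fin r) ℝ}
    {J : Matrix (Fin q) (Fin m) ℝ} {γ : ℝ} {K₀ : Matrix (Fin m) (Fin r) ℝ}
    {K : Matrix (Fin m) (Fin n ⊕ Fin n) ℝ} {α ρ μ β ϖ κ : ℝ} {S : Matrix (Fin r) (Fin r) ℝ}
    {P : Matrix (Fin n ⊕ Fin n) (Fin n ⊕ Fin n) ℝ} (hγ : 0 < γ)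
    (hF : Feasible G H J γ K₀ K α ρ μ β ϖ κ S P) :
    ∃ l > 0, ∀ (ζ : Fin r → ℝ) (σ z w s : Fin n → ℝ), σ ≠ 0 → euclNorm w ≤ γ⁻¹ →
      s = C0 G K₀ *ᵥ ζ + G.D *ᵥ σ + (G.B * K) *ᵥ Sum.elim (cFun α σ • σ) z →
      2 * ((P *ᵥ Sum.elim (cFun α σ • σ) z) ⬝ᵥ Sum.elim
          (cFun α σ • s + (-(1 / 2) * (σ ⬝ᵥ s) / (euclNorm σ ^ 2 * Real.sqrt (euclNorm σ))) • σ)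
          (cFun α σ ^ 2 • σ + w))
        ≤ cFun α σ * (ρ * (ζ ⬝ᵥ S *ᵥ ζ)
            - (ρ + l) * (Sum.elim (cFun α σ • σ) z ⬝ᵥ P *ᵥ Sum.elim (cFun α σ • σ) z)
            - α⁻¹ * (output H J K₀ ζ ⬝ᵥ output H J K₀ ζ)) := by
  obtain ⟨l, hl, hl'⟩ := riccati_bound hF
  refine ⟨l, hl, fun ζ σ z w s hσ hw hs => ?_⟩
  have hα := hF.alpha_pos
  have he := euclNorm_pos hσ
  have hc := cFun_pos hα σ
  set c := cFun α σ with hcdef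
  set e := euclNorm σ with hedef
  set x := Real.sqrt e with hx
  have hx0 : 0 < x := Real.sqrt_pos.2 he
  have hxe : x ^ 2 = e := Real.sq_sqrt he.le
  have hcx : 1 ≤ c * x := by
    rw [hcdef, cFun, ← hedef, ← hx, add_mul, one_div, inv_mul_cancel₀ hx0.ne']
    have := mul_pos hα hx0
    linarith
  set y : Fin n ⊕ Fin n → ℝ := Sum.elim (c • σ) z with hy
  set k := 1 / (c * (e ^ 2 * x)) with hk
  have hk0 : 0 ≤ k := by positivity
  have hσσ : σ ⬝ᵥ σ = e ^ 2 := (euclNorm_sq σ).symm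
  have hk1 : k * (σ ⬝ᵥ σ) ≤ 1 := by
    rw [hσσ, hk, one_div, inv_mul_le_iff₀ (by positivity), mul_one]
    nlinarith [sq_nonneg e]
  set a₁ := (G.B * K) *ᵥ y
  set a₃ := G.D *ᵥ σ
  set a₄ := C0 G K₀ *ᵥ ζ
  have hyl : y ∘ Sum.inl = c • σ := by rw [hy, Sum.elim_comp_inl]
  have hkey := hl' y (-(k * (σ ⬝ᵥ a₁)) • σ) (c⁻¹ • w) (a₃ - (1 / 2 * (k * (σ ⬝ᵥ a₃))) • σ)
    (a₄ - (1 / 2 * (k * (σ ⬝ᵥ a₄))) • σ) (projection_le hk0 hk1 a₁) ?_ ?_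
  · have hw4 := half_projection_le hk0 hk1 a₄
    have hw4' := mul_le_mul_of_nonneg_left hw4 (inv_pos.2 hF.kappa_pos).le
    have hcoup := coupling_bound hF ζ
    have hvel : (Sum.elim (c • s + (-(1 / 2) * (σ ⬝ᵥ s) / (e ^ 2 * x)) • σ) (c ^ 2 • σ + w) :
        Fin n ⊕ Fin n → ℝ) = c • Sum.elim (a₁ + (1 / 2 : ℝ) • (-(k * (σ ⬝ᵥ a₁)) • σ)
          + (a₃ - (1 / 2 * (k * (σ ⬝ᵥ a₃))) • σ + (a₄ - (1 / 2 * (k * (σ ⬝ᵥ a₄))) • σ)))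
          (y ∘ Sum.inl + c⁻¹ • w) := by
      have hks : -(1 / 2) * (σ ⬝ᵥ s) / (e ^ 2 * x)
          = -(c * (1 / 2 * (k * (σ ⬝ᵥ a₁ + σ ⬝ᵥ a₃ + σ ⬝ᵥ a₄)))) := by
        rw [hs, dotProduct_add, dotProduct_add, hk]
        field_simp
        ring
      rw [hks, hs, hyl]
      ext (i | i)
      · simp only [Sum.elim_inl, Pi.smul_apply, Pi.add_apply, Pi.sub_apply, smul_eq_mul]
        ring
      · simp only [Sum.elim_inr, Pi.smul_apply, Pi.add_apply, smul_eq_mul]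
        field_simp
    rw [hvel, dotProduct_smul, sum_elim_dotProduct, smul_eq_mul, mul_left_comm]
    exact mul_le_mul_of_nonneg_left (by linarith) hc.le
  · rw [hyl]
    simp only [smul_dotProduct, dotProduct_smul, smul_eq_mul]
    rw [← euclNorm_sq w, hσσ]
    have h1 : c⁻¹ * (c⁻¹ * euclNorm w ^ 2) ≤ c⁻¹ * (c⁻¹ * γ⁻¹ ^ 2) := by
      have := euclNorm_nonneg w
      gcongr
    have h2 : 1 ≤ c ^ 2 * e := by
      rw [← hxe, ← mul_pow]
      exact one_le_pow₀ hcx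
    have h3 : c⁻¹ ≤ c * e := by
      rw [inv_le_iff_one_le_mul₀ hc]
      linarith
    refine h1.trans ?_
    have h4 : c⁻¹ * c⁻¹ ≤ (c * e) * (c * e) := by gcongr
    calc c⁻¹ * (c⁻¹ * γ⁻¹ ^ 2) = γ⁻¹ ^ 2 * (c⁻¹ * c⁻¹) := by ring
      _ ≤ γ⁻¹ ^ 2 * ((c * e) * (c * e)) := by gcongr
      _ = _ := by ring
  · rw [hyl, Matrix.mulVec_smul]
    refine (half_projection_le hk0 hk1 a₃).trans ?_
    simp only [smul_dotProduct, dotProduct_smul, smul_eq_mul]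
    have h1 : 1 ≤ α⁻¹ * c := by
      rw [inv_mul_eq_div, one_le_div hα]
      exact le_cFun α σ
    have h2 : 1 ≤ (α⁻¹ * c) ^ 2 := one_le_pow₀ h1
    calc a₃ ⬝ᵥ a₃ ≤ (α⁻¹ * c) ^ 2 * (a₃ ⬝ᵥ a₃) :=
          le_mul_of_one_le_left (dotProduct_self_nonneg' _) h2
      _ = _ := by ring

/-! ### Regularity of trajectories -/

theorem closedLoop_snd_fst_eq {G : Plant r n m} {K : Matrix (Fin m) (Fin n ⊕ Fin n) ℝ}
    (hU : IsUnit (G.B * K.toCols₂)) (α : ℝ) (K₀ : Matrix (Fin m) (Fin r) ℝ)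
    (f : ℝ → Fin n → ℝ) (t : ℝ) (p : State r n) :
    (closedLoop G α K₀ K f t p).2.1
      = C0 G K₀ *ᵥ p.1 + G.D *ᵥ p.2.1 + (G.B * K) *ᵥ gainVec α (xState G K f t p) := by
  have h1 : (G.B * K.toCols₂) *ᵥ ((G.B * K.toCols₂)⁻¹ *ᵥ f t) = f t := by
    rw [Matrix.mulVec_mulVec, Matrix.mul_nonsing_inv _ ((Matrix.isUnit_iff_isUnit_det _).1 hU),
      Matrix.one_mulVec]
  simp only [closedLoop, control_eq, gainVec, xState, toCols_mulVec, Sum.elim_comp_inl,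
    Sum.elim_comp_inr, Matrix.mulVec_add, h1, C0, Matrix.add_mulVec, Matrix.mulVec_mulVec]
  abel

section Trajectory

variable {G : Plant r n m} {α γ : ℝ} {K₀ : Matrix (Fin m) (Fin r) ℝ}
  {K : Matrix (Fin m) (Fin n ⊕ Fin n) ℝ} {f : ℝ → Fin n → ℝ} {T : EReal} {y : ℝ → State r n}
  {b : ℝ}

theorem Admissible.continuousOn (hf : Admissible G K γ f) : ContinuousOn f (Ici 0) := by
  intro t ht
  have h := (hf.1 (t + 1) (by linarith [show (0 : ℝ) ≤ t from ht])).continuousOn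
  rw [uIcc_of_le (by linarith [show (0 : ℝ) ≤ t from ht])] at h
  refine (h t ⟨ht, by linarith⟩).mono_of_mem_nhdsWithin ?_
  rw [← Ici_inter_Iic]
  exact inter_mem_nhdsWithin _ (Iic_mem_nhds (by linarith))

theorem IsFilippovSolution.continuousOn {g : ℝ → State r n → State r n}
    (hy : IsFilippovSolution g T y) (hb : 0 ≤ b) (hbT : (b : EReal) < T) :
    ContinuousOn y (Icc 0 b) := by
  have := (hy.1 b hb hbT).continuousOn
  rwa [uIcc_of_le hb] at this

theorem continuousOn_xState (hf : ContinuousOn f (Icc 0 b)) (hy : ContinuousOn y (Icc 0 b)) :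
    ContinuousOn (fun t => xState G K f t (y t)) (Icc 0 b) := by
  refine continuousOn_pi.2 fun i => ?_
  rcases i with i | i
  · have : Continuous fun p : State r n => p.2.1 i := by fun_prop
    exact this.comp_continuousOn hy
  · have h1 : Continuous fun p : State r n => p.2.2 i := by fun_prop
    have h2 : Continuous fun v : Fin n → ℝ => ((G.B * K.toCols₂)⁻¹ *ᵥ v) i := by fun_prop
    exact (h1.comp_continuousOn hy).add (h2.comp_continuousOn hf)

theorem hasDerivAt_zeta (hα : 0 < α) (hb : 0 ≤ b) (hbT : (b : EReal) < T)
    (hy : IsFilippovSolution (closedLoop G α K₀ K f) T y) :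
    ∀ t ∈ Ioo 0 b, HasDerivAt (fun t => (y t).1) (G.A *ᵥ (y t).1 + G.E *ᵥ (y t).2.1) t := by
  refine ac_hasDerivAt_of_ae (ac_lipschitz_comp LipschitzWith.prod_fst (hy.1 b hb hbT)) ?_ ?_
  · have : Continuous fun p : State r n => G.A *ᵥ p.1 + G.E *ᵥ p.2.1 := by fun_prop
    exact this.comp_continuousOn (hy.continuousOn hb hbT)
  · filter_upwards [hy.2] with t ht htI
    obtain ⟨d, hd, hdm⟩ := ht htI.1 ((EReal.coe_lt_coe_iff.2 htI.2).trans hbT)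
    have h1 := (isVelocity_of_mem_filippovMap hα hdm).fst
    have h2 := (ContinuousLinearMap.fst ℝ (Fin r → ℝ) ((Fin n → ℝ) × (Fin n → ℝ))).hasFDerivAt
      |>.comp_hasDerivAt t hd
    exact h2.congr_deriv h1

/-- The velocity of `σ` along a trajectory. -/
noncomputable def sigmaVel (G : Plant r n m) (α : ℝ) (K₀ : Matrix (Fin m) (Fin r) ℝ)
    (K : Matrix (Fin m) (Fin n ⊕ Fin n) ℝ) (f : ℝ → Fin n → ℝ) (y : ℝ → State r n) (t : ℝ) :
    Fin n → ℝ :=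
  C0 G K₀ *ᵥ (y t).1 + G.D *ᵥ (y t).2.1 + (G.B * K) *ᵥ gainVec α (xState G K f t (y t))

theorem continuousOn_sigmaVel (hα : 0 < α) (hf : ContinuousOn f (Icc 0 b))
    (hy : ContinuousOn y (Icc 0 b)) : ContinuousOn (sigmaVel G α K₀ K f y) (Icc 0 b) := by
  have h1 : Continuous fun p : State r n => C0 G K₀ *ᵥ p.1 + G.D *ᵥ p.2.1 := by fun_prop
  have h2 : Continuous fun v : Fin n ⊕ Fin n → ℝ => (G.B * K) *ᵥ gainVec α v := by
    have := continuous_gainVec (n := n) hα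
    fun_prop
  exact (h1.comp_continuousOn hy).add (h2.comp_continuousOn (continuousOn_xState hf hy))

theorem hasDerivAt_sigma (hα : 0 < α) (hU : IsUnit (G.B * K.toCols₂)) (hb : 0 ≤ b)
    (hbT : (b : EReal) < T) (hf : ContinuousOn f (Icc 0 b))
    (hy : IsFilippovSolution (closedLoop G α K₀ K f) T y) :
    ∀ t ∈ Ioo 0 b, HasDerivAt (fun t => (y t).2.1) (sigmaVel G α K₀ K f y t) t := by
  refine ac_hasDerivAt_of_ae (ac_lipschitz_comp
    (LipschitzWith.prod_fst.comp LipschitzWith.prod_snd) (hy.1 b hb hbT))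
    (continuousOn_sigmaVel hα hf (hy.continuousOn hb hbT)) ?_
  filter_upwards [hy.2] with t ht htI
  obtain ⟨d, hd, hdm⟩ := ht htI.1 ((EReal.coe_lt_coe_iff.2 htI.2).trans hbT)
  have h1 := (isVelocity_of_mem_filippovMap hα hdm).snd_fst
  have h2 := ((ContinuousLinearMap.fst ℝ (Fin n → ℝ) (Fin n → ℝ)).comp
    (ContinuousLinearMap.snd ℝ (Fin r → ℝ) _)).hasFDerivAt |>.comp_hasDerivAt t hd
  rw [closedLoop_snd_fst_eq hU] at h1
  exact h2.congr_deriv h1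

theorem ac_xState (hb : 0 ≤ b) (hbT : (b : EReal) < T) (hf : Admissible G K γ f)
    (hy : IsFilippovSolution (closedLoop G α K₀ K f) T y) :
    ∀ i, AbsolutelyContinuousOnInterval (fun t => xState G K f t (y t) i) 0 b := by
  have h2 : AbsolutelyContinuousOnInterval (fun t => (y t).2) 0 b :=
    ac_lipschitz_comp LipschitzWith.prod_snd (hy.1 b hb hbT)
  have hM : AbsolutelyContinuousOnInterval (fun t => (G.B * K.toCols₂)⁻¹ *ᵥ f t) 0 b :=
    ac_lipschitz_comp (LinearMap.toContinuousLinearMap (G.B * K.toCols₂)⁻¹.mulVecLin).lipschitz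
      (hf.1 b hb)
  rintro (i | i)
  · have h3 : AbsolutelyContinuousOnInterval (fun t => (y t).2.1) 0 b :=
      ac_lipschitz_comp LipschitzWith.prod_fst h2
    exact ac_lipschitz_comp (φ := fun v : Fin n → ℝ => v i) (LipschitzWith.eval i) h3
  · have h3 : AbsolutelyContinuousOnInterval (fun t => (y t).2.2) 0 b :=
      ac_lipschitz_comp LipschitzWith.prod_snd h2
    have h4 : AbsolutelyContinuousOnInterval
        (fun t => (y t).2.2 + (G.B * K.toCols₂)⁻¹ *ᵥ f t) 0 b := h3.fun_add hM
    have h5 := ac_lipschitz_comp (φ := fun v : Fin n → ℝ => v i) (LipschitzWith.eval i) h4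
    exact h5

/-- Away from `σ = 0`, the state `z` moves, at almost every time, with velocity `c(σ)² σ + w`
where `‖w‖ ≤ γ⁻¹`. -/
theorem ae_hasDerivAt_z (hα : 0 < α) (hb : 0 ≤ b) (hbT : (b : EReal) < T)
    (hf : Admissible G K γ f) (hy : IsFilippovSolution (closedLoop G α K₀ K f) T y) :
    ∀ᵐ t : ℝ, t ∈ Ioo 0 b → (y t).2.1 ≠ 0 → ∃ w : Fin n → ℝ, euclNorm w ≤ γ⁻¹ ∧
      HasDerivAt (fun t => (y t).2.2 + (G.B * K.toCols₂)⁻¹ *ᵥ f t)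
        (cFun α (y t).2.1 ^ 2 • (y t).2.1 + w) t := by
  have hfd : ∀ᵐ t : ℝ, ∀ i, t ∈ uIcc 0 b → DifferentiableAt ℝ (fun t => f t i) t := by
    rw [ae_all_iff]
    exact fun i => (ac_lipschitz_comp (LipschitzWith.eval i) (hf.1 b hb)).ae_differentiableAt
  filter_upwards [hy.2, hf.2, hfd] with t ht hft hfdt htI hσ
  obtain ⟨d, hd, hdm⟩ := ht htI.1 ((EReal.coe_lt_coe_iff.2 htI.2).trans hbT)
  have h1 := (isVelocity_of_mem_filippovMap hα hdm).snd_snd hσ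
  have h2 := ((ContinuousLinearMap.snd ℝ (Fin n → ℝ) (Fin n → ℝ)).comp
    (ContinuousLinearMap.snd ℝ (Fin r → ℝ) _)).hasFDerivAt |>.comp_hasDerivAt t hd
  have htb : t ∈ uIcc 0 b := by
    rw [uIcc_of_le hb]; exact Ioo_subset_Icc_self htI
  have h3 : HasDerivAt f (deriv f t) t :=
    (differentiableAt_pi.2 fun i => hfdt i htb).hasDerivAt
  refine ⟨_, hft htI.1, ?_⟩
  exact (h2.congr_deriv h1).add (hasDerivAt_mulVec _ h3)

theorem lipschitz_cFun_of_ne_zero {σ s : ℝ → Fin n → ℝ} {a b : ℝ} (α : ℝ)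
    (hσ : ∀ t ∈ Icc a b, HasDerivAt σ (s t) t) (hs : ContinuousOn s (Icc a b))
    (h0 : ∀ t ∈ Icc a b, σ t ≠ 0) :
    ∃ C : NNReal, LipschitzOnWith C (fun t => cFun α (σ t)) (Icc a b) := by
  have hσc : ContinuousOn σ (Icc a b) := fun t ht => (hσ t ht).continuousAt.continuousWithinAt
  have hec : ContinuousOn (fun t => euclNorm (σ t)) (Icc a b) :=
    continuous_euclNorm.comp_continuousOn hσc
  have hdc : ContinuousOn (fun t => -(1 / 2) * (σ t ⬝ᵥ s t) /
      (euclNorm (σ t) ^ 2 * Real.sqrt (euclNorm (σ t)))) (Icc a b) := by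
    refine ContinuousOn.div (continuousOn_const.mul ?_) ((hec.pow 2).mul hec.sqrt) fun t ht => ?_
    · simp only [dotProduct]
      exact continuousOn_finsetSum _ fun i _ =>
        (continuousOn_pi.1 hσc i).mul (continuousOn_pi.1 hs i)
    · have he := euclNorm_pos (h0 t ht)
      have := Real.sqrt_pos.2 he
      positivity
  obtain ⟨C, hC⟩ := isCompact_Icc.exists_bound_of_continuousOn hdc
  refine ⟨C.toNNReal, (convex_Icc a b).lipschitzOnWith_of_nnnorm_hasDerivWithin_le
    (fun t ht => (hasDerivAt_cFun α (hσ t ht) (h0 t ht)).hasDerivWithinAt) fun t ht => ?_⟩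
  rw [← NNReal.coe_le_coe, coe_nnnorm]
  exact (hC t ht).trans (Real.le_coe_toNNReal C)

end Trajectory

/-! ### Dissipation along trajectories -/

/-- The value of `ν` along a trajectory. -/
noncomputable def nuAlong (G : Plant r n m) (α : ℝ) (K : Matrix (Fin m) (Fin n ⊕ Fin n) ℝ)
    (S : Matrix (Fin r) (Fin r) ℝ) (P : Matrix (Fin n ⊕ Fin n) (Fin n ⊕ Fin n) ℝ)
    (f : ℝ → Fin n → ℝ) (y : ℝ → State r n) (t : ℝ) : ℝ :=
  nuFun α S P (y t).1 (xState G K f t (y t))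

theorem nuFun_nonneg {α : ℝ} {S : Matrix (Fin r) (Fin r) ℝ}
    {P : Matrix (Fin n ⊕ Fin n) (Fin n ⊕ Fin n) ℝ} (hS : S.PosDef) (ζ : Fin r → ℝ)
    (x : Fin n ⊕ Fin n → ℝ) : 0 ≤ nuFun α S P ζ x :=
  le_max_of_le_left (posDef_form_nonneg hS ζ)

/-- The decrease of `ν`, with rate `l ν + ‖ξ‖²`, immediately after every time at which `ν > 0`.
If `σ ≠ 0` right after the given time, this follows from the estimates of `v'` and `V'`, since
`V` is absolutely continuous away from `σ = 0`. The remaining case is `σ = σ' = 0`. There `V`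
need not be differentiable along the trajectory, but `V < v`, so that `ν` agrees with `v`. -/
theorem eventually_nuAlong_le {G : Plant r n m} {H : Matrix (Fin q) (Fin r) ℝ}
    {J : Matrix (Fin q) (Fin m) ℝ} {γ : ℝ} {K₀ : Matrix (Fin m) (Fin r) ℝ}
    {K : Matrix (Fin m) (Fin n ⊕ Fin n) ℝ} {α ρ μ β ϖ κ : ℝ} {S : Matrix (Fin r) (Fin r) ℝ}
    {P : Matrix (Fin n ⊕ Fin n) (Fin n ⊕ Fin n) ℝ} (hγ : 0 < γ)
    (hF : Feasible G H J γ K₀ K α ρ μ β ϖ κ S P) :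
    ∃ l > 0, ∀ (f : ℝ → Fin n → ℝ), Admissible G K γ f → ∀ (T : EReal) (y : ℝ → State r n),
      IsFilippovSolution (closedLoop G α K₀ K f) T y → ∀ b : ℝ, 0 ≤ b → (b : EReal) < T →
      ∀ p : ℝ → ℝ, Continuous p → (∀ t ∈ Icc 0 b, p t = l * nuAlong G α K S P f y t
        + output H J K₀ (y t).1 ⬝ᵥ output H J K₀ (y t).1) →
      ∀ t ∈ Ioo 0 b, 0 < nuAlong G α K S P f y t →
        ∀ᶠ s in 𝓝[>] t, nuAlong G α K S P f y s + ∫ x in t..s, p x ≤ nuAlong G α K S P f y t := by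
  obtain ⟨l₁, hl₁, hV⟩ := V_decay hγ hF
  obtain ⟨l₂, hl₂, hv⟩ := linear_bound hF
  obtain ⟨l₃, hl₃, hslide⟩ := sliding_bound hF
  have hα := hF.alpha_pos
  have hU := isUnit_BK₂ hF
  refine ⟨min (α * l₁) l₂, by positivity, ?_⟩
  set l := min (α * l₁) l₂
  intro f hf T y hy b hb hbT p hp hpe t₀ ht₀ hpos
  have hl1 : l ≤ α * l₁ := min_le_left _ _
  have hl2 : l ≤ l₂ := min_le_right _ _
  set ν := nuAlong G α K S P f y with hν
  set x : ℝ → Fin n ⊕ Fin n → ℝ := fun t => xState G K f t (y t) with hx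
  set v : ℝ → ℝ := fun t => (y t).1 ⬝ᵥ S *ᵥ (y t).1 with hvdef
  set V : ℝ → ℝ := fun t => gainVec α (x t) ⬝ᵥ P *ᵥ gainVec α (x t) with hVdef
  set ξ : ℝ → ℝ := fun t => output H J K₀ (y t).1 ⬝ᵥ output H J K₀ (y t).1 with hξ
  have hνmax : ν = fun t => max (v t) (V t) := by
    funext t
    simp only [hν, nuAlong, nuFun, vFun, VFun_eq, hvdef, hVdef, hx]
  have hξ0 : ∀ t, 0 ≤ ξ t := fun t => dotProduct_self_nonneg' _
  have hV0 : ∀ t, 0 ≤ V t := fun t => posDef_form_nonneg hF.P_pos _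
  have hv0 : ∀ t, 0 ≤ v t := fun t => posDef_form_nonneg hF.S_pos _
  have hyc := hy.continuousOn hb hbT
  have hfc : ContinuousOn f (Icc 0 b) := hf.continuousOn.mono Icc_subset_Ici_self
  have hxc : ContinuousOn x (Icc 0 b) := continuousOn_xState hfc hyc
  have hvc : ContinuousOn v (Icc 0 b) := by
    have : Continuous fun s : State r n => s.1 ⬝ᵥ S *ᵥ s.1 := by fun_prop
    exact this.comp_continuousOn hyc
  have hVc : ContinuousOn V (Icc 0 b) := by
    have hg := continuous_gainVec (n := n) hα
    have : Continuous fun s : Fin n ⊕ Fin n → ℝ => gainVec α s ⬝ᵥ P *ᵥ gainVec α s := by fun_prop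
    exact this.comp_continuousOn hxc
  have hζ := hasDerivAt_zeta hα hb hbT hy
  have hσ := hasDerivAt_sigma hα hU hb hbT hfc hy
  set Q : ℝ → ℝ := fun s => ∫ x in t₀..s, p x with hQ
  have hQd : ∀ s, HasDerivAt Q (p s) s := fun s => (hp.integral_hasStrictDerivAt t₀ s).hasDerivAt
  have hQac : ∀ s t, AbsolutelyContinuousOnInterval Q s t := fun s t => by
    have : ContDiff ℝ 1 Q := by
      rw [contDiff_one_iff_deriv]
      refine ⟨fun s => (hQd s).differentiableAt, ?_⟩
      rwa [show deriv Q = p from funext fun s => (hQd s).deriv]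
    exact this.contDiffOn.absolutelyContinuousOnInterval
  have hQc : Continuous Q := continuous_iff_continuousAt.2 fun s => (hQd s).continuousAt
  have hQt : Q t₀ = 0 := intervalIntegral.integral_same
  have hgain : ∀ t, gainVec α (x t) = Sum.elim (cFun α (y t).2.1 • (y t).2.1)
      ((y t).2.2 + (G.B * K.toCols₂)⁻¹ *ᵥ f t) := fun t => rfl
  have hζac : AbsolutelyContinuousOnInterval (fun t => (y t).1) 0 b :=
    ac_lipschitz_comp LipschitzWith.prod_fst (hy.1 b hb hbT)
  have hvac : AbsolutelyContinuousOnInterval v 0 b :=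
    ac_form S fun i => ac_lipschitz_comp (φ := fun v : Fin r → ℝ => v i) (LipschitzWith.eval i) hζac
  have hvd : ∀ t ∈ Ioo 0 b, ∃ d, HasDerivAt v d t ∧ d ≤ ρ * V t - (ρ + l₂) * v t - ξ t := by
    intro t ht
    refine ⟨_, hasDerivAt_form hF.S_pos (hζ t ht), ?_⟩
    exact hv _ _ ((y t).2.2 + (G.B * K.toCols₂)⁻¹ *ᵥ f t) _ (le_cFun α _)
  -- The decrease on compact intervals free of zeros of `σ`.
  have hfree : ∀ s t, 0 < s → s ≤ t → t < b → (∀ τ ∈ Icc s t, (y τ).2.1 ≠ 0) →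
      ν t + Q t ≤ ν s + Q s := by
    intro s t hs hst htb hne
    have hsub : Icc s t ⊆ Ioo 0 b := fun τ hτ => ⟨hs.trans_le hτ.1, hτ.2.trans_lt htb⟩
    have hsub' : uIcc s t ⊆ uIcc 0 b := by
      rw [uIcc_of_le hst, uIcc_of_le hb]
      exact hsub.trans Ioo_subset_Icc_self
    obtain ⟨C, hC⟩ := lipschitz_cFun_of_ne_zero α (fun τ hτ => hσ τ (hsub hτ))
      ((continuousOn_sigmaVel hα hfc hyc).mono (hsub.trans Ioo_subset_Icc_self)) hne
    rw [← uIcc_of_le hst] at hC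
    have hcac := hC.absolutelyContinuousOnInterval
    have hxac : ∀ i, AbsolutelyContinuousOnInterval (fun τ => x τ i) s t := fun i =>
      (ac_xState hb hbT hf hy i).mono hsub'
    have hVac : AbsolutelyContinuousOnInterval V s t := by
      refine ac_form P fun i => ?_
      rcases i with i | i
      · exact hcac.fun_mul (hxac (Sum.inl i))
      · exact hxac (Sum.inr i)
    have hνac : AbsolutelyContinuousOnInterval (fun τ => max (v τ) (V τ)) s t :=
      ac_max (hvac.mono hsub') hVac
    rw [hνmax]
    refine ac_le_of_deriv_nonpos (W := fun τ => max (v τ) (V τ) + Q τ) hst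
      (hνac.fun_add (hQac s t)) ?_
    filter_upwards [hνac.ae_differentiableAt, ae_hasDerivAt_z hα hb hbT hf hy] with τ hτd hτz hτ
    have hτI : τ ∈ Ioo 0 b := hsub (Ioo_subset_Icc_self hτ)
    have hτ0 := hne τ (Ioo_subset_Icc_self hτ)
    have hd := (hτd (by rw [uIcc_of_le hst]; exact Ioo_subset_Icc_self hτ)).hasDerivAt
    obtain ⟨w, hw, hz⟩ := hτz hτI hτ0
    obtain ⟨dv, hdv, hdv'⟩ := hvd τ hτI
    have hY : HasDerivAt (fun τ => gainVec α (x τ)) (Sum.elim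
        (cFun α (y τ).2.1 • sigmaVel G α K₀ K f y τ + (-(1 / 2) *
          ((y τ).2.1 ⬝ᵥ sigmaVel G α K₀ K f y τ) / (euclNorm (y τ).2.1 ^ 2 *
            Real.sqrt (euclNorm (y τ).2.1))) • (y τ).2.1)
        (cFun α (y τ).2.1 ^ 2 • (y τ).2.1 + w)) τ := by
      have h1 := (hasDerivAt_cFun α (hσ τ hτI) hτ0).fun_smul (hσ τ hτI)
      refine hasDerivAt_pi.2 fun i => ?_
      rcases i with i | i
      · exact hasDerivAt_pi.1 h1 i
      · exact hasDerivAt_pi.1 hz i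
    obtain ⟨dV, hdV, hdV'⟩ : ∃ d, HasDerivAt V d τ ∧
        d ≤ cFun α (y τ).2.1 * (ρ * v τ - (ρ + l₁) * V τ - α⁻¹ * ξ τ) :=
      ⟨_, hasDerivAt_form hF.P_pos hY, hV (y τ).1 (y τ).2.1
        ((y τ).2.2 + (G.B * K.toCols₂)⁻¹ *ᵥ f τ) w (sigmaVel G α K₀ K f y τ) hτ0 hw rfl⟩
    refine ⟨_, ?_, hd.add (hQd τ)⟩
    have hpτ : p τ = l * max (v τ) (V τ) + ξ τ := by
      rw [hpe τ (Ioo_subset_Icc_self hτI), hνmax]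
    rw [hpτ]
    rcases le_total (V τ) (v τ) with hle | hle
    · rw [hasDerivAt_max_eq hdv hd hle, max_eq_left hle]
      have h1 := mul_le_mul_of_nonneg_left hle hF.rho_pos.le
      have h2 := mul_le_mul_of_nonneg_right hl2 (hv0 τ)
      linarith
    · have hd' : HasDerivAt (fun τ => max (V τ) (v τ)) (deriv (fun τ => max (v τ) (V τ)) τ) τ := by
        simpa only [max_comm] using hd
      rw [hasDerivAt_max_eq hdV hd' hle, max_eq_right hle]
      have hc := le_cFun α (y τ).2.1
      have h1 := mul_le_mul_of_nonneg_left hle hF.rho_pos.le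
      have h2 : ρ * v τ - (ρ + l₁) * V τ - α⁻¹ * ξ τ ≤ -(l₁ * V τ + α⁻¹ * ξ τ) := by linarith
      have h3 : 0 ≤ l₁ * V τ + α⁻¹ * ξ τ := by
        have := hV0 τ
        have := hξ0 τ
        positivity
      have h4 : cFun α (y τ).2.1 * (ρ * v τ - (ρ + l₁) * V τ - α⁻¹ * ξ τ)
          ≤ -(α * (l₁ * V τ + α⁻¹ * ξ τ)) := by
        have h5 := mul_le_mul_of_nonneg_left h2 (hα.le.trans hc)
        have h6 := mul_le_mul_of_nonneg_right hc h3
        linarith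
      have h7 : α * (l₁ * V τ + α⁻¹ * ξ τ) = α * l₁ * V τ + ξ τ := by
        rw [mul_add, mul_inv_cancel_left₀ hα.ne', mul_assoc]
      have h8 := mul_le_mul_of_nonneg_right hl1 (hV0 τ)
      have h9 := hdV'.trans h4
      linarith
  have hcont : Tendsto (fun s => ν s + Q s) (𝓝[>] t₀) (𝓝 (ν t₀)) := by
    have h1 : ContinuousOn (fun s => ν s + Q s) (Icc 0 b) := by
      rw [hνmax]
      exact (hvc.sup hVc).add hQc.continuousOn
    have h2 := (h1.continuousAt (Icc_mem_nhds ht₀.1 ht₀.2)).tendsto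
    simp only [hQt, add_zero] at h2
    exact h2.mono_left nhdsWithin_le_nhds
  have hcaseA : (∀ᶠ s in 𝓝[>] t₀, (y s).2.1 ≠ 0) → ∀ᶠ s in 𝓝[>] t₀, ν s + Q s ≤ ν t₀ := by
    intro hev
    obtain ⟨c, hc, hsub⟩ := (mem_nhdsGT_iff_exists_Ioo_subset' ht₀.2).1 hev
    filter_upwards [Ioo_mem_nhdsGT (lt_min hc ht₀.2)] with s hs
    refine ge_of_tendsto hcont ?_
    filter_upwards [Ioo_mem_nhdsGT hs.1] with u hu
    refine hfree u s (ht₀.1.trans hu.1) hu.2.le (hs.2.trans_le (min_le_right _ _)) fun τ hτ => ?_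
    exact hsub ⟨hu.1.trans_le hτ.1, hτ.2.trans_lt (hs.2.trans_le (min_le_left _ _))⟩
  have hσt := hσ t₀ ht₀
  by_cases h0 : (y t₀).2.1 = 0
  swap
  · exact hcaseA ((hσt.continuousAt.eventually_ne h0).filter_mono nhdsWithin_le_nhds)
  by_cases h1 : sigmaVel G α K₀ K f y t₀ = 0
  swap
  · refine hcaseA ?_
    have := hσt.eventually_ne (c := (y t₀).2.1) h1
    rw [h0] at this
    exact this.filter_mono (nhdsWithin_mono _ fun s (hs : t₀ < s) => hs.ne')
  have hVv : V t₀ < v t₀ := by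
    have h2 : gainVec α (x t₀) = Sum.elim (0 : Fin n → ℝ)
        ((y t₀).2.2 + (G.B * K.toCols₂)⁻¹ *ᵥ f t₀) := by
      rw [hgain, h0, smul_zero]
    have h3 := hslide (y t₀).1 ((y t₀).2.2 + (G.B * K.toCols₂)⁻¹ *ᵥ f t₀) (by
      rw [sigmaVel, h0, Matrix.mulVec_zero, add_zero] at h1
      change _ + _ *ᵥ gainVec α (x t₀) = 0 at h1
      rwa [h2, toCols_mulVec, Matrix.mulVec_zero, Matrix.mulVec_zero, zero_add] at h1)
    rw [← h2] at h3
    change (ρ + l₃) * V t₀ ≤ ρ * v t₀ at h3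
    by_contra hle
    rw [not_lt] at hle
    have h4 : 0 < V t₀ := by
      rw [hνmax] at hpos
      simpa [max_eq_right hle] using hpos
    have h5 := mul_le_mul_of_nonneg_left hle hF.rho_pos.le
    have h6 := mul_pos hl₃ h4
    linarith
  have hev : ∀ᶠ s in 𝓝 t₀, V s < v s :=
    (hVc.continuousAt (Icc_mem_nhds ht₀.1 ht₀.2)).eventually_lt
      (hvc.continuousAt (Icc_mem_nhds ht₀.1 ht₀.2)) hVv
  obtain ⟨c, hc, hsub⟩ := (mem_nhdsGT_iff_exists_Ioo_subset' ht₀.2).1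
    (hev.filter_mono nhdsWithin_le_nhds)
  filter_upwards [Ioo_mem_nhdsGT (lt_min hc ht₀.2)] with s hs
  have hsc : s < c := hs.2.trans_le (min_le_left _ _)
  have hsb : s < b := hs.2.trans_le (min_le_right _ _)
  have key : v s + Q s ≤ v t₀ + Q t₀ := by
    refine ac_le_of_deriv_nonpos (W := fun τ => v τ + Q τ) hs.1.le
      ((hvac.mono ?_).fun_add (hQac t₀ s)) (Eventually.of_forall fun τ hτ => ?_)
    · rw [uIcc_of_le hs.1.le, uIcc_of_le hb]
      exact Icc_subset_Icc ht₀.1.le hsb.le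
    · have hτI : τ ∈ Ioo 0 b := ⟨ht₀.1.trans hτ.1, hτ.2.trans hsb⟩
      obtain ⟨d, hd, hd'⟩ := hvd τ hτI
      refine ⟨_, ?_, hd.add (hQd τ)⟩
      have hle : V τ ≤ v τ := le_of_lt (hsub ⟨hτ.1, hτ.2.trans hsc⟩)
      have hpτ : p τ = l * v τ + ξ τ := by
        rw [hpe τ (Ioo_subset_Icc_self hτI), hνmax]
        simp only [max_eq_left hle, hξ]
      have h1 := mul_le_mul_of_nonneg_left hle hF.rho_pos.le
      have h2 := mul_le_mul_of_nonneg_right hl2 (hv0 τ)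
      linarith
  have hVs : V s ≤ v s := le_of_lt (hsub ⟨hs.1, hsc⟩)
  rw [hνmax]
  simp only [max_eq_left hVs, max_eq_left hVv.le]
  linarith

theorem continuousOn_nuAlong {G : Plant r n m} {α : ℝ} (hα : 0 < α)
    (K : Matrix (Fin m) (Fin n ⊕ Fin n) ℝ) (S : Matrix (Fin r) (Fin r) ℝ)
    (P : Matrix (Fin n ⊕ Fin n) (Fin n ⊕ Fin n) ℝ) {f : ℝ → Fin n → ℝ} {y : ℝ → State r n} {b : ℝ}
    (hf : ContinuousOn f (Icc 0 b)) (hy : ContinuousOn y (Icc 0 b)) :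
    ContinuousOn (nuAlong G α K S P f y) (Icc 0 b) := by
  have h1 : Continuous fun s : State r n => vFun S s.1 := by
    unfold vFun
    fun_prop
  exact (h1.comp_continuousOn hy).sup
    ((continuous_VFun hα P).comp_continuousOn (continuousOn_xState hf hy))

theorem continuousOn_output_sq (H : Matrix (Fin q) (Fin r) ℝ) (J : Matrix (Fin q) (Fin m) ℝ)
    (K₀ : Matrix (Fin m) (Fin r) ℝ) {y : ℝ → State r n} {s : Set ℝ} (hy : ContinuousOn y s) :
    ContinuousOn (fun t => output H J K₀ (y t).1 ⬝ᵥ output H J K₀ (y t).1) s := by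
  have h1 : Continuous fun s : State r n => output H J K₀ s.1 ⬝ᵥ output H J K₀ s.1 := by
    unfold output
    fun_prop
  exact h1.comp_continuousOn hy

/-- Along solutions on `[0, T)`, `ν` does not increase, and its initial value bounds both the cost
and, up to a factor, the product of time and `ν`. -/
theorem dissipation {G : Plant r n m} {H : Matrix (Fin q) (Fin r) ℝ}
    {J : Matrix (Fin q) (Fin m) ℝ} {γ : ℝ} {K₀ : Matrix (Fin m) (Fin r) ℝ}
    {K : Matrix (Fin m) (Fin n ⊕ Fin n) ℝ} {α ρ μ β ϖ κ : ℝ} {S : Matrix (Fin r) (Fin r) ℝ}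
    {P : Matrix (Fin n ⊕ Fin n) (Fin n ⊕ Fin n) ℝ} (hγ : 0 < γ)
    (hF : Feasible G H J γ K₀ K α ρ μ β ϖ κ S P) :
    ∃ l > 0, ∀ (f : ℝ → Fin n → ℝ), Admissible G K γ f → ∀ (T : EReal) (y : ℝ → State r n),
      IsFilippovSolution (closedLoop G α K₀ K f) T y → ∀ b : ℝ, 0 ≤ b → (b : EReal) < T →
      (∀ s ∈ Icc 0 b, nuAlong G α K S P f y b ≤ nuAlong G α K S P f y s) ∧
      ∫ t in 0..b, output H J K₀ (y t).1 ⬝ᵥ output H J K₀ (y t).1 ≤ nuAlong G α K S P f y 0 ∧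
      l * b * nuAlong G α K S P f y b ≤ nuAlong G α K S P f y 0 := by
  obtain ⟨l, hl, h⟩ := eventually_nuAlong_le hγ hF
  refine ⟨l, hl, fun f hf T y hy b hb hbT => ?_⟩
  have hyc := hy.continuousOn hb hbT
  have hνc : ContinuousOn (nuAlong G α K S P f y) (Icc 0 b) :=
    continuousOn_nuAlong hF.alpha_pos K S P (hf.continuousOn.mono Icc_subset_Ici_self) hyc
  have hξc := continuousOn_output_sq H J K₀ hyc
  have hν0 : ∀ t, 0 ≤ nuAlong G α K S P f y t := fun t => nuFun_nonneg hF.S_pos _ _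
  set p₀ : ℝ → ℝ := fun t => l * nuAlong G α K S P f y t
        + output H J K₀ (y t).1 ⬝ᵥ output H J K₀ (y t).1 with hp₀
  have hp₀c : ContinuousOn p₀ (Icc 0 b) := (continuousOn_const.mul hνc).add hξc
  set p : ℝ → ℝ := IccExtend hb ((Icc 0 b).domRestrict p₀) with hp
  have hpc : Continuous p := (continuousOn_iff_continuous_domRestrict.1 hp₀c).Icc_extend'
  have hpe : ∀ s ∈ Icc 0 b, p s = p₀ s := fun s hs => by
    rw [hp, IccExtend_of_mem _ _ hs]; rfl
  have hp0 : ∀ t, 0 ≤ p t := fun t =>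
    add_nonneg (mul_nonneg hl.le (hν0 _)) (dotProduct_self_nonneg' _)
  have hpz : ∀ t ∈ Icc 0 b, nuAlong G α K S P f y t = 0 → p t = 0 := by
    intro t ht h0
    have h1 : vFun S (y t).1 ≤ 0 := (le_max_left _ _).trans h0.le
    have hζ : (y t).1 = 0 := by
      by_contra hne
      have := hF.S_pos.dotProduct_mulVec_pos hne
      simp only [star_trivial] at this
      exact absurd h1 (not_le.2 this)
    rw [hpe t ht, hp₀]
    simp [h0, hζ, output]
  have hres := dissipation_of_local hb hνc (fun t _ => hν0 t) hpc hp0 hpz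
    (h f hf T y hy b hb hbT p hpc hpe)
  have hint : ∫ t in 0..b, p₀ t = ∫ t in 0..b, p t := by
    refine intervalIntegral.integral_congr fun t ht => ?_
    rw [uIcc_of_le hb] at ht
    exact (hpe t ht).symm
  have hI₀ : IntervalIntegrable p₀ volume 0 b := hp₀c.intervalIntegrable_of_Icc hb
  have hξ0 : ∀ t, 0 ≤ output H J K₀ (y t).1 ⬝ᵥ output H J K₀ (y t).1 := fun t =>
    dotProduct_self_nonneg' _
  have hb0 := hν0 b
  refine ⟨hres.1, ?_, ?_⟩
  · have h1 : ∫ t in 0..b, output H J K₀ (y t).1 ⬝ᵥ output H J K₀ (y t).1 ≤ ∫ t in 0..b, p₀ t :=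
      intervalIntegral.integral_mono_on hb (hξc.intervalIntegrable_of_Icc hb) hI₀ fun t _ =>
        le_add_of_nonneg_left (mul_nonneg hl.le (hν0 t))
    linarith [hres.2]
  · have h1 : ∫ _t in 0..b, l * nuAlong G α K S P f y b ≤ ∫ t in 0..b, p₀ t :=
      intervalIntegral.integral_mono_on hb intervalIntegrable_const hI₀ fun t ht =>
        (mul_le_mul_of_nonneg_left (hres.1 t ht) hl.le).trans (le_add_of_nonneg_right (hξ0 t))
    rw [intervalIntegral.integral_const, smul_eq_mul, sub_zero] at h1
    linarith [hres.2]

/-! ### Stability and the guaranteed cost -/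

/-- `ν` is proper: it dominates a multiple of the squared norm of `(ζ, x)`, because `c(σ) ≥ α`. -/
theorem nuFun_coercive {α : ℝ} (hα : 0 < α) {S : Matrix (Fin r) (Fin r) ℝ}
    {P : Matrix (Fin n ⊕ Fin n) (Fin n ⊕ Fin n) ℝ} (hS : S.PosDef) (hP : P.PosDef) :
    ∃ k > 0, ∀ (ζ : Fin r → ℝ) (x : Fin n ⊕ Fin n → ℝ), k * ‖(ζ, x)‖ ^ 2 ≤ nuFun α S P ζ x := by
  obtain ⟨a, ha, hS'⟩ := posDef_coercive hS
  obtain ⟨b, hb, hP'⟩ := posDef_coercive hP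
  have hsq : ∀ {ι : Type} [Fintype ι] (v : ι → ℝ), ‖v‖ ^ 2 ≤ v ⬝ᵥ v := fun v => by
    rw [← euclNorm_sq]
    have := norm_le_euclNorm v
    gcongr
  set d := 1 + α⁻¹ with hd
  have hd0 : 0 < d := by positivity
  refine ⟨min a (b / d ^ 2), by positivity, fun ζ x => ?_⟩
  have h1 : a * ‖ζ‖ ^ 2 ≤ nuFun α S P ζ x :=
    (mul_le_mul_of_nonneg_left (hsq ζ) ha.le).trans ((hS' ζ).trans (le_max_left _ _))
  have hx : ‖x‖ ≤ d * ‖gainVec α x‖ := by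
    refine (pi_norm_le_iff_of_nonneg (by positivity)).2 fun i => ?_
    have hi := norm_le_pi_norm (gainVec α x) i
    have hg := norm_nonneg (gainVec α x)
    rcases i with i | i
    · have e : gainVec α x (Sum.inl i) = cFun α (x ∘ Sum.inl) * x (Sum.inl i) := rfl
      have hc := le_cFun α (x ∘ Sum.inl)
      rw [e, norm_mul, Real.norm_of_nonneg (hα.le.trans hc)] at hi
      have h2 : α * ‖x (Sum.inl i)‖ ≤ ‖gainVec α x‖ :=
        (mul_le_mul_of_nonneg_right hc (norm_nonneg _)).trans hi
      have h3 : ‖x (Sum.inl i)‖ ≤ α⁻¹ * ‖gainVec α x‖ := by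
        rwa [le_inv_mul_iff₀ hα]
      rw [hd, add_mul]
      linarith
    · have e : gainVec α x (Sum.inr i) = x (Sum.inr i) := rfl
      rw [e] at hi
      have : 0 ≤ α⁻¹ * ‖gainVec α x‖ := by positivity
      rw [hd, add_mul]
      linarith
  have h2 : b / d ^ 2 * ‖x‖ ^ 2 ≤ nuFun α S P ζ x := by
    calc b / d ^ 2 * ‖x‖ ^ 2 ≤ b / d ^ 2 * (d * ‖gainVec α x‖) ^ 2 := by gcongr
      _ = b * ‖gainVec α x‖ ^ 2 := by field_simp
      _ ≤ b * (gainVec α x ⬝ᵥ gainVec α x) := by gcongr; exact hsq _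
      _ ≤ VFun α P x := by rw [VFun_eq]; exact hP' _
      _ ≤ _ := le_max_right _ _
  rw [Prod.norm_def]
  rcases max_choice ‖ζ‖ ‖x‖ with h | h <;> simp only [h]
  · exact (mul_le_mul_of_nonneg_right (min_le_left _ _) (sq_nonneg _)).trans h1
  · exact (mul_le_mul_of_nonneg_right (min_le_right _ _) (sq_nonneg _)).trans h2

theorem continuous_nuFun {α : ℝ} (hα : 0 < α) (S : Matrix (Fin r) (Fin r) ℝ)
    (P : Matrix (Fin n ⊕ Fin n) (Fin n ⊕ Fin n) ℝ) :
    Continuous fun s : (Fin r → ℝ) × (Fin n ⊕ Fin n → ℝ) => nuFun α S P s.1 s.2 := by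
  have h1 : Continuous fun s : (Fin r → ℝ) × (Fin n ⊕ Fin n → ℝ) => vFun S s.1 := by
    unfold vFun
    fun_prop
  exact h1.max ((continuous_VFun hα P).comp continuous_snd)

theorem globallyAsymptoticallyStable_of_feasible {G : Plant r n m} {H : Matrix (Fin q) (Fin r) ℝ}
    {J : Matrix (Fin q) (Fin m) ℝ} {γ : ℝ} {K₀ : Matrix (Fin m) (Fin r) ℝ}
    {K : Matrix (Fin m) (Fin n ⊕ Fin n) ℝ} {α ρ μ β ϖ κ : ℝ} {S : Matrix (Fin r) (Fin r) ℝ}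
    {P : Matrix (Fin n ⊕ Fin n) (Fin n ⊕ Fin n) ℝ} (hγ : 0 < γ)
    (hF : Feasible G H J γ K₀ K α ρ μ β ϖ κ S P) : GloballyAsymptoticallyStable G α γ K₀ K := by
  obtain ⟨l, hl, hdiss⟩ := dissipation hγ hF
  obtain ⟨k, hk, hco⟩ := nuFun_coercive hF.alpha_pos hF.S_pos hF.P_pos
  have hα := hF.alpha_pos
  have hexist : ∀ f, Admissible G K γ f → ∀ s₀ : State r n,
      ∃ y, IsFilippovSolution (closedLoop G α K₀ K f) ⊤ y ∧ y 0 = s₀ := fun f hf s₀ => by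
    obtain ⟨y, hy0, hyL, hy⟩ := exists_lipschitz_solution G hα K₀ K hf.continuousOn s₀
    exact ⟨y, isFilippovSolution_of_lipschitz hyL (Eventually.of_forall hy), hy0⟩
  refine ⟨hexist, ?_, ?_, ?_⟩
  · intro f hf T y hy
    induction T using EReal.rec with
    | bot =>
      obtain ⟨Y, hY, -⟩ := hexist f hf 0
      exact ⟨Y, hY, fun t _ ht => absurd ht not_lt_bot⟩
    | top => exact ⟨y, hy, fun _ _ _ => rfl⟩
    | coe T =>
      rcases le_or_gt T 0 with hT | hT
      · obtain ⟨Y, hY, -⟩ := hexist f hf 0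
        exact ⟨Y, hY, fun t h0 ht => absurd (EReal.coe_lt_coe_iff.1 ht) (by linarith)⟩
      obtain ⟨F, hFb⟩ := isCompact_Icc.exists_bound_of_continuousOn
        (hf.continuousOn.mono (Icc_subset_Ici_self : Icc 0 T ⊆ Ici 0))
      obtain ⟨M, hM0, hM⟩ := exists_mulVec_le (G.B * K.toCols₂)⁻¹
      set R := Real.sqrt (nuAlong G α K S P f y 0 / k) with hR
      have hbound : ∀ t ∈ Ico 0 T, ‖y t‖ ≤ R + M * |F| := by
        intro t ht
        have h1 := (hdiss f hf T y hy t ht.1 (EReal.coe_lt_coe_iff.2 ht.2)).1 0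
          ⟨le_rfl, ht.1⟩
        have h2 : ‖((y t).1, xState G K f t (y t))‖ ≤ R := by
          refine Real.le_sqrt_of_sq_le ?_
          rw [le_div_iff₀ hk, mul_comm]
          exact (hco _ _).trans h1
        have hpos : 0 ≤ M * |F| := by positivity
        have hζ : ‖(y t).1‖ ≤ R :=
          (norm_fst_le ((y t).1, xState G K f t (y t))).trans h2
        have hx : ‖xState G K f t (y t)‖ ≤ R :=
          (norm_snd_le ((y t).1, xState G K f t (y t))).trans h2
        have hR0 : 0 ≤ R := Real.sqrt_nonneg _
        have hσ : ‖(y t).2.1‖ ≤ R := (pi_norm_le_iff_of_nonneg hR0).2 fun i =>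
          (norm_le_pi_norm (xState G K f t (y t)) (Sum.inl i)).trans hx
        have hz : ‖(y t).2.2 + (G.B * K.toCols₂)⁻¹ *ᵥ f t‖ ≤ R :=
          (pi_norm_le_iff_of_nonneg hR0).2 fun i =>
            (norm_le_pi_norm (xState G K f t (y t)) (Sum.inr i)).trans hx
        have hη : ‖(y t).2.2‖ ≤ R + M * |F| := by
          have e : (y t).2.2 = ((y t).2.2 + (G.B * K.toCols₂)⁻¹ *ᵥ f t)
              - (G.B * K.toCols₂)⁻¹ *ᵥ f t := by abel
          rw [e]
          refine (norm_sub_le _ _).trans (add_le_add hz ((hM _).trans ?_))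
          exact mul_le_mul_of_nonneg_left
            ((hFb t ⟨ht.1, ht.2.le⟩).trans (le_abs_self F)) hM0
        rw [norm_prod_le_iff, norm_prod_le_iff]
        exact ⟨by linarith, by linarith, hη⟩
      obtain ⟨Y, hY, hYy⟩ := exists_extension G hα K₀ K hf.continuousOn hT hy hbound
      exact ⟨Y, hY, fun t h0 ht => hYy t ⟨h0, EReal.coe_lt_coe_iff.1 ht⟩⟩
  · intro ε hε
    have hlim := (continuous_nuFun hα S P).tendsto 0
    have h0 : nuFun α S P (0 : (Fin r → ℝ) × (Fin n ⊕ Fin n → ℝ)).1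
        (0 : (Fin r → ℝ) × (Fin n ⊕ Fin n → ℝ)).2 = 0 := by
      simp [nuFun, vFun, VFun]
    obtain ⟨δ, hδ, hsub⟩ := Metric.eventually_nhds_iff.1
      (hlim.eventually_lt_const (u := k * ε ^ 2) (by rw [h0]; positivity))
    refine ⟨δ, hδ, fun f hf y hy hy0 t ht => ?_⟩
    have h1 : nuAlong G α K S P f y 0 < k * ε ^ 2 :=
      hsub (y := ((y 0).1, xState G K f 0 (y 0))) (by rwa [dist_zero_right])
    have h2 := (hdiss f hf ⊤ y hy t ht (EReal.coe_lt_top t)).1 0 ⟨le_rfl, ht⟩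
    have h3 := (hco (y t).1 (xState G K f t (y t))).trans_lt (lt_of_le_of_lt h2 h1)
    exact lt_of_pow_lt_pow_left₀ 2 hε.le (lt_of_mul_lt_mul_left h3 hk.le)
  · intro f hf y hy
    rw [tendsto_zero_iff_norm_tendsto_zero]
    set c := nuAlong G α K S P f y 0
    have h1 : Tendsto (fun t : ℝ => Real.sqrt (c / (l * k) * t⁻¹)) atTop (𝓝 0) := by
      have := ((tendsto_inv_atTop_zero (𝕜 := ℝ)).const_mul (c / (l * k))).sqrt
      simpa using this
    refine squeeze_zero' (Eventually.of_forall fun t => norm_nonneg _) ?_ h1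
    filter_upwards [eventually_gt_atTop 0] with t ht
    refine Real.le_sqrt_of_sq_le ?_
    have h2 := (hdiss f hf ⊤ y hy t ht.le (EReal.coe_lt_top t)).2.2
    have h3 := mul_le_mul_of_nonneg_left (hco (y t).1 (xState G K f t (y t)))
      (by positivity : 0 ≤ l * t)
    have h4 := h3.trans h2
    rw [← div_eq_mul_inv, div_div, le_div_iff₀ (by positivity)]
    calc _ = l * t * (k * ‖((y t).1, xState G K f t (y t))‖ ^ 2) := by ring
      _ ≤ c := h4

theorem worstCaseCost_le_of_feasible {G : Plant r n m} {H : Matrix (Fin q) (Fin r) ℝ}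
    {J : Matrix (Fin q) (Fin m) ℝ} {γ : ℝ} {K₀ : Matrix (Fin m) (Fin r) ℝ}
    {K : Matrix (Fin m) (Fin n ⊕ Fin n) ℝ} {α ρ μ β ϖ κ : ℝ} {S : Matrix (Fin r) (Fin r) ℝ}
    {P : Matrix (Fin n ⊕ Fin n) (Fin n ⊕ Fin n) ℝ} (hγ : 0 < γ)
    (hF : Feasible G H J γ K₀ K α ρ μ β ϖ κ S P) (ζ₀ : Fin r → ℝ) (x₀ : Fin n ⊕ Fin n → ℝ) :
    worstCaseCost G H J α γ K₀ K ζ₀ x₀ ≤ ENNReal.ofReal (nuFun α S P ζ₀ x₀) := by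
  obtain ⟨l, hl, hdiss⟩ := dissipation hγ hF
  refine iSup_le fun f => iSup_le fun hf => iSup_le fun y => iSup_le fun hy => iSup_le fun hy0 => ?_
  have hν : nuAlong G α K S P f y 0 = nuFun α S P ζ₀ x₀ := by
    rw [nuAlong, hy0.1, hy0.2]
  have hU : Ioi (0 : ℝ) = ⋃ N : ℕ, Ioc (0 : ℝ) N := by
    ext t
    simp only [mem_Ioi, mem_iUnion, mem_Ioc, exists_and_left]
    exact ⟨fun h => ⟨h, exists_nat_ge t⟩, fun h => h.1⟩
  have hdir : Directed (· ⊆ ·) fun N : ℕ => Ioc (0 : ℝ) N :=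
    (monotone_nat_of_le_succ fun N => Ioc_subset_Ioc_right (by simp)).directed_le
  rw [hU, setLIntegral_iUnion_of_directed _ hdir]
  refine iSup_le fun N => ?_
  have hN : (0 : ℝ) ≤ N := Nat.cast_nonneg N
  have hc := continuousOn_output_sq H J K₀ (hy.continuousOn hN (EReal.coe_lt_top N))
  have hint : IntegrableOn (fun t => output H J K₀ (y t).1 ⬝ᵥ output H J K₀ (y t).1)
      (Ioc (0 : ℝ) N) := (hc.integrableOn_Icc).mono_set Ioc_subset_Icc_self
  rw [← ofReal_integral_eq_lintegral_ofReal hint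
    (Eventually.of_forall fun t => dotProduct_self_nonneg' _),
    ← intervalIntegral.integral_of_le hN, ← hν]
  exact ENNReal.ofReal_le_ofReal (hdiss f hf ⊤ y hy N hN (EReal.coe_lt_top N)).2.1

theorem isGLB_guaranteedCosts {G : Plant r n m} {H : Matrix (Fin q) (Fin r) ℝ}
    {J : Matrix (Fin q) (Fin m) ℝ} {γ : ℝ} {K₀ : Matrix (Fin m) (Fin r) ℝ}
    {K : Matrix (Fin m) (Fin n ⊕ Fin n) ℝ} (ζ₀ : Fin r → ℝ) (x₀ : Fin n ⊕ Fin n → ℝ)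
    (hfeas : ∃ α ρ μ β ϖ κ S P, Feasible G H J γ K₀ K α ρ μ β ϖ κ S P) :
    IsGLB (guaranteedCosts G H J γ K₀ K ζ₀ x₀) (rhoRobSq G H J γ K₀ K ζ₀ x₀) := by
  obtain ⟨α, ρ, μ, β, ϖ, κ, S, P, hF⟩ := hfeas
  refine isGLB_csInf ⟨_, α, ρ, μ, β, ϖ, κ, S, P, hF, rfl⟩ ⟨0, ?_⟩
  rintro _ ⟨α, ρ, μ, β, ϖ, κ, S, P, hF, rfl⟩
  exact nuFun_nonneg hF.S_pos _ _

end MGSTA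

theorem mainTheorem3 {r n m q : ℕ} (G : MGSTA.Plant r n m)
    (H : Matrix (Fin q) (Fin r) ℝ) (J : Matrix (Fin q) (Fin m) ℝ)
    (γ : ℝ) (hγ : 0 < γ)
    (K₀ : Matrix (Fin m) (Fin r) ℝ) (K : Matrix (Fin m) (Fin n ⊕ Fin n) ℝ)
    (ζ₀ : Fin r → ℝ) (x₀ : Fin n ⊕ Fin n → ℝ)
    (hfeas : ∃ α ρ μ β ϖ κ S P, MGSTA.Feasible G H J γ K₀ K α ρ μ β ϖ κ S P) :
    (∀ α ρ μ β ϖ κ S P, MGSTA.Feasible G H J γ K₀ K α ρ μ β ϖ κ S P →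
      MGSTA.GloballyAsymptoticallyStable G α γ K₀ K ∧
      MGSTA.worstCaseCost G H J α γ K₀ K ζ₀ x₀ ≤ ENNReal.ofReal (MGSTA.nuFun α S P ζ₀ x₀)) ∧
    IsGLB (MGSTA.guaranteedCosts G H J γ K₀ K ζ₀ x₀) (MGSTA.rhoRobSq G H J γ K₀ K ζ₀ x₀) ∧
    (∀ ε : ℝ, 0 < ε → ∃ α ρ μ β ϖ κ S P, MGSTA.Feasible G H J γ K₀ K α ρ μ β ϖ κ S P ∧
      MGSTA.GloballyAsymptoticallyStable G α γ K₀ K ∧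
      MGSTA.worstCaseCost G H J α γ K₀ K ζ₀ x₀ ≤
        ENNReal.ofReal (MGSTA.rhoRobSq G H J γ K₀ K ζ₀ x₀ + ε)) := by
  refine ⟨fun α ρ μ β ϖ κ S P hF =>
    ⟨MGSTA.globallyAsymptoticallyStable_of_feasible hγ hF,
      MGSTA.worstCaseCost_le_of_feasible hγ hF ζ₀ x₀⟩,
    MGSTA.isGLB_guaranteedCosts ζ₀ x₀ hfeas, fun ε hε => ?_⟩
  obtain ⟨_, ⟨α, ρ, μ, β, ϖ, κ, S, P, hF, rfl⟩, -, hlt⟩ :=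
    (MGSTA.isGLB_guaranteedCosts ζ₀ x₀ hfeas).exists_between (lt_add_of_pos_right _ hε)
  exact ⟨α, ρ, μ, β, ϖ, κ, S, P, hF, MGSTA.globallyAsymptoticallyStable_of_feasible hγ hF,
    (MGSTA.worstCaseCost_le_of_feasible hγ hF ζ₀ x₀).trans (ENNReal.ofReal_le_ofReal hlt.le)⟩
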